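/- Let $\Bbbk$ be a field of characteristic different from $2$, let $q\in\Bbbk^\times$ be not a root of unity, and let $\delta=-(q-q^{-1})$. A supercategory is a $\Bbbk$-linear category whose morphism spaces are $\mathbb Z/2$-graded, with composition preserving the grading; in a monoidal supercategory the tensor product of morphisms is bilinear, preserves the grading, and satisfies the super interchange law $(f\otimes g)\circ(h\otimes l)=(-1)^{|g||h|}(f\circ h)\otimes(g\circ l)$ for homogeneous morphisms. Let $\mathcal{STL}(\delta)$ be the odd Temperley–Lieb supercategory: the strict monoidal supercategory with one generating object $\cdot$ and two odd generating morphisms $\mathrm{cup}:\mathbb 1\to\cdot\otimes\cdot$ and $\mathrm{cap}:\cdot\otimes\cdot\to\mathbb 1$, subject to the relations $$(\mathrm{cap}\otimes 1)\circ(1\otimes\mathrm{cup})=1,\qquad (1\otimes\mathrm{cap})\circ(\mathrm{cup}\otimes 1)=-1,\qquad \mathrm{cap}\circ\mathrm{cup}=\delta .$$ For a monoidal supercategory $\mathcal A$, its $\Pi$-envelope $\mathcal A_\pi$ has objects $\Pi^aX$ for $a\in\mathbb Z/2$ and $X\in\mathcal A$; a homogeneous morphism $f:X\to Y$ of $\mathcal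 A$ gives a morphism $f_a^b:\Pi^aX\to\Pi^bY$ of parity $a+b+|f|$, with $g_b^c\circ f_a^b=(g\circ f)_a^c$, $\Pi^aX\otimes\Pi^bY=\Pi^{a+b}(X\otimes Y)$ and $f_a^b\otimes g_c^d=(-1)^{a|g|+|f|d+ad+ac}(f\otimes g)_{a+c}^{b+d}$. Let $\operatorname{SKar}(\mathcal A)$ be the additive Karoubi envelope (the idempotent completion of the additive envelope) of the category with the same objects as $\mathcal A_\pi$ and the even morphisms of $\mathcal A_\pi$; it is a monoidal category, with a distinguished object $\pi=\Pi^1\mathbb 1$. Let $K_0(\operatorname{SKar}(\mathcal A))$ be its split Grothendieck ring, with $[V]+[W]=[V\oplus W]$ and $[V][W]=[V\otimes W]$. Then: 1. $\operatorname{SKar}(\mathcal{STL}(\delta))$ is a semisimple Abelian category (it is Abelian, and every object is a finite direct sum of simple objects). 2. The classes of the simple objects, one for each isomorphism class, form a $\mathbb Z$-basis of $K_0(\operatorname{SKar}(\mathcal{STL}(\delta)))$. 3. Let $\mathbb Z^\pi=\mathbb Z[\pi]/(\pi^2-1)$, and in $\mathbb Z^\pi[x,x^{-1}]$ let $[n+1]_{x,\pi}=x^n+\pi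 x^{n-2}+\cdots+\pi^n x^{-n}$. The elements $[n+1]_{x,\pi}$ and $\pi[n+1]_{x,\pi}$ $(n\in\mathbb N=\{0,1,2,\dots\})$ are linearly independent over $\mathbb Z$, their $\mathbb Z$-span is a subring $R$ of $\mathbb Z^\pi[x,x^{-1}]$, and there is a ring isomorphism $K_0(\operatorname{SKar}(\mathcal{STL}(\delta)))\cong R$ that maps the set of classes of simple objects bijectively onto $\{[n+1]_{x,\pi},\ \pi[n+1]_{x,\pi}\mid n\in\mathbb N\}$ and maps $[\pi]$ to $\pi$. -/

import Mathlib

open CategoryTheory CategoryTheory.Limits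

noncomputable section

/-! ### Supercategories -/

/-- The sign `(-1)^a` attached to a parity `a`, as a scalar. -/
def ssign (k : Type*) [Ring k] (a : ZMod 2) : k := (-1) ^ a.val

lemma ssign_zero (k : Type*) [Ring k] : ssign k 0 = 1 := by simp [ssign]

lemma ssign_add (k : Type*) [Ring k] (a b : ZMod 2) :
    ssign k (a + b) = ssign k a * ssign k b := by
  simp only [ssign, ZMod.val_add, ← neg_one_pow_eq_pow_mod_two, pow_add]

/-- A supercategory over `k`: a `k`-linear category whose morphism spaces are superspaces
(the part of parity `p` is `part X Y p`), with even identities and with composition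
inducing an even linear map. -/
class Supercategory (k : Type*) [Field k] (C : Type*) [Category* C] [Preadditive C]
    [Linear k C] where
  part : ∀ X Y : C, ZMod 2 → Submodule k (X ⟶ Y)
  isInternal : ∀ X Y : C, DirectSum.IsInternal (part X Y)
  id_mem : ∀ X : C, 𝟙 X ∈ part X X 0
  comp_mem : ∀ {X Y Z : C} {a b : ZMod 2} {f : X ⟶ Y} {g : Y ⟶ Z},
    f ∈ part X Y a → g ∈ part Y Z b → f ≫ g ∈ part X Z (a + b)

/-- The part of parity `p` of a morphism space of a supercategory. -/
abbrev homPart (k : Type*) [Field k] {C : Type*} [Category* C] [Preadditive C] [Linear k C]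
    [Supercategory k C] (X Y : C) (p : ZMod 2) : Submodule k (X ⟶ Y) :=
  Supercategory.part X Y p

open Supercategory

/-- A monoidal supercategory: a tensor product that is bilinear, preserves parities and satisfies
the super interchange law, a unit object, and even coherence isomorphisms satisfying the usual
axioms.  Recall that `f ≫ g` is `g ∘ f`. -/
class MonoidalSupercategory (k : Type*) [Field k] (C : Type*) [Category* C] [Preadditive C]
    [Linear k C] [Supercategory k C] where
  tObj : C → C → C
  tHom : ∀ {X₁ Y₁ X₂ Y₂ : C},
    (X₁ ⟶ Y₁) →ₗ[k] (X₂ ⟶ Y₂) →ₗ[k] (tObj X₁ X₂ ⟶ tObj Y₁ Y₂)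
  tHom_mem : ∀ {X₁ Y₁ X₂ Y₂ : C} {a b : ZMod 2} {f : X₁ ⟶ Y₁} {g : X₂ ⟶ Y₂},
    f ∈ homPart k X₁ Y₁ a → g ∈ homPart k X₂ Y₂ b →
      tHom f g ∈ homPart k (tObj X₁ X₂) (tObj Y₁ Y₂) (a + b)
  tHom_id : ∀ X Y : C, tHom (𝟙 X) (𝟙 Y) = 𝟙 (tObj X Y)
  /-- `(f ⊗ g) ∘ (h ⊗ l) = (-1)^{|g||h|} (f ∘ h) ⊗ (g ∘ l)` -/
  super_interchange : ∀ {X₁ Y₁ Z₁ X₂ Y₂ Z₂ : C} {a b : ZMod 2}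
    (h : X₁ ⟶ Y₁) (l : X₂ ⟶ Y₂) (f : Y₁ ⟶ Z₁) (g : Y₂ ⟶ Z₂),
    h ∈ homPart k X₁ Y₁ a → g ∈ homPart k Y₂ Z₂ b →
      tHom h l ≫ tHom f g = ssign k (b * a) • tHom (h ≫ f) (l ≫ g)
  tUnit : C
  assoc : ∀ X Y Z : C, tObj (tObj X Y) Z ≅ tObj X (tObj Y Z)
  lunit : ∀ X : C, tObj tUnit X ≅ X
  runit : ∀ X : C, tObj X tUnit ≅ X
  assoc_hom_mem : ∀ X Y Z : C, (assoc X Y Z).hom ∈ homPart k _ _ 0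
  assoc_inv_mem : ∀ X Y Z : C, (assoc X Y Z).inv ∈ homPart k _ _ 0
  lunit_hom_mem : ∀ X : C, (lunit X).hom ∈ homPart k _ _ 0
  lunit_inv_mem : ∀ X : C, (lunit X).inv ∈ homPart k _ _ 0
  runit_hom_mem : ∀ X : C, (runit X).hom ∈ homPart k _ _ 0
  runit_inv_mem : ∀ X : C, (runit X).inv ∈ homPart k _ _ 0
  assoc_naturality : ∀ {X₁ X₂ X₃ Y₁ Y₂ Y₃ : C} (f₁ : X₁ ⟶ Y₁) (f₂ : X₂ ⟶ Y₂) (f₃ : X₃ ⟶ Y₃),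
    tHom (tHom f₁ f₂) f₃ ≫ (assoc Y₁ Y₂ Y₃).hom =
      (assoc X₁ X₂ X₃).hom ≫ tHom f₁ (tHom f₂ f₃)
  lunit_naturality : ∀ {X Y : C} (f : X ⟶ Y),
    tHom (𝟙 tUnit) f ≫ (lunit Y).hom = (lunit X).hom ≫ f
  runit_naturality : ∀ {X Y : C} (f : X ⟶ Y),
    tHom f (𝟙 tUnit) ≫ (runit Y).hom = (runit X).hom ≫ f
  pentagon : ∀ W X Y Z : C,
    tHom (assoc W X Y).hom (𝟙 Z) ≫ (assoc W (tObj X Y) Z).hom ≫ tHom (𝟙 W) (assoc X Y Z).hom =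
      (assoc (tObj W X) Y Z).hom ≫ (assoc W X (tObj Y Z)).hom
  triangle : ∀ X Y : C,
    (assoc X tUnit Y).hom ≫ tHom (𝟙 X) (lunit Y).hom = tHom (runit X).hom (𝟙 Y)

open MonoidalSupercategory

/-! ### The underlying category -/

/-- The underlying category of a supercategory: the same objects, only the even morphisms. -/
structure Underlying (k : Type*) (C : Type*) where
  obj : C

namespace Underlying

variable {k : Type*} [Field k] {C : Type*} [Category* C] [Preadditive C] [Linear k C]
  [Supercategory k C]

instance : Category (Underlying k C) where
  Hom X Y := homPart k X.obj Y.obj 0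
  id X := ⟨𝟙 X.obj, id_mem X.obj⟩
  comp f g := ⟨f.1 ≫ g.1, by simpa using comp_mem f.2 g.2⟩
  id_comp f := Subtype.ext (Category.id_comp f.1)
  comp_id f := Subtype.ext (Category.comp_id f.1)
  assoc f g h := Subtype.ext (Category.assoc f.1 g.1 h.1)

instance : Preadditive (Underlying k C) where
  homGroup X Y := inferInstanceAs (AddCommGroup (homPart k X.obj Y.obj 0))
  add_comp _ _ _ f f' g := Subtype.ext (Preadditive.add_comp _ _ _ f.1 f'.1 g.1)
  comp_add _ _ _ f g g' := Subtype.ext (Preadditive.comp_add _ _ _ f.1 g.1 g'.1)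

lemma hom_ext {X Y : Underlying k C} {f g : X ⟶ Y} (h : f.1 = g.1) : f = g := Subtype.ext h

end Underlying

/-! ### The `Π`-envelope -/

/-- The objects `Π^a X` of the `Π`-envelope, for `a ∈ ℤ/2` and `X` an object of `C`. -/
structure PiEnvelope (C : Type*) where
  par : ZMod 2
  obj : C

namespace PiEnvelope

variable {k : Type*} [Field k] {C : Type*} [Category* C] [Preadditive C] [Linear k C]

/-- The morphism spaces of the `Π`-envelope are those of `C` up to a shift of the grading
(see the instance of `Supercategory` below), and the composition is the one of `C`. -/
instance : Category (PiEnvelope C) where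
  Hom X Y := X.obj ⟶ Y.obj
  id X := 𝟙 X.obj
  comp f g := CategoryStruct.comp (obj := C) f g
  id_comp f := Category.id_comp (obj := C) f
  comp_id f := Category.comp_id (obj := C) f
  assoc f g h := Category.assoc (obj := C) f g h

instance : Preadditive (PiEnvelope C) where
  homGroup X Y := inferInstanceAs (AddCommGroup (X.obj ⟶ Y.obj))
  add_comp X Y Z f f' g := Preadditive.add_comp (C := C) X.obj Y.obj Z.obj f f' g
  comp_add X Y Z f g g' := Preadditive.comp_add (C := C) X.obj Y.obj Z.obj f g g'

instance : Linear k (PiEnvelope C) where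
  homModule X Y := inferInstanceAs (Module k (X.obj ⟶ Y.obj))
  smul_comp X Y Z r f g := Linear.smul_comp (C := C) X.obj Y.obj Z.obj r f g
  comp_smul X Y Z f r g := Linear.comp_smul (C := C) X.obj Y.obj Z.obj f r g

variable [Supercategory k C]

/-- A morphism `f` of `C` of parity `|f|`, regarded as a morphism `Π^a X ⟶ Π^b Y`, has parity
`a + b + |f|`; equivalently the part of parity `p` is the part of parity `a + b + p` in `C`. -/
instance : Supercategory k (PiEnvelope C) where
  part X Y p := homPart k X.obj Y.obj (X.par + Y.par + p)
  isInternal X Y := by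
    have h := isInternal (k := k) X.obj Y.obj
    rw [DirectSum.isInternal_submodule_iff_iSupIndep_and_iSup_eq_top] at h ⊢
    refine ⟨h.1.comp (add_right_injective _), ?_⟩
    rw [← h.2]
    exact (Equiv.addLeft (X.par + Y.par)).iSup_comp (g := fun p => homPart k X.obj Y.obj p)
  id_mem X := by
    have := id_mem (k := k) X.obj
    rwa [show (0 : ZMod 2) = X.par + X.par + 0 by rw [CharTwo.add_self_eq_zero, add_zero]] at this
  comp_mem {X Y Z a b f g} hf hg := by
    have := comp_mem (k := k) hf hg
    rwa [show X.par + Y.par + a + (Y.par + Z.par + b) = X.par + Z.par + (a + b) by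
      linear_combination CharTwo.add_self_eq_zero Y.par] at this

end PiEnvelope

lemma zmod_two_cases : ∀ i : ZMod 2, i = 0 ∨ i = 1 := by decide

section Homogeneous

variable (k : Type*) [Field k] {C : Type*} [Category* C] [Preadditive C] [Linear k C]
  [Supercategory k C]

lemma homPart_bijective (X Y : C) :
    Function.Bijective (DirectSum.coeLinearMap (homPart k X Y)) := isInternal X Y

/-- The projection of a morphism space of a supercategory onto its part of parity `p`. -/
def parityProj (X Y : C) (p : ZMod 2) : (X ⟶ Y) →ₗ[k] (X ⟶ Y) :=
  (homPart k X Y p).subtype ∘ₗ DirectSum.component k (ZMod 2) (fun p => homPart k X Y p) p ∘ₗ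
    (LinearEquiv.ofBijective (DirectSum.coeLinearMap (homPart k X Y))
      (homPart_bijective k X Y)).symm.toLinearMap

lemma parityProj_mem {X Y : C} (p : ZMod 2) (f : X ⟶ Y) :
    parityProj k X Y p f ∈ homPart k X Y p := by
  simp [parityProj]

lemma parityProj_of_mem {X Y : C} {p : ZMod 2} {f : X ⟶ Y} (hf : f ∈ homPart k X Y p)
    (r : ZMod 2) : parityProj k X Y r f = if r = p then f else 0 := by
  have : (LinearEquiv.ofBijective (DirectSum.coeLinearMap (homPart k X Y))
      (homPart_bijective k X Y)).symm f =
      DirectSum.lof k (ZMod 2) (fun p => homPart k X Y p) p ⟨f, hf⟩ := by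
    rw [LinearEquiv.symm_apply_eq]
    simp
  simp only [parityProj, LinearMap.comp_apply, LinearEquiv.coe_coe, this, Submodule.subtype_apply]
  rw [DirectSum.component.of]
  by_cases h : p = r
  · subst h; simp
  · simp [h, Ne.symm h]

lemma parityProj_add (X Y : C) (f : X ⟶ Y) :
    parityProj k X Y 0 f + parityProj k X Y 1 f = f := by
  obtain ⟨x, rfl⟩ := (homPart_bijective k X Y).2 f
  induction x using DirectSum.induction_on with
  | zero => simp
  | of i x =>
    have h : DirectSum.coeLinearMap (homPart k X Y) (DirectSum.of _ i x) ∈ homPart k X Y i := by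
      simp
    have h' : i = 0 ∨ i = 1 := zmod_two_cases i
    rw [parityProj_of_mem k h, parityProj_of_mem k h]
    rcases h' with rfl | rfl <;> simp
  | add x y hx hy =>
    simp only [map_add] at hx hy ⊢
    rw [add_add_add_comm, hx, hy]

variable {k} in
/-- Additive statements about morphisms can be checked on homogeneous morphisms. -/
@[elab_as_elim]
lemma homogeneous_induction {X Y : C} {P : (X ⟶ Y) → Prop} (f : X ⟶ Y)
    (hadd : ∀ f g, P f → P g → P (f + g)) (hP : ∀ p, ∀ f ∈ homPart k X Y p, P f) : P f := by
  rw [← parityProj_add k X Y f]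
  exact hadd _ _ (hP _ _ (parityProj_mem k 0 f)) (hP _ _ (parityProj_mem k 1 f))

end Homogeneous

/-! ### The monoidal structure on the underlying category -/

namespace Underlying

variable {k : Type*} [Field k] {C : Type*} [Category* C] [Preadditive C] [Linear k C]
  [Supercategory k C] [MonoidalSupercategory k C]

/-- The underlying category of a monoidal supercategory is a monoidal category. -/
instance : MonoidalCategoryStruct (Underlying k C) where
  tensorObj X Y := ⟨tObj k X.obj Y.obj⟩
  tensorHom f g := ⟨tHom (k := k) f.1 g.1, by simpa using tHom_mem (k := k) f.2 g.2⟩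
  whiskerLeft X _ _ f := ⟨tHom (k := k) (𝟙 X.obj) f.1, by simpa using tHom_mem (k := k) (id_mem X.obj) f.2⟩
  whiskerRight f Y := ⟨tHom (k := k) f.1 (𝟙 Y.obj), by simpa using tHom_mem (k := k) f.2 (id_mem Y.obj)⟩
  tensorUnit := ⟨tUnit k⟩
  associator X Y Z :=
    { hom := ⟨(assoc (k := k) X.obj Y.obj Z.obj).hom, assoc_hom_mem (k := k) _ _ _⟩
      inv := ⟨(assoc (k := k) X.obj Y.obj Z.obj).inv, assoc_inv_mem (k := k) _ _ _⟩
      hom_inv_id := hom_ext (assoc (k := k) X.obj Y.obj Z.obj).hom_inv_id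
      inv_hom_id := hom_ext (assoc (k := k) X.obj Y.obj Z.obj).inv_hom_id }
  leftUnitor X :=
    { hom := ⟨(lunit (k := k) X.obj).hom, lunit_hom_mem (k := k) _⟩
      inv := ⟨(lunit (k := k) X.obj).inv, lunit_inv_mem (k := k) _⟩
      hom_inv_id := hom_ext (lunit (k := k) X.obj).hom_inv_id
      inv_hom_id := hom_ext (lunit (k := k) X.obj).inv_hom_id }
  rightUnitor X :=
    { hom := ⟨(runit (k := k) X.obj).hom, runit_hom_mem (k := k) _⟩
      inv := ⟨(runit (k := k) X.obj).inv, runit_inv_mem (k := k) _⟩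
      hom_inv_id := hom_ext (runit (k := k) X.obj).hom_inv_id
      inv_hom_id := hom_ext (runit (k := k) X.obj).inv_hom_id }

instance : MonoidalCategory (Underlying k C) :=
  MonoidalCategory.ofTensorHom
    (id_tensorHom_id := fun X Y => hom_ext (tHom_id (k := k) X.obj Y.obj))
    (id_tensorHom := fun _ _ _ _ => rfl)
    (tensorHom_id := fun _ _ => rfl)
    (tensorHom_comp_tensorHom := fun f₁ f₂ g₁ g₂ => hom_ext (by
      have := super_interchange (k := k) f₁.1 f₂.1 g₁.1 g₂.1 f₁.2 g₂.2
      rw [mul_zero, ssign_zero, one_smul] at this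
      exact this))
    (associator_naturality := fun f₁ f₂ f₃ => hom_ext (assoc_naturality (k := k) f₁.1 f₂.1 f₃.1))
    (leftUnitor_naturality := fun f => hom_ext (lunit_naturality (k := k) f.1))
    (rightUnitor_naturality := fun f => hom_ext (runit_naturality (k := k) f.1))
    (pentagon := fun W X Y Z => hom_ext (pentagon (k := k) W.obj X.obj Y.obj Z.obj))
    (triangle := fun X Y => hom_ext (triangle (k := k) X.obj Y.obj))

instance : MonoidalPreadditive (Underlying k C) where
  whiskerLeft_zero := hom_ext (map_zero (tHom (k := k) (𝟙 _)))
  zero_whiskerRight := hom_ext (LinearMap.map_zero₂ (tHom (k := k)) (𝟙 _))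
  whiskerLeft_add f g := hom_ext (map_add (tHom (k := k) (𝟙 _)) f.1 g.1)
  add_whiskerRight f g := hom_ext (LinearMap.map_add₂ (tHom (k := k)) f.1 g.1 (𝟙 _))

end Underlying

/-! ### The monoidal structure on the `Π`-envelope -/

namespace PiEnvelope

variable {k : Type*} [Field k] {C : Type*} [Category* C] [Preadditive C] [Linear k C]
  [Supercategory k C] [MonoidalSupercategory k C]

variable (k) in
/-- The tensor product of morphisms in the `Π`-envelope: for `f : X₁ ⟶ Y₁` and `g : X₂ ⟶ Y₂`
homogeneous in `C`, regarded as morphisms `Π^a X₁ ⟶ Π^b Y₁` and `Π^c X₂ ⟶ Π^d Y₂`, it is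
`(-1)^{a|g| + |f|d + ad + ac} f ⊗ g`. -/
def tensor (a c d : ZMod 2) (X₁ Y₁ X₂ Y₂ : C) :
    (X₁ ⟶ Y₁) →ₗ[k] (X₂ ⟶ Y₂) →ₗ[k] (tObj k X₁ X₂ ⟶ tObj k Y₁ Y₂) :=
  ∑ p : ZMod 2, ∑ r : ZMod 2, ssign k (a * r + p * d + a * d + a * c) •
    (tHom (k := k)).compl₁₂ (parityProj k X₁ Y₁ p) (parityProj k X₂ Y₂ r)

lemma tensor_of_mem (a c d : ZMod 2) {X₁ Y₁ X₂ Y₂ : C} {f : X₁ ⟶ Y₁} {g : X₂ ⟶ Y₂}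
    {p r : ZMod 2} (hf : f ∈ homPart k X₁ Y₁ p) (hg : g ∈ homPart k X₂ Y₂ r) :
    tensor k a c d X₁ Y₁ X₂ Y₂ f g =
      ssign k (a * r + p * d + a * d + a * c) • tHom (k := k) f g := by
  simp only [tensor, LinearMap.sum_apply, LinearMap.smul_apply, LinearMap.compl₁₂_apply,
    parityProj_of_mem k hf, parityProj_of_mem k hg]
  rw [Finset.sum_eq_single p, Finset.sum_eq_single r]
  · simp
  · intro i _ hi; simp [hi]
  · simp
  · intro i _ hi; simp [hi]
  · simp

lemma tensor_mem (a c d : ZMod 2) {X₁ Y₁ X₂ Y₂ : C} {f : X₁ ⟶ Y₁} {g : X₂ ⟶ Y₂}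
    {p r : ZMod 2} (hf : f ∈ homPart k X₁ Y₁ p) (hg : g ∈ homPart k X₂ Y₂ r) :
    tensor k a c d X₁ Y₁ X₂ Y₂ f g ∈ homPart k (tObj k X₁ X₂) (tObj k Y₁ Y₂) (p + r) := by
  rw [tensor_of_mem a c d hf hg]
  exact Submodule.smul_mem _ _ (tHom_mem hf hg)

lemma tensor_even_id (a c : ZMod 2) {X₁ Y₁ : C} {f : X₁ ⟶ Y₁} (hf : f ∈ homPart k X₁ Y₁ 0)
    (X₂ : C) : tensor k a c c X₁ Y₁ X₂ X₂ f (𝟙 X₂) = tHom (k := k) f (𝟙 X₂) := by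
  rw [tensor_of_mem a c c hf (id_mem X₂), mul_zero, zero_mul, zero_add, zero_add,
    CharTwo.add_self_eq_zero, ssign_zero, one_smul]

lemma tensor_id_even (a : ZMod 2) {c d : ZMod 2} (hcd : c = d) {X₂ Y₂ : C} {f : X₂ ⟶ Y₂}
    (hf : f ∈ homPart k X₂ Y₂ 0) (X₁ : C) :
    tensor k a c d X₁ X₁ X₂ Y₂ (𝟙 X₁) f = tHom (k := k) (𝟙 X₁) f := by
  subst hcd
  rw [tensor_of_mem a c c (id_mem X₁) hf, mul_zero, zero_mul, zero_add, zero_add,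
    CharTwo.add_self_eq_zero, ssign_zero, one_smul]

lemma tensor_zero_left (c d : ZMod 2) {X₂ Y₂ : C} (f : X₂ ⟶ Y₂) (X₁ : C) :
    tensor k 0 c d X₁ X₁ X₂ Y₂ (𝟙 X₁) f = tHom (k := k) (𝟙 X₁) f := by
  refine homogeneous_induction (k := k) f (fun f g hf hg => ?_) (fun p f hf => ?_)
  · rw [map_add, map_add, hf, hg]
  · rw [tensor_of_mem 0 c d (id_mem X₁) hf]
    simp [ssign_zero]

lemma tensor_zero_right (a : ZMod 2) {X₁ Y₁ : C} (f : X₁ ⟶ Y₁) (X₂ : C) :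
    tensor k a 0 0 X₁ Y₁ X₂ X₂ f (𝟙 X₂) = tHom (k := k) f (𝟙 X₂) := by
  refine homogeneous_induction (k := k) f (fun f g hf hg => ?_) (fun p f hf => ?_)
  · rw [map_add, map_add, LinearMap.add_apply, LinearMap.add_apply, hf, hg]
  · rw [tensor_of_mem a 0 0 hf (id_mem X₂)]
    simp [ssign_zero]

lemma tensor_interchange (a a' c c' c'' : ZMod 2) {X₁ Y₁ Z₁ X₂ Y₂ Z₂ : C}
    (h : X₁ ⟶ Y₁) (l : X₂ ⟶ Y₂) (f : Y₁ ⟶ Z₁) (g : Y₂ ⟶ Z₂) {p r : ZMod 2}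
    (hh : h ∈ homPart k X₁ Y₁ p) (hg : g ∈ homPart k Y₂ Z₂ r) :
    tensor k a c c' X₁ Y₁ X₂ Y₂ h l ≫ tensor k a' c' c'' Y₁ Z₁ Y₂ Z₂ f g =
      ssign k ((c' + c'' + r) * (a + a' + p)) •
        tensor k a c c'' X₁ Z₁ X₂ Z₂ (h ≫ f) (l ≫ g) := by
  refine homogeneous_induction (k := k) l (fun l l' hl hl' => ?_) (fun s l hl => ?_)
  · rw [map_add, Preadditive.add_comp, hl, hl', Preadditive.add_comp, map_add, smul_add]
  refine homogeneous_induction (k := k) f (fun f f' hf hf' => ?_) (fun t f hf => ?_)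
  · rw [map_add, LinearMap.add_apply, Preadditive.comp_add, hf, hf', Preadditive.comp_add,
      map_add, LinearMap.add_apply, smul_add]
  rw [tensor_of_mem a c c' hh hl, tensor_of_mem a' c' c'' hf hg,
    tensor_of_mem a c c'' (comp_mem hh hf) (comp_mem hl hg), Linear.smul_comp, Linear.comp_smul,
    super_interchange h l f g hh hg, smul_smul, smul_smul, smul_smul, ← ssign_add, ← ssign_add,
    ← ssign_add]
  congr 2
  have h2 : (2 : ZMod 2) = 0 := rfl
  linear_combination (-(a * c'' + p * c'' + a * r)) * h2

lemma tensor_assoc (a₁ a₂ a₃ b₂ b₃ : ZMod 2) {X₁ X₂ X₃ Y₁ Y₂ Y₃ : C}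
    (f₁ : X₁ ⟶ Y₁) (f₂ : X₂ ⟶ Y₂) (f₃ : X₃ ⟶ Y₃) :
    tensor k (a₁ + a₂) a₃ b₃ _ _ _ _ (tensor k a₁ a₂ b₂ _ _ _ _ f₁ f₂) f₃ ≫
        (assoc (k := k) Y₁ Y₂ Y₃).hom =
      (assoc (k := k) X₁ X₂ X₃).hom ≫
        tensor k a₁ (a₂ + a₃) (b₂ + b₃) _ _ _ _ f₁ (tensor k a₂ a₃ b₃ _ _ _ _ f₂ f₃) := by
  refine homogeneous_induction (k := k) f₁ (fun f g hf hg => ?_) (fun p₁ f₁ h₁ => ?_)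
  · simp only [map_add, LinearMap.add_apply, Preadditive.add_comp, Preadditive.comp_add, hf, hg]
  refine homogeneous_induction (k := k) f₂ (fun f g hf hg => ?_) (fun p₂ f₂ h₂ => ?_)
  · simp only [map_add, LinearMap.add_apply, Preadditive.add_comp, Preadditive.comp_add, hf, hg]
  refine homogeneous_induction (k := k) f₃ (fun f g hf hg => ?_) (fun p₃ f₃ h₃ => ?_)
  · simp only [map_add, Preadditive.add_comp, Preadditive.comp_add, hf, hg]
  rw [tensor_of_mem _ _ _ (tensor_mem _ _ _ h₁ h₂) h₃, tensor_of_mem _ _ _ h₁ h₂,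
    tensor_of_mem _ _ _ h₁ (tensor_mem _ _ _ h₂ h₃), tensor_of_mem _ _ _ h₂ h₃]
  simp only [map_smul, LinearMap.smul_apply, smul_smul, Linear.smul_comp, Linear.comp_smul,
    assoc_naturality, ← ssign_add]
  congr 2
  ring

set_option maxHeartbeats 2000000 in
/-- The `Π`-envelope of a monoidal supercategory is a monoidal supercategory, with
`Π^a X ⊗ Π^b Y = Π^{a+b} (X ⊗ Y)`, unit object `Π^0 𝟙`, and the coherence maps of `C`. -/
instance : MonoidalSupercategory k (PiEnvelope C) where
  tObj X Y := ⟨X.par + Y.par, tObj k X.obj Y.obj⟩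
  tHom {X₁ Y₁ X₂ Y₂} := tensor k X₁.par X₂.par Y₂.par X₁.obj Y₁.obj X₂.obj Y₂.obj
  tHom_mem {X₁ Y₁ X₂ Y₂ a b f g} hf hg := by
    have := tensor_mem (k := k) (C := C) X₁.par X₂.par Y₂.par hf hg
    rwa [show X₁.par + Y₁.par + a + (X₂.par + Y₂.par + b) =
      X₁.par + X₂.par + (Y₁.par + Y₂.par) + (a + b) by ring] at this
  tHom_id X Y := (tensor_even_id X.par Y.par (id_mem X.obj) Y.obj).trans (tHom_id X.obj Y.obj)
  super_interchange {X₁ Y₁ Z₁ X₂ Y₂ Z₂ a b} h l f g hh hg := by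
    have := tensor_interchange (k := k) (C := C) X₁.par Y₁.par X₂.par Y₂.par Z₂.par h l f g hh hg
    rwa [show (Y₂.par + Z₂.par + (Y₂.par + Z₂.par + b)) * (X₁.par + Y₁.par +
      (X₁.par + Y₁.par + a)) = b * a by
        rw [CharTwo.add_cancel_left, CharTwo.add_cancel_left]] at this
  tUnit := ⟨0, tUnit k⟩
  assoc X Y Z :=
    { hom := (assoc (k := k) X.obj Y.obj Z.obj).hom
      inv := (assoc (k := k) X.obj Y.obj Z.obj).inv
      hom_inv_id := (assoc (k := k) X.obj Y.obj Z.obj).hom_inv_id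
      inv_hom_id := (assoc (k := k) X.obj Y.obj Z.obj).inv_hom_id }
  lunit X :=
    { hom := (lunit (k := k) X.obj).hom
      inv := (lunit (k := k) X.obj).inv
      hom_inv_id := (lunit (k := k) X.obj).hom_inv_id
      inv_hom_id := (lunit (k := k) X.obj).inv_hom_id }
  runit X :=
    { hom := (runit (k := k) X.obj).hom
      inv := (runit (k := k) X.obj).inv
      hom_inv_id := (runit (k := k) X.obj).hom_inv_id
      inv_hom_id := (runit (k := k) X.obj).inv_hom_id }
  assoc_hom_mem X Y Z := by
    have := assoc_hom_mem (k := k) X.obj Y.obj Z.obj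
    rwa [show (0 : ZMod 2) = X.par + Y.par + Z.par + (X.par + (Y.par + Z.par)) + 0 by
      rw [← add_assoc X.par, CharTwo.add_self_eq_zero, add_zero]] at this
  assoc_inv_mem X Y Z := by
    have := assoc_inv_mem (k := k) X.obj Y.obj Z.obj
    rwa [show (0 : ZMod 2) = X.par + (Y.par + Z.par) + (X.par + Y.par + Z.par) + 0 by
      rw [← add_assoc X.par, CharTwo.add_self_eq_zero, add_zero]] at this
  lunit_hom_mem X := by
    have := lunit_hom_mem (k := k) X.obj
    rwa [show (0 : ZMod 2) = 0 + X.par + X.par + 0 by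
      rw [zero_add, CharTwo.add_self_eq_zero, add_zero]] at this
  lunit_inv_mem X := by
    have := lunit_inv_mem (k := k) X.obj
    rwa [show (0 : ZMod 2) = X.par + (0 + X.par) + 0 by
      rw [zero_add, CharTwo.add_self_eq_zero, add_zero]] at this
  runit_hom_mem X := by
    have := runit_hom_mem (k := k) X.obj
    rwa [show (0 : ZMod 2) = X.par + 0 + X.par + 0 by
      rw [add_zero, add_zero, CharTwo.add_self_eq_zero]] at this
  runit_inv_mem X := by
    have := runit_inv_mem (k := k) X.obj
    rwa [show (0 : ZMod 2) = X.par + (X.par + 0) + 0 by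
      rw [add_zero, add_zero, CharTwo.add_self_eq_zero]] at this
  assoc_naturality {X₁ X₂ X₃ Y₁ Y₂ Y₃} f₁ f₂ f₃ := by
    have h := tensor_assoc (k := k) (C := C) X₁.par X₂.par X₃.par Y₂.par Y₃.par f₁ f₂ f₃
    exact h
  lunit_naturality {X Y} f := by
    have h := lunit_naturality (k := k) (C := C) f
    rw [← tensor_zero_left X.par Y.par] at h
    exact h
  runit_naturality {X Y} f := by
    have h := runit_naturality (k := k) (C := C) f
    rw [← tensor_zero_right X.par] at h
    exact h
  pentagon W X Y Z := by
    have h := pentagon (k := k) W.obj X.obj Y.obj Z.obj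
    rw [← tensor_even_id (W.par + X.par + Y.par) Z.par (assoc_hom_mem _ _ _),
      ← tensor_id_even W.par (add_assoc X.par Y.par Z.par) (assoc_hom_mem _ _ _)] at h
    exact h
  triangle X Y := by
    have h := triangle (k := k) X.obj Y.obj
    rw [← tensor_id_even X.par (zero_add Y.par) (lunit_hom_mem _),
      ← tensor_even_id (X.par + 0) Y.par (runit_hom_mem _)] at h
    exact h

end PiEnvelope

/-! ### The monoidal structure on the additive envelope -/

namespace MatMonoidal

open MonoidalCategory

variable {C : Type*} [Category* C] [Preadditive C]

open scoped Classical in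
/-- The morphism of `Mat_ C` given by a map `e` between the index sets and morphisms
`M.X i ⟶ N.X (e i)`; all the other matrix entries are zero. -/
def reindex {M N : Mat_ C} (e : M.ι → N.ι) (φ : ∀ i, M.X i ⟶ N.X (e i)) : M ⟶ N :=
  fun i j => if h : e i = j then φ i ≫ eqToHom (congrArg N.X h) else 0

lemma reindex_self {M N : Mat_ C} (e : M.ι → N.ι) (φ : ∀ i, M.X i ⟶ N.X (e i)) (i : M.ι) :
    reindex e φ i (e i) = φ i := by
  simp [reindex]

lemma reindex_ne {M N : Mat_ C} (e : M.ι → N.ι) (φ : ∀ i, M.X i ⟶ N.X (e i)) (i : M.ι) (j : N.ι)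
    (h : e i ≠ j) : reindex e φ i j = 0 := by
  simp [reindex, h]

lemma reindex_comp_apply {M N K : Mat_ C} (e : M.ι → N.ι) (φ : ∀ i, M.X i ⟶ N.X (e i))
    (f : N ⟶ K) (i : M.ι) (k : K.ι) : (reindex e φ ≫ f) i k = φ i ≫ f (e i) k := by
  rw [Mat_.comp_apply, Finset.sum_eq_single (e i)]
  · rw [reindex_self]
  · intro j _ hj
    rw [reindex_ne e φ i j hj.symm, zero_comp]
  · simp

lemma comp_reindex_apply {M N K : Mat_ C} (e : N.ι → K.ι) (he : Function.Injective e)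
    (φ : ∀ i, N.X i ⟶ K.X (e i)) (f : M ⟶ N) (i : M.ι) (j : N.ι) :
    (f ≫ reindex e φ) i (e j) = f i j ≫ φ j := by
  rw [Mat_.comp_apply, Finset.sum_eq_single j]
  · rw [reindex_self]
  · intro j' _ hj
    rw [reindex_ne e φ j' (e j) (he.ne hj), comp_zero]
  · simp

lemma reindex_comp_reindex {M N K : Mat_ C} (e : M.ι → N.ι) (φ : ∀ i, M.X i ⟶ N.X (e i))
    (e' : N.ι → K.ι) (φ' : ∀ i, N.X i ⟶ K.X (e' i)) :
    reindex e φ ≫ reindex e' φ' =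
      reindex (fun i => e' (e i)) (fun i => φ i ≫ φ' (e i)) := by
  ext i k
  rw [reindex_comp_apply]
  by_cases h : e' (e i) = k
  · subst h
    rw [reindex_self, reindex_self (fun i => e' (e i)) (fun i => φ i ≫ φ' (e i))]
  · rw [reindex_ne e' φ' _ _ h, reindex_ne (fun i => e' (e i)) _ _ _ h, comp_zero]

lemma id_eq_reindex (M : Mat_ C) : 𝟙 M = reindex (fun i => i) (fun i => 𝟙 (M.X i)) := by
  ext i j
  by_cases h : i = j
  · subst h
    rw [Mat_.id_apply_self, reindex_self (fun i => i)]
  · rw [Mat_.id_apply_of_ne _ _ _ h, reindex_ne _ _ _ _ h]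

variable [MonoidalCategory C] [MonoidalPreadditive C]

/-- The tensor product of families of objects. -/
abbrev tensorObj (M N : Mat_ C) : Mat_ C := ⟨M.ι × N.ι, fun p => M.X p.1 ⊗ N.X p.2⟩

/-- The tensor product of matrices of morphisms. -/
def tensorHom {M N M' N' : Mat_ C} (f : M ⟶ N) (g : M' ⟶ N') :
    tensorObj M M' ⟶ tensorObj N N' := fun p r => f p.1 r.1 ⊗ₘ g p.2 r.2

lemma tensorHom_reindex {M N M' N' : Mat_ C} (e : M.ι → N.ι) (φ : ∀ i, M.X i ⟶ N.X (e i))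
    (e' : M'.ι → N'.ι) (φ' : ∀ i, M'.X i ⟶ N'.X (e' i)) :
    tensorHom (reindex e φ) (reindex e' φ') =
      reindex (M := tensorObj M M') (N := tensorObj N N') (fun p => (e p.1, e' p.2))
        (fun p => φ p.1 ⊗ₘ φ' p.2) := by
  ext ⟨i, i'⟩ ⟨j, j'⟩
  by_cases h : e i = j
  · by_cases h' : e' i' = j'
    · subst h h'
      rw [reindex_self (M := tensorObj M M') (N := tensorObj N N')
        (fun p => (e p.1, e' p.2)) _ (i, i')]
      simp only [tensorHom, reindex_self]
    · rw [reindex_ne _ _ _ _ (by simp [h'])]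
      simp only [tensorHom, reindex_ne _ _ _ _ h', MonoidalPreadditive.tensor_zero]
  · rw [reindex_ne _ _ _ _ (by simp [h])]
    simp only [tensorHom, reindex_ne _ _ _ _ h, MonoidalPreadditive.zero_tensor]

lemma tensorHom_id (M N : Mat_ C) : tensorHom (𝟙 M) (𝟙 N) = 𝟙 (tensorObj M N) := by
  rw [id_eq_reindex, id_eq_reindex, tensorHom_reindex, id_eq_reindex]
  congr 1
  funext p
  exact id_tensorHom_id _ _

lemma tensorHom_comp {M N K M' N' K' : Mat_ C} (f : M ⟶ N) (f' : M' ⟶ N') (g : N ⟶ K)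
    (g' : N' ⟶ K') : tensorHom f f' ≫ tensorHom g g' = tensorHom (f ≫ g) (f' ≫ g') := by
  ext ⟨i, i'⟩ ⟨k, k'⟩
  simp only [Mat_.comp_apply, tensorHom, tensorHom_comp_tensorHom, Fintype.sum_prod_type,
    tensor_sum, sum_tensor]
  rw [Finset.sum_comm]

/-- The associator, entrywise the one of `C`. -/
def assocIso (M N K : Mat_ C) :
    tensorObj (tensorObj M N) K ≅ tensorObj M (tensorObj N K) where
  hom := reindex (fun p => (p.1.1, (p.1.2, p.2))) (fun p => (α_ _ _ _).hom)
  inv := reindex (fun p => ((p.1, p.2.1), p.2.2)) (fun p => (α_ _ _ _).inv)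
  hom_inv_id := by
    rw [reindex_comp_reindex, id_eq_reindex]
    exact congrArg (reindex _) (funext fun p => Iso.hom_inv_id _)
  inv_hom_id := by
    rw [reindex_comp_reindex, id_eq_reindex]
    exact congrArg (reindex _) (funext fun p => Iso.inv_hom_id _)

/-- The unit object, the family consisting of the unit object of `C`. -/
abbrev unit (C : Type*) [Category* C] [Preadditive C] [MonoidalCategory C] : Mat_ C :=
  ⟨PUnit, fun _ => 𝟙_ C⟩

/-- The left unitor, entrywise the one of `C`. -/
def lunitIso (M : Mat_ C) : tensorObj (unit C) M ≅ M where
  hom := reindex (fun p => p.2) (fun p => (λ_ _).hom)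
  inv := reindex (fun i => (PUnit.unit, i)) (fun i => (λ_ _).inv)
  hom_inv_id := by
    rw [reindex_comp_reindex, id_eq_reindex]
    exact congrArg (reindex _) (funext fun p => Iso.hom_inv_id _)
  inv_hom_id := by
    rw [reindex_comp_reindex, id_eq_reindex]
    exact congrArg (reindex _) (funext fun p => Iso.inv_hom_id _)

/-- The right unitor, entrywise the one of `C`. -/
def runitIso (M : Mat_ C) : tensorObj M (unit C) ≅ M where
  hom := reindex (fun p => p.1) (fun p => (ρ_ _).hom)
  inv := reindex (fun i => (i, PUnit.unit)) (fun i => (ρ_ _).inv)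
  hom_inv_id := by
    rw [reindex_comp_reindex, id_eq_reindex]
    exact congrArg (reindex _) (funext fun p => Iso.hom_inv_id _)
  inv_hom_id := by
    rw [reindex_comp_reindex, id_eq_reindex]
    exact congrArg (reindex _) (funext fun p => Iso.inv_hom_id _)

instance : MonoidalCategoryStruct (Mat_ C) where
  tensorObj := tensorObj
  tensorHom := tensorHom
  whiskerLeft M _ _ f := tensorHom (𝟙 M) f
  whiskerRight f N := tensorHom f (𝟙 N)
  tensorUnit := unit C
  associator := assocIso
  leftUnitor := lunitIso
  rightUnitor := runitIso

lemma assoc_nat {M₁ M₂ M₃ N₁ N₂ N₃ : Mat_ C} (f₁ : M₁ ⟶ N₁) (f₂ : M₂ ⟶ N₂) (f₃ : M₃ ⟶ N₃) :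
    tensorHom (tensorHom f₁ f₂) f₃ ≫ (assocIso N₁ N₂ N₃).hom =
      (assocIso M₁ M₂ M₃).hom ≫ tensorHom f₁ (tensorHom f₂ f₃) := by
  ext ⟨⟨i₁, i₂⟩, i₃⟩ ⟨j₁, j₂, j₃⟩
  have he : Function.Injective (fun p : (N₁.ι × N₂.ι) × N₃.ι => (p.1.1, (p.1.2, p.2))) := by
    rintro ⟨⟨a, b⟩, c⟩ ⟨⟨a', b'⟩, c'⟩ h
    simp_all
  refine (comp_reindex_apply (M := tensorObj (tensorObj M₁ M₂) M₃)
    (N := tensorObj (tensorObj N₁ N₂) N₃) (K := tensorObj N₁ (tensorObj N₂ N₃)) _ he _ _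
    ((i₁, i₂), i₃) ((j₁, j₂), j₃)).trans ?_
  refine Eq.trans ?_ (reindex_comp_apply (M := tensorObj (tensorObj M₁ M₂) M₃)
    (N := tensorObj M₁ (tensorObj M₂ M₃)) (K := tensorObj N₁ (tensorObj N₂ N₃)) _ _ _
    ((i₁, i₂), i₃) (j₁, (j₂, j₃))).symm
  exact associator_naturality _ _ _

lemma lunit_nat {M N : Mat_ C} (f : M ⟶ N) :
    tensorHom (𝟙 (unit C)) f ≫ (lunitIso N).hom = (lunitIso M).hom ≫ f := by
  ext ⟨⟨⟩, i⟩ j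
  have he : Function.Injective (fun p : PUnit.{1} × N.ι => p.2) := by
    rintro ⟨⟨⟩, b⟩ ⟨⟨⟩, b'⟩ h
    simp_all
  refine (comp_reindex_apply (M := tensorObj (unit C) M)
    (N := tensorObj (unit C) N) (K := N) _ he _ _ (PUnit.unit, i) (PUnit.unit, j)).trans ?_
  refine Eq.trans ?_ (reindex_comp_apply (M := tensorObj (unit C) M) (N := M) (K := N) _ _ _
    (PUnit.unit, i) j).symm
  simp only [tensorHom, Mat_.id_apply_self, id_tensorHom]
  exact leftUnitor_naturality (f i j)

lemma runit_nat {M N : Mat_ C} (f : M ⟶ N) :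
    tensorHom f (𝟙 (unit C)) ≫ (runitIso N).hom = (runitIso M).hom ≫ f := by
  ext ⟨i, ⟨⟩⟩ j
  have he : Function.Injective (fun p : N.ι × PUnit.{1} => p.1) := by
    rintro ⟨b, ⟨⟩⟩ ⟨b', ⟨⟩⟩ h
    simp_all
  refine (comp_reindex_apply (M := tensorObj M (unit C))
    (N := tensorObj N (unit C)) (K := N) _ he _ _ (i, PUnit.unit) (j, PUnit.unit)).trans ?_
  refine Eq.trans ?_ (reindex_comp_apply (M := tensorObj M (unit C)) (N := M) (K := N) _ _ _
    (i, PUnit.unit) j).symm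
  simp only [tensorHom, Mat_.id_apply_self, MonoidalCategory.tensorHom_id]
  exact rightUnitor_naturality (f i j)

lemma pentagon' (M N K L : Mat_ C) :
    tensorHom (assocIso M N K).hom (𝟙 L) ≫ (assocIso M (tensorObj N K) L).hom ≫
        tensorHom (𝟙 M) (assocIso N K L).hom =
      (assocIso (tensorObj M N) K L).hom ≫ (assocIso M N (tensorObj K L)).hom := by
  simp only [assocIso]
  rw [id_eq_reindex, id_eq_reindex, tensorHom_reindex, tensorHom_reindex, reindex_comp_reindex,
    reindex_comp_reindex, reindex_comp_reindex]
  exact congrArg (reindex _) (funext fun p => by simp)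

lemma triangle' (M N : Mat_ C) :
    (assocIso M (unit C) N).hom ≫ tensorHom (𝟙 M) (lunitIso N).hom =
      tensorHom (runitIso M).hom (𝟙 N) := by
  simp only [assocIso, lunitIso, runitIso]
  rw [id_eq_reindex, id_eq_reindex, tensorHom_reindex, tensorHom_reindex, reindex_comp_reindex]
  exact congrArg (reindex _) (funext fun p => by simp)

/-- The additive envelope of a preadditive monoidal category is a monoidal category. -/
instance : MonoidalCategory (Mat_ C) :=
  MonoidalCategory.ofTensorHom
    (id_tensorHom_id := tensorHom_id)
    (id_tensorHom := fun _ _ _ _ => rfl)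
    (tensorHom_id := fun _ _ => rfl)
    (tensorHom_comp_tensorHom := tensorHom_comp)
    (associator_naturality := assoc_nat)
    (leftUnitor_naturality := lunit_nat)
    (rightUnitor_naturality := runit_nat)
    (pentagon := pentagon')
    (triangle := triangle')

instance : MonoidalPreadditive (Mat_ C) where
  whiskerLeft_zero := by
    intros; ext p r; exact MonoidalPreadditive.tensor_zero _
  zero_whiskerRight := by
    intros; ext p r; exact MonoidalPreadditive.zero_tensor _
  whiskerLeft_add _ _ := by
    ext p r; exact MonoidalPreadditive.tensor_add _ _ _
  add_whiskerRight _ _ := by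
    ext p r; exact MonoidalPreadditive.add_tensor _ _ _

end MatMonoidal

/-! ### The monoidal structure on the idempotent completion -/

namespace KaroubiMonoidal

open MonoidalCategory Idempotents

variable {C : Type*} [Category* C] [MonoidalCategory C]

/-- The tensor product of morphisms in the idempotent completion is the one of `C`, with
`(X, p) ⊗ (Y, q) = (X ⊗ Y, p ⊗ q)`. -/
instance : MonoidalCategoryStruct (Karoubi C) where
  tensorObj P Q := ⟨P.X ⊗ Q.X, P.p ⊗ₘ Q.p, by
    rw [tensorHom_comp_tensorHom, P.idem, Q.idem]⟩
  tensorHom f g := ⟨f.f ⊗ₘ g.f, by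
    simp only [tensorHom_comp_tensorHom, f.comm, g.comm]⟩
  whiskerLeft P _ _ f := ⟨P.p ⊗ₘ f.f, by
    simp only [tensorHom_comp_tensorHom, f.comm, P.idem]⟩
  whiskerRight f Q := ⟨f.f ⊗ₘ Q.p, by
    simp only [tensorHom_comp_tensorHom, f.comm, Q.idem]⟩
  tensorUnit := ⟨𝟙_ C, 𝟙 _, Category.comp_id _⟩
  associator P Q R :=
    { hom := ⟨((P.p ⊗ₘ Q.p) ⊗ₘ R.p) ≫ (α_ _ _ _).hom, by
        simp only [Category.assoc, ← associator_naturality, tensorHom_comp_tensorHom_assoc,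
          tensorHom_comp_tensorHom, P.idem, Q.idem, R.idem]⟩
      inv := ⟨(P.p ⊗ₘ (Q.p ⊗ₘ R.p)) ≫ (α_ _ _ _).inv, by
        simp only [Category.assoc, ← associator_inv_naturality, tensorHom_comp_tensorHom_assoc,
          tensorHom_comp_tensorHom, P.idem, Q.idem, R.idem]⟩
      hom_inv_id := by
        ext
        change (((P.p ⊗ₘ Q.p) ⊗ₘ R.p) ≫ (α_ _ _ _).hom) ≫ (P.p ⊗ₘ (Q.p ⊗ₘ R.p)) ≫ (α_ _ _ _).inv =
          (P.p ⊗ₘ Q.p) ⊗ₘ R.p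
        simp only [Category.assoc, associator_inv_naturality, Iso.hom_inv_id_assoc,
          tensorHom_comp_tensorHom, P.idem, Q.idem, R.idem]
      inv_hom_id := by
        ext
        change ((P.p ⊗ₘ (Q.p ⊗ₘ R.p)) ≫ (α_ _ _ _).inv) ≫ ((P.p ⊗ₘ Q.p) ⊗ₘ R.p) ≫ (α_ _ _ _).hom =
          P.p ⊗ₘ (Q.p ⊗ₘ R.p)
        simp only [Category.assoc, associator_naturality, Iso.inv_hom_id_assoc,
          tensorHom_comp_tensorHom, P.idem, Q.idem, R.idem] }
  leftUnitor P :=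
    { hom := ⟨(λ_ P.X).hom ≫ P.p, by
        simp only [Category.assoc, id_tensorHom, leftUnitor_naturality_assoc, P.idem]⟩
      inv := ⟨P.p ≫ (λ_ P.X).inv, by
        simp only [Category.assoc, id_tensorHom, ← leftUnitor_inv_naturality, Karoubi.idem_assoc]⟩
      hom_inv_id := by
        ext
        simp only [Karoubi.comp_f, Karoubi.id_f, Category.assoc, Karoubi.idem_assoc, id_tensorHom]
        rw [leftUnitor_inv_naturality, Iso.hom_inv_id_assoc]
      inv_hom_id := by
        ext
        simp only [Karoubi.comp_f, Karoubi.id_f, Category.assoc, Iso.inv_hom_id_assoc, P.idem] }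
  rightUnitor P :=
    { hom := ⟨(ρ_ P.X).hom ≫ P.p, by
        simp only [Category.assoc, tensorHom_id, rightUnitor_naturality_assoc, P.idem]⟩
      inv := ⟨P.p ≫ (ρ_ P.X).inv, by
        simp only [Category.assoc, tensorHom_id, ← rightUnitor_inv_naturality, Karoubi.idem_assoc]⟩
      hom_inv_id := by
        ext
        simp only [Karoubi.comp_f, Karoubi.id_f, Category.assoc, Karoubi.idem_assoc, tensorHom_id]
        rw [rightUnitor_inv_naturality, Iso.hom_inv_id_assoc]
      inv_hom_id := by
        ext
        simp only [Karoubi.comp_f, Karoubi.id_f, Category.assoc, Iso.inv_hom_id_assoc, P.idem] }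

lemma karoubi_pentagon {W X Y Z : C} (p : W ⟶ W) (q : X ⟶ X) (r : Y ⟶ Y) (s : Z ⟶ Z)
    (hp : p ≫ p = p) (hq : q ≫ q = q) (hr : r ≫ r = r) (hs : s ≫ s = s) :
    ((((p ⊗ₘ q) ⊗ₘ r) ≫ (α_ W X Y).hom) ⊗ₘ s) ≫
        (((p ⊗ₘ (q ⊗ₘ r)) ⊗ₘ s) ≫ (α_ W (X ⊗ Y) Z).hom) ≫
          (p ⊗ₘ (((q ⊗ₘ r) ⊗ₘ s) ≫ (α_ X Y Z).hom)) =
      ((((p ⊗ₘ q) ⊗ₘ r) ⊗ₘ s) ≫ (α_ (W ⊗ X) Y Z).hom) ≫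
        ((p ⊗ₘ q) ⊗ₘ (r ⊗ₘ s)) ≫ (α_ W X (Y ⊗ Z)).hom := by
  have h1 : (((p ⊗ₘ q) ⊗ₘ r) ≫ (α_ W X Y).hom) ⊗ₘ s =
      (((p ⊗ₘ q) ⊗ₘ r) ⊗ₘ s) ≫ ((α_ W X Y).hom ⊗ₘ 𝟙 Z) := by
    rw [tensorHom_comp_tensorHom, Category.comp_id]
  have h2 : p ⊗ₘ (((q ⊗ₘ r) ⊗ₘ s) ≫ (α_ X Y Z).hom) =
      (p ⊗ₘ ((q ⊗ₘ r) ⊗ₘ s)) ≫ (𝟙 W ⊗ₘ (α_ X Y Z).hom) := by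
    rw [tensorHom_comp_tensorHom, Category.comp_id]
  have h3 : ((α_ W X Y).hom ⊗ₘ 𝟙 Z) ≫ ((p ⊗ₘ (q ⊗ₘ r)) ⊗ₘ s) =
      (((p ⊗ₘ q) ⊗ₘ r) ⊗ₘ s) ≫ ((α_ W X Y).hom ⊗ₘ 𝟙 Z) := by
    rw [tensorHom_comp_tensorHom, tensorHom_comp_tensorHom, associator_naturality,
      Category.id_comp, Category.comp_id]
  rw [h1, h2]
  simp only [Category.assoc]
  rw [reassoc_of% h3, ← associator_naturality_assoc, ← associator_naturality_assoc]
  have hE : (((p ⊗ₘ q) ⊗ₘ r) ⊗ₘ s) ≫ (((p ⊗ₘ q) ⊗ₘ r) ⊗ₘ s) = ((p ⊗ₘ q) ⊗ₘ r) ⊗ₘ s := by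
    simp only [tensorHom_comp_tensorHom, hp, hq, hr, hs]
  rw [reassoc_of% hE, reassoc_of% h3, reassoc_of% hE]
  rw [← MonoidalCategory.pentagon, id_tensorHom, tensorHom_id, reassoc_of% hE]

lemma karoubi_triangle {X Y : C} (p : X ⟶ X) (q : Y ⟶ Y) (hp : p ≫ p = p) (hq : q ≫ q = q) :
    (((p ⊗ₘ 𝟙 (𝟙_ C)) ⊗ₘ q) ≫ (α_ X (𝟙_ C) Y).hom) ≫ (p ⊗ₘ ((λ_ Y).hom ≫ q)) =
      ((ρ_ X).hom ≫ p) ⊗ₘ q := by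
  have h2 : p ⊗ₘ ((λ_ Y).hom ≫ q) = (𝟙 X ⊗ₘ (λ_ Y).hom) ≫ (p ⊗ₘ q) := by
    rw [tensorHom_comp_tensorHom, Category.id_comp]
  have h3 : (α_ X (𝟙_ C) Y).hom ≫ (𝟙 X ⊗ₘ (λ_ Y).hom) = (ρ_ X).hom ⊗ₘ 𝟙 Y := by
    rw [id_tensorHom, MonoidalCategory.triangle, tensorHom_id]
  rw [h2, Category.assoc, reassoc_of% h3, tensorHom_comp_tensorHom_assoc, tensorHom_comp_tensorHom,
    Category.comp_id, hq, tensorHom_id, rightUnitor_naturality, Category.assoc, hp]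

/-- The idempotent completion of a monoidal category is a monoidal category. -/
instance : MonoidalCategory (Karoubi C) :=
  MonoidalCategory.ofTensorHom
    (id_tensorHom_id := fun _ _ => rfl)
    (id_tensorHom := fun _ _ _ _ => rfl)
    (tensorHom_id := fun _ _ => rfl)
    (tensorHom_comp_tensorHom := fun f₁ f₂ g₁ g₂ => Karoubi.hom_ext _ _
      (tensorHom_comp_tensorHom f₁.f f₂.f g₁.f g₂.f))
    (associator_naturality := fun {X₁ X₂ X₃ Y₁ Y₂ Y₃} f₁ f₂ f₃ => by
      ext
      change ((f₁.f ⊗ₘ f₂.f) ⊗ₘ f₃.f) ≫ ((Y₁.p ⊗ₘ Y₂.p) ⊗ₘ Y₃.p) ≫ (α_ _ _ _).hom =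
        (((X₁.p ⊗ₘ X₂.p) ⊗ₘ X₃.p) ≫ (α_ _ _ _).hom) ≫ (f₁.f ⊗ₘ (f₂.f ⊗ₘ f₃.f))
      simp only [Category.assoc, ← associator_naturality, tensorHom_comp_tensorHom_assoc,
        tensorHom_comp_tensorHom, Karoubi.comp_p, Karoubi.p_comp])
    (leftUnitor_naturality := fun {X Y} f => by
      ext
      change (𝟙 (𝟙_ C) ⊗ₘ f.f) ≫ (λ_ _).hom ≫ Y.p = ((λ_ _).hom ≫ X.p) ≫ f.f
      simp only [Category.assoc, id_tensorHom, leftUnitor_naturality_assoc, Karoubi.comp_p,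
        Karoubi.p_comp])
    (rightUnitor_naturality := fun {X Y} f => by
      ext
      change (f.f ⊗ₘ 𝟙 (𝟙_ C)) ≫ (ρ_ _).hom ≫ Y.p = ((ρ_ _).hom ≫ X.p) ≫ f.f
      simp only [Category.assoc, tensorHom_id, rightUnitor_naturality_assoc, Karoubi.comp_p,
        Karoubi.p_comp])
    (pentagon := fun W X Y Z => by
      ext
      exact karoubi_pentagon W.p X.p Y.p Z.p W.idem X.idem Y.idem Z.idem)
    (triangle := fun X Y => by
      ext
      exact karoubi_triangle X.p Y.p X.idem Y.idem)

instance [Preadditive C] [MonoidalPreadditive C] : MonoidalPreadditive (Karoubi C) where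
  whiskerLeft_zero := by
    intros; ext; exact MonoidalPreadditive.tensor_zero _
  zero_whiskerRight := by
    intros; ext; exact MonoidalPreadditive.zero_tensor _
  whiskerLeft_add _ _ := by
    ext; exact MonoidalPreadditive.tensor_add _ _ _
  add_whiskerRight _ _ := by
    ext; exact MonoidalPreadditive.add_tensor _ _ _

end KaroubiMonoidal

/-! ### Split Grothendieck groups and rings -/

section GrothendieckGroup

variable (C : Type*) [Category* C] [Preadditive C] [HasBinaryBiproducts C]

/-- The relations defining the split Grothendieck group: isomorphic objects are identified, and
the class of `V ⊕ W` is the sum of the classes of `V` and `W`. -/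
def K0.relations : AddSubgroup (FreeAbelianGroup C) :=
  AddSubgroup.closure
    ({x | ∃ V W : C, Nonempty (V ≅ W) ∧ x = FreeAbelianGroup.of V - FreeAbelianGroup.of W} ∪
      {x | ∃ V W : C, x = FreeAbelianGroup.of (V ⊞ W) -
        (FreeAbelianGroup.of V + FreeAbelianGroup.of W)})

/-- The split Grothendieck group of an additive category. -/
abbrev K0 := FreeAbelianGroup C ⧸ K0.relations C

namespace K0

variable {C}

/-- The class of an object in the split Grothendieck group. -/
def mk (V : C) : K0 C := QuotientAddGroup.mk (FreeAbelianGroup.of V)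

lemma mk_iso {V W : C} (e : V ≅ W) : mk V = mk W := by
  rw [mk, mk, QuotientAddGroup.eq_iff_sub_mem]
  exact AddSubgroup.subset_closure (Or.inl ⟨V, W, ⟨e⟩, rfl⟩)

lemma mk_biprod (V W : C) : mk (V ⊞ W) = mk V + mk W := by
  rw [mk, mk, mk, ← QuotientAddGroup.mk_add, QuotientAddGroup.eq_iff_sub_mem]
  exact AddSubgroup.subset_closure (Or.inr ⟨V, W, rfl⟩)

/-- The universal property of the split Grothendieck group. -/
def lift {A : Type*} [AddCommGroup A] (φ : C → A) (hiso : ∀ V W : C, Nonempty (V ≅ W) → φ V = φ W)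
    (hadd : ∀ V W : C, φ (V ⊞ W) = φ V + φ W) : K0 C →+ A :=
  QuotientAddGroup.lift (relations C) (FreeAbelianGroup.lift φ) (by
    rw [relations, AddSubgroup.closure_le]
    rintro x (⟨V, W, h, rfl⟩ | ⟨V, W, rfl⟩)
    · simp [hiso V W h]
    · simp [hadd V W])

lemma lift_mk {A : Type*} [AddCommGroup A] (φ : C → A)
    (hiso : ∀ V W : C, Nonempty (V ≅ W) → φ V = φ W)
    (hadd : ∀ V W : C, φ (V ⊞ W) = φ V + φ W) (V : C) : lift φ hiso hadd (mk V) = φ V := by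
  simp [lift, mk]

lemma hom_ext {A : Type*} [AddCommGroup A] {f g : K0 C →+ A} (h : ∀ V : C, f (mk V) = g (mk V)) :
    f = g := by
  refine QuotientAddGroup.addMonoidHom_ext _ ?_
  ext V
  exact h V

variable [MonoidalCategory C] [MonoidalPreadditive C]

open MonoidalCategory

lemma mk_tensor_biprod (V W W' : C) : mk (V ⊗ (W ⊞ W')) = mk (V ⊗ W) + mk (V ⊗ W') := by
  have := preservesBinaryBiproducts_of_preservesBiproducts (tensorLeft V)
  exact (mk_iso ((tensorLeft V).mapBiprod W W')).trans (mk_biprod _ _)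

lemma mk_biprod_tensor (V V' W : C) : mk ((V ⊞ V') ⊗ W) = mk (V ⊗ W) + mk (V' ⊗ W) := by
  have := preservesBinaryBiproducts_of_preservesBiproducts (tensorRight W)
  exact (mk_iso ((tensorRight W).mapBiprod V V')).trans (mk_biprod _ _)

/-- Left multiplication by the class of `V` on the Grothendieck group. -/
def mulLeft (V : C) : K0 C →+ K0 C :=
  lift (fun W => mk (V ⊗ W)) (fun _ _ ⟨e⟩ => mk_iso (whiskerLeftIso V e))
    (mk_tensor_biprod V)

/-- The multiplication `[V] [W] = [V ⊗ W]`. -/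
def mulHom : K0 C →+ K0 C →+ K0 C :=
  lift mulLeft
    (fun V V' ⟨e⟩ => hom_ext fun W => by
      simp only [mulLeft, lift_mk]
      exact mk_iso (whiskerRightIso e W))
    (fun V V' => hom_ext fun W => by
      simp only [mulLeft, lift_mk, AddMonoidHom.add_apply]
      exact mk_biprod_tensor V V' W)

lemma mulHom_mk (V W : C) : mulHom (mk V) (mk W) = mk (V ⊗ W) := by
  simp only [mulHom, mulLeft, lift_mk]

/-- The Grothendieck ring of an additive monoidal category. -/
instance : Ring (K0 C) where
  __ := (inferInstance : AddCommGroup (K0 C))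
  mul x y := mulHom x y
  one := mk (𝟙_ C)
  left_distrib x y z := map_add (mulHom x) y z
  right_distrib x y z := by
    change mulHom (x + y) z = mulHom x z + mulHom y z
    rw [map_add, AddMonoidHom.add_apply]
  zero_mul x := by
    change mulHom 0 x = 0
    rw [map_zero, AddMonoidHom.zero_apply]
  mul_zero x := map_zero (mulHom x)
  one_mul x := by
    have : mulHom (mk (𝟙_ C)) = AddMonoidHom.id (K0 C) := hom_ext fun V => by
      rw [mulHom_mk]
      exact mk_iso (λ_ V)
    exact DFunLike.congr_fun this x
  mul_one x := by
    have : mulHom.flip (mk (𝟙_ C)) = AddMonoidHom.id (K0 C) := hom_ext fun V => by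
      rw [AddMonoidHom.flip_apply, mulHom_mk]
      exact mk_iso (ρ_ V)
    exact DFunLike.congr_fun this x
  mul_assoc x y z := by
    have h₁ : ∀ V W : C, (mulHom (mulHom (mk V) (mk W)) : K0 C →+ K0 C) =
        (mulHom (mk V)).comp (mulHom (mk W)) := fun V W => hom_ext fun U => by
      simp only [AddMonoidHom.comp_apply, mulHom_mk]
      exact mk_iso (α_ V W U)
    have h₂ : ∀ V : C, (mulHom.flip z).comp (mulHom (mk V)) =
        (mulHom (mk V)).comp (mulHom.flip z) := fun V => hom_ext fun W =>
      DFunLike.congr_fun (h₁ V W) z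
    have h₃ : (mulHom.flip z).comp (mulHom.flip y) = mulHom.flip (mulHom y z) := hom_ext fun V =>
      DFunLike.congr_fun (h₂ V) y
    exact DFunLike.congr_fun h₃ x

lemma mk_mul_mk (V W : C) : mk V * mk W = mk (V ⊗ W) := mulHom_mk V W

lemma one_def : (1 : K0 C) = mk (𝟙_ C) := rfl

end K0

end GrothendieckGroup

/-! ### The odd Temperley-Lieb supercategory -/

namespace OddTL

/-- The morphisms `·^{⊗m} ⟶ ·^{⊗n}` obtained from identities and the generators
`cup : 𝟙 ⟶ · ⊗ ·` and `cap : · ⊗ · ⟶ 𝟙` by formal compositions and tensor products.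
Here `comp f g` is the composition `g ∘ f`. -/
inductive Word : ℕ → ℕ → Type
  | id (n : ℕ) : Word n n
  | comp {m n p : ℕ} (f : Word m n) (g : Word n p) : Word m p
  | tensor {m n p r : ℕ} (f : Word m n) (g : Word p r) : Word (m + p) (n + r)
  | cup : Word 0 2
  | cap : Word 2 0

namespace Word

/-- The parity of a word; both generators are odd. -/
def parity : ∀ {m n : ℕ}, Word m n → ZMod 2
  | _, _, id _ => 0
  | _, _, comp f g => parity f + parity g
  | _, _, tensor f g => parity f + parity g
  | _, _, cup => 1
  | _, _, cap => 1

/-- Transport of a word along equalities of source and target. -/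
def cast {m n m' n' : ℕ} (hm : m = m') (hn : n = n') (w : Word m n) : Word m' n' :=
  hm ▸ hn ▸ w

lemma cast_rfl {m n : ℕ} (w : Word m n) : cast rfl rfl w = w := rfl

lemma parity_spec {m n : ℕ} (w : Word m n) : (n : ZMod 4) = m + 2 * (w.parity.val : ZMod 4) := by
  have key : ∀ a b : ZMod 2, 2 * (((a + b).val : ℕ) : ZMod 4) =
      2 * ((a.val : ℕ) : ZMod 4) + 2 * ((b.val : ℕ) : ZMod 4) := by decide
  induction w with
  | id n => simp [parity]
  | comp f g hf hg => rw [hg, hf, parity, key, add_assoc]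
  | tensor f g hf hg =>
    rw [parity, key, Nat.cast_add, Nat.cast_add, hf, hg]
    ring
  | cup => decide
  | cap => decide

lemma parity_eq {m n : ℕ} (w w' : Word m n) : w.parity = w'.parity := by
  have key : ∀ a b : ZMod 2, 2 * ((a.val : ℕ) : ZMod 4) = 2 * ((b.val : ℕ) : ZMod 4) → a = b := by
    decide
  exact key _ _ (add_left_cancel ((parity_spec w).symm.trans (parity_spec w')))

end Word

open Word

variable {k : Type*} [Field k]

/-- The defining relations: `Rel δ f c g` imposes the relation `f = c g`. -/
inductive Rel (δ : k) : ∀ {m n : ℕ}, Word m n → k → Word m n → Prop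
  | id_comp {m n : ℕ} (f : Word m n) : Rel δ (comp (Word.id m) f) 1 f
  | comp_id {m n : ℕ} (f : Word m n) : Rel δ (comp f (Word.id n)) 1 f
  | comp_assoc {m n p r : ℕ} (f : Word m n) (g : Word n p) (h : Word p r) :
      Rel δ (comp (comp f g) h) 1 (comp f (comp g h))
  | tensor_id (m n : ℕ) : Rel δ (tensor (Word.id m) (Word.id n)) 1 (Word.id (m + n))
  | unit_tensor {m n : ℕ} (f : Word m n) :
      Rel δ (cast (Nat.zero_add m) (Nat.zero_add n) (tensor (Word.id 0) f)) 1 f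
  | tensor_unit {m n : ℕ} (f : Word m n) :
      Rel δ (cast (Nat.add_zero m) (Nat.add_zero n) (tensor f (Word.id 0))) 1 f
  | tensor_assoc {m n p r s t : ℕ} (f : Word m n) (g : Word p r) (h : Word s t) :
      Rel δ (cast (Nat.add_assoc m p s) (Nat.add_assoc n r t) (tensor (tensor f g) h)) 1
        (tensor f (tensor g h))
  /-- `(f ⊗ g) ∘ (h ⊗ l) = (-1)^{|g||h|} (f ∘ h) ⊗ (g ∘ l)` -/
  | super_interchange {m n p r s t : ℕ} (h : Word m n) (l : Word r s) (f : Word n p)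
      (g : Word s t) :
      Rel δ (comp (tensor h l) (tensor f g)) (ssign k (g.parity * h.parity))
        (tensor (comp h f) (comp l g))
  /-- `(cap ⊗ ·) ∘ (· ⊗ cup) = 1` -/
  | zigzag_left : Rel δ (comp (n := 3) (tensor (Word.id 1) cup : Word (1 + 0) (1 + 2))
        (tensor cap (Word.id 1) : Word (2 + 1) (0 + 1))) 1 (Word.id 1)
  /-- `(· ⊗ cap) ∘ (cup ⊗ ·) = -1` -/
  | zigzag_right : Rel δ (comp (n := 3) (tensor cup (Word.id 1) : Word (0 + 1) (2 + 1))
        (tensor (Word.id 1) cap : Word (1 + 2) (1 + 0))) (-1) (Word.id 1)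
  /-- `cap ∘ cup = δ` -/
  | circle : Rel δ (comp cup cap) δ (Word.id 0)
  | comp_left {m n p : ℕ} {f f' : Word m n} {c : k} (g : Word n p) (h : Rel δ f c f') :
      Rel δ (comp f g) c (comp f' g)
  | comp_right {m n p : ℕ} (f : Word m n) {g g' : Word n p} {c : k} (h : Rel δ g c g') :
      Rel δ (comp f g) c (comp f g')
  | tensor_left {m n p r : ℕ} {f f' : Word m n} {c : k} (g : Word p r) (h : Rel δ f c f') :
      Rel δ (tensor f g) c (tensor f' g)
  | tensor_right {m n p r : ℕ} (f : Word m n) {g g' : Word p r} {c : k} (h : Rel δ g c g') :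
      Rel δ (tensor f g) c (tensor f g')

/-- The subspace spanned by the relations. -/
def relSubmodule (δ : k) (m n : ℕ) : Submodule k (Word m n →₀ k) :=
  Submodule.span k {x | ∃ (f : Word m n) (c : k) (g : Word m n), Rel δ f c g ∧
    x = Finsupp.single f 1 - Finsupp.single g c}

/-- The morphism spaces: linear combinations of words modulo the relations. -/
abbrev HomSpace (δ : k) (m n : ℕ) := (Word m n →₀ k) ⧸ relSubmodule δ m n

/-- The class of a word. -/
def cls (δ : k) {m n : ℕ} (w : Word m n) : HomSpace δ m n :=
  (relSubmodule δ m n).mkQ (Finsupp.single w 1)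

variable {δ : k}

lemma cls_rel {m n : ℕ} {f g : Word m n} {c : k} (h : Rel δ f c g) :
    cls δ f = c • cls δ g := by
  rw [cls, cls, ← map_smul, Finsupp.smul_single, smul_eq_mul, mul_one, ← sub_eq_zero, ← map_sub,
    Submodule.mkQ_apply, Submodule.Quotient.mk_eq_zero]
  exact Submodule.subset_span ⟨f, c, g, h, rfl⟩

lemma cls_rel_one {m n : ℕ} {f g : Word m n} (h : Rel δ f 1 g) : cls δ f = cls δ g := by
  rw [cls_rel h, one_smul]

/-- A map on words that respects the relations extends to a linear map. -/
def liftHom {V : Type*} [AddCommGroup V] [Module k V] {m n : ℕ} (φ : Word m n → V)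
    (h : ∀ (f : Word m n) (c : k) (g : Word m n), Rel δ f c g → φ f = c • φ g) :
    HomSpace δ m n →ₗ[k] V :=
  (relSubmodule δ m n).liftQ (Finsupp.linearCombination k φ) (by
    rw [relSubmodule, Submodule.span_le]
    rintro x ⟨f, c, g, hfg, rfl⟩
    simp [h f c g hfg])

lemma liftHom_cls {V : Type*} [AddCommGroup V] [Module k V] {m n : ℕ} (φ : Word m n → V)
    (h : ∀ (f : Word m n) (c : k) (g : Word m n), Rel δ f c g → φ f = c • φ g) (w : Word m n) :
    liftHom φ h (cls δ w) = φ w := by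
  simp [liftHom, cls]

lemma linearMap_ext {V : Type*} [AddCommGroup V] [Module k V] {m n : ℕ}
    {φ ψ : HomSpace δ m n →ₗ[k] V} (h : ∀ w, φ (cls δ w) = ψ (cls δ w)) : φ = ψ := by
  refine Submodule.linearMap_qext _ (Finsupp.lhom_ext' fun w => LinearMap.ext_ring ?_)
  exact h w

lemma span_cls (m n : ℕ) : Submodule.span k (Set.range (cls δ (m := m) (n := n))) = ⊤ := by
  rw [eq_top_iff]
  rintro x -
  obtain ⟨y, rfl⟩ := (relSubmodule δ m n).mkQ_surjective x
  induction y using Finsupp.induction_linear with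
  | zero => rw [map_zero]; exact zero_mem _
  | add y z hy hz => rw [map_add]; exact add_mem hy hz
  | single w c =>
    rw [← mul_one c, ← smul_eq_mul, ← Finsupp.smul_single, map_smul]
    exact Submodule.smul_mem _ _ (Submodule.subset_span ⟨w, rfl⟩)

/-- Composition, extended bilinearly from words. -/
def compHom (δ : k) (m n p : ℕ) :
    HomSpace δ m n →ₗ[k] HomSpace δ n p →ₗ[k] HomSpace δ m p :=
  liftHom
    (fun f => liftHom (fun g => cls δ (comp f g)) (fun _ _ _ h => cls_rel (Rel.comp_right f h)))
    (fun f c f' h => linearMap_ext fun g => by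
      rw [LinearMap.smul_apply, liftHom_cls, liftHom_cls, cls_rel (Rel.comp_left g h)])

lemma compHom_cls {m n p : ℕ} (f : Word m n) (g : Word n p) :
    compHom δ m n p (cls δ f) (cls δ g) = cls δ (comp f g) := by
  rw [compHom, liftHom_cls, liftHom_cls]

/-- Tensor product, extended bilinearly from words. -/
def tensorHom (δ : k) (m n p r : ℕ) :
    HomSpace δ m n →ₗ[k] HomSpace δ p r →ₗ[k] HomSpace δ (m + p) (n + r) :=
  liftHom
    (fun f => liftHom (fun g => cls δ (tensor f g))
      (fun _ _ _ h => cls_rel (Rel.tensor_right f h)))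
    (fun f c f' h => linearMap_ext fun g => by
      rw [LinearMap.smul_apply, liftHom_cls, liftHom_cls, cls_rel (Rel.tensor_left g h)])

lemma tensorHom_cls {m n p r : ℕ} (f : Word m n) (g : Word p r) :
    tensorHom δ m n p r (cls δ f) (cls δ g) = cls δ (tensor f g) := by
  rw [tensorHom, liftHom_cls, liftHom_cls]

/-- The part of parity `p` is spanned by the words of parity `p`. -/
def partOf (δ : k) (m n : ℕ) (p : ZMod 2) : Submodule k (HomSpace δ m n) :=
  Submodule.span k {x | ∃ w : Word m n, w.parity = p ∧ x = cls δ w}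

lemma cls_mem {m n : ℕ} (w : Word m n) : cls δ w ∈ partOf δ m n w.parity :=
  Submodule.subset_span ⟨w, rfl, rfl⟩

lemma partOf_eq_top {m n : ℕ} (w : Word m n) : partOf δ m n w.parity = ⊤ := by
  rw [eq_top_iff, ← span_cls, Submodule.span_le]
  rintro _ ⟨w', rfl⟩
  exact parity_eq w' w ▸ cls_mem w'

lemma partOf_eq_bot {m n : ℕ} {p : ZMod 2} (h : ∀ w : Word m n, w.parity ≠ p) :
    partOf δ m n p = ⊥ := by
  rw [partOf, Submodule.span_eq_bot]
  rintro x ⟨w, hw, -⟩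
  exact absurd hw (h w)

lemma partOf_isInternal (m n : ℕ) : DirectSum.IsInternal (partOf δ m n) := by
  rw [DirectSum.isInternal_submodule_iff_iSupIndep_and_iSup_eq_top]
  constructor
  · intro i
    by_cases h : ∃ w : Word m n, w.parity = i
    · obtain ⟨w, rfl⟩ := h
      have : (⨆ (j : ZMod 2) (_ : j ≠ w.parity), partOf δ m n j) = ⊥ := by
        simp only [iSup_eq_bot]
        intro j hj
        exact partOf_eq_bot fun w' hw' => hj (hw'.symm.trans (parity_eq w' w))
      rw [this]
      exact disjoint_bot_right
    · push Not at h
      rw [partOf_eq_bot h]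
      exact disjoint_bot_left
  · rw [eq_top_iff, ← span_cls, Submodule.span_le]
    rintro _ ⟨w, rfl⟩
    exact Submodule.mem_iSup_of_mem _ (cls_mem w)

lemma compHom_mem {m n p : ℕ} {a b : ZMod 2} {f : HomSpace δ m n} {g : HomSpace δ n p}
    (hf : f ∈ partOf δ m n a) (hg : g ∈ partOf δ n p b) :
    compHom δ m n p f g ∈ partOf δ m p (a + b) := by
  induction hf using Submodule.span_induction with
  | zero => simp
  | add x y _ _ hx hy => rw [map_add, LinearMap.add_apply]; exact add_mem hx hy
  | smul c x _ hx => rw [map_smul, LinearMap.smul_apply]; exact Submodule.smul_mem _ _ hx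
  | mem x hx =>
    obtain ⟨f, rfl, rfl⟩ := hx
    induction hg using Submodule.span_induction with
    | zero => simp
    | add x y _ _ hx hy => rw [map_add]; exact add_mem hx hy
    | smul c x _ hx => rw [map_smul]; exact Submodule.smul_mem _ _ hx
    | mem x hx =>
      obtain ⟨g, rfl, rfl⟩ := hx
      rw [compHom_cls]
      exact cls_mem (comp f g)

lemma tensorHom_mem {m n p r : ℕ} {a b : ZMod 2} {f : HomSpace δ m n} {g : HomSpace δ p r}
    (hf : f ∈ partOf δ m n a) (hg : g ∈ partOf δ p r b) :
    tensorHom δ m n p r f g ∈ partOf δ (m + p) (n + r) (a + b) := by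
  induction hf using Submodule.span_induction with
  | zero => simp
  | add x y _ _ hx hy => rw [map_add, LinearMap.add_apply]; exact add_mem hx hy
  | smul c x _ hx => rw [map_smul, LinearMap.smul_apply]; exact Submodule.smul_mem _ _ hx
  | mem x hx =>
    obtain ⟨f, rfl, rfl⟩ := hx
    induction hg using Submodule.span_induction with
    | zero => simp
    | add x y _ _ hx hy => rw [map_add]; exact add_mem hx hy
    | smul c x _ hx => rw [map_smul]; exact Submodule.smul_mem _ _ hx
    | mem x hx =>
      obtain ⟨g, rfl, rfl⟩ := hx
      rw [tensorHom_cls]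
      exact cls_mem (tensor f g)

lemma cls_induction {m n : ℕ} {P : HomSpace δ m n → Prop} (f : HomSpace δ m n) (zero : P 0)
    (add : ∀ f g, P f → P g → P (f + g)) (smul : ∀ (c : k) f, P f → P (c • f))
    (cls : ∀ w, P (cls δ w)) : P f := by
  have hf : f ∈ Submodule.span k (Set.range (OddTL.cls δ (m := m) (n := n))) := by
    rw [span_cls]; trivial
  induction hf using Submodule.span_induction with
  | zero => exact zero
  | add x y _ _ hx hy => exact add x y hx hy
  | smul c x _ hx => exact smul c x hx
  | mem x hx =>
    obtain ⟨w, rfl⟩ := hx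
    exact cls w

lemma compHom_assoc {m n p r : ℕ} (f : HomSpace δ m n) (g : HomSpace δ n p)
    (h : HomSpace δ p r) :
    compHom δ _ _ _ (compHom δ _ _ _ f g) h = compHom δ _ _ _ f (compHom δ _ _ _ g h) := by
  induction f using cls_induction with
  | zero => simp only [map_zero, LinearMap.zero_apply]
  | add x y hx hy => simp only [map_add, LinearMap.add_apply, hx, hy]
  | smul c x hx => simp only [map_smul, LinearMap.smul_apply, hx]
  | cls f =>
    induction g using cls_induction with
    | zero => simp only [map_zero, LinearMap.zero_apply]
    | add x y hx hy => simp only [map_add, LinearMap.add_apply, hx, hy]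
    | smul c x hx => simp only [map_smul, LinearMap.smul_apply, hx]
    | cls g =>
      induction h using cls_induction with
      | zero => simp only [map_zero]
      | add x y hx hy => simp only [map_add, hx, hy]
      | smul c x hx => simp only [map_smul, hx]
      | cls h =>
        simp only [compHom_cls]
        exact cls_rel_one (Rel.comp_assoc f g h)

end OddTL

/-- The odd Temperley-Lieb supercategory: the strict monoidal supercategory with one generating
object `·`, two odd generating morphisms `cup` and `cap`, and the zigzag and circle relations.
Its objects are the tensor powers `·^{⊗n}`. -/
structure STL {k : Type*} [Field k] (δ : k) where
  n : ℕ

namespace STL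

open OddTL

variable {k : Type*} [Field k] {δ : k}

instance : Category (STL δ) where
  Hom X Y := HomSpace δ X.n Y.n
  id X := cls δ (Word.id X.n)
  comp {X Y Z} f g := compHom δ X.n Y.n Z.n f g
  id_comp {X Y} f := by
    have : compHom δ X.n X.n Y.n (cls δ (Word.id X.n)) = LinearMap.id := linearMap_ext fun w => by
      rw [compHom_cls]; exact cls_rel_one (Rel.id_comp w)
    exact LinearMap.congr_fun this f
  comp_id {X Y} f := by
    have : (compHom δ X.n Y.n Y.n).flip (cls δ (Word.id Y.n)) = LinearMap.id :=
      linearMap_ext fun w => by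
        rw [LinearMap.flip_apply, compHom_cls]; exact cls_rel_one (Rel.comp_id w)
    exact LinearMap.congr_fun this f
  assoc f g h := compHom_assoc f g h

instance : Preadditive (STL δ) where
  homGroup X Y := inferInstanceAs (AddCommGroup (HomSpace δ X.n Y.n))
  add_comp X Y Z f f' g := LinearMap.map_add₂ (compHom δ X.n Y.n Z.n) f f' g
  comp_add X Y Z f g g' := LinearMap.map_add (compHom δ X.n Y.n Z.n f) g g'

instance : Linear k (STL δ) where
  homModule X Y := inferInstanceAs (Module k (HomSpace δ X.n Y.n))
  smul_comp X Y Z c f g := LinearMap.map_smul₂ (compHom δ X.n Y.n Z.n) c f g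
  comp_smul X Y Z f c g := LinearMap.map_smul (compHom δ X.n Y.n Z.n f) c g

instance : Supercategory k (STL δ) where
  part X Y p := partOf δ X.n Y.n p
  isInternal X Y := partOf_isInternal X.n Y.n
  id_mem X := cls_mem (Word.id X.n)
  comp_mem hf hg := compHom_mem hf hg

/-- The identity, as a morphism between equal objects. -/
def eqHom {m n : ℕ} (h : m = n) : HomSpace δ m n := cls δ (Word.cast rfl h (Word.id m))

lemma eqHom_mem {m n : ℕ} (h : m = n) : (eqHom h : HomSpace δ m n) ∈ partOf δ m n 0 := by
  subst h
  exact cls_mem (Word.id m)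

/-- The isomorphism between equal objects. -/
def eqIso {X Y : STL δ} (h : X.n = Y.n) : X ≅ Y where
  hom := (eqHom h : HomSpace δ X.n Y.n)
  inv := (eqHom h.symm : HomSpace δ Y.n X.n)
  hom_inv_id := by
    obtain ⟨m⟩ := X
    obtain ⟨n⟩ := Y
    obtain rfl : m = n := h
    exact Category.comp_id (𝟙 (⟨m⟩ : STL δ))
  inv_hom_id := by
    obtain ⟨m⟩ := X
    obtain ⟨n⟩ := Y
    obtain rfl : m = n := h
    exact Category.comp_id (𝟙 (⟨m⟩ : STL δ))

lemma compHom_eqHom {m n m' n' : ℕ} (hm : m = m') (hn : n = n') (f : Word m n) :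
    compHom δ m n n' (cls δ f) (eqHom hn) =
      compHom δ m m' n' (eqHom hm) (cls δ (Word.cast hm hn f)) := by
  subst hm hn
  simp only [eqHom, Word.cast_rfl, compHom_cls]
  rw [cls_rel_one (Rel.comp_id f), cls_rel_one (Rel.id_comp f)]

lemma eqHom_trans {m n p : ℕ} (h : m = n) (h' : n = p) :
    compHom δ m n p (eqHom h) (eqHom h') = eqHom (h.trans h') := by
  subst h h'
  simp only [eqHom, Word.cast_rfl, compHom_cls]
  exact cls_rel_one (Rel.comp_id _)

lemma tensorHom_eqHom_id {m n : ℕ} (h : m = n) (p : ℕ) :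
    tensorHom δ m n p p (eqHom h) (cls δ (Word.id p)) = eqHom (congrArg (· + p) h) := by
  subst h
  simp only [eqHom, Word.cast_rfl, tensorHom_cls]
  exact cls_rel_one (Rel.tensor_id _ _)

lemma tensorHom_id_eqHom {m n : ℕ} (h : m = n) (p : ℕ) :
    tensorHom δ p p m n (cls δ (Word.id p)) (eqHom h) = eqHom (congrArg (p + ·) h) := by
  subst h
  simp only [eqHom, Word.cast_rfl, tensorHom_cls]
  exact cls_rel_one (Rel.tensor_id _ _)

lemma tensorHom_interchange {m n p r s t : ℕ} {a b : ZMod 2} (h : HomSpace δ m n)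
    (l : HomSpace δ r s) (f : HomSpace δ n p) (g : HomSpace δ s t) (hh : h ∈ partOf δ m n a)
    (hg : g ∈ partOf δ s t b) :
    compHom δ _ _ _ (tensorHom δ m n r s h l) (tensorHom δ n p s t f g) =
      ssign k (b * a) • tensorHom δ _ _ _ _ (compHom δ m n p h f) (compHom δ r s t l g) := by
  induction hh using Submodule.span_induction with
  | zero => simp only [map_zero, LinearMap.zero_apply, smul_zero]
  | add x y _ _ hx hy => simp only [map_add, LinearMap.add_apply, hx, hy, smul_add]
  | smul c x _ hx => simp only [map_smul, LinearMap.smul_apply, hx, smul_comm c]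
  | mem x hx =>
    obtain ⟨h, rfl, rfl⟩ := hx
    induction hg using Submodule.span_induction with
    | zero => simp only [map_zero, smul_zero]
    | add x y _ _ hx hy => simp only [map_add, hx, hy, smul_add]
    | smul c x _ hx => simp only [map_smul, hx, smul_comm c]
    | mem x hx =>
      obtain ⟨g, rfl, rfl⟩ := hx
      induction l using cls_induction with
      | zero => simp only [map_zero, LinearMap.zero_apply, smul_zero]
      | add x y hx hy => simp only [map_add, LinearMap.add_apply, hx, hy, smul_add]
      | smul c x hx => simp only [map_smul, LinearMap.smul_apply, hx, smul_comm c]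
      | cls l =>
        induction f using cls_induction with
        | zero => simp only [map_zero, LinearMap.zero_apply, smul_zero]
        | add x y hx hy => simp only [map_add, LinearMap.add_apply, hx, hy, smul_add]
        | smul c x hx => simp only [map_smul, LinearMap.smul_apply, hx, smul_comm c]
        | cls f =>
          simp only [tensorHom_cls, compHom_cls]
          exact cls_rel (Rel.super_interchange h l f g)

lemma tensorHom_assoc {m n p r s t : ℕ} (f : HomSpace δ m n) (g : HomSpace δ p r)
    (h : HomSpace δ s t) :
    compHom δ _ _ _ (tensorHom δ _ _ _ _ (tensorHom δ _ _ _ _ f g) h)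
        (eqHom (Nat.add_assoc n r t)) =
      compHom δ _ _ _ (eqHom (Nat.add_assoc m p s))
        (tensorHom δ _ _ _ _ f (tensorHom δ _ _ _ _ g h)) := by
  induction f using cls_induction with
  | zero => simp only [map_zero, LinearMap.zero_apply]
  | add x y hx hy => simp only [map_add, LinearMap.add_apply, hx, hy]
  | smul c x hx => simp only [map_smul, LinearMap.smul_apply, hx]
  | cls f =>
    induction g using cls_induction with
    | zero => simp only [map_zero, LinearMap.zero_apply]
    | add x y hx hy => simp only [map_add, LinearMap.add_apply, hx, hy]
    | smul c x hx => simp only [map_smul, LinearMap.smul_apply, hx]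
    | cls g =>
      induction h using cls_induction with
      | zero => simp only [map_zero, LinearMap.zero_apply]
      | add x y hx hy => simp only [map_add, LinearMap.add_apply, hx, hy]
      | smul c x hx => simp only [map_smul, LinearMap.smul_apply, hx]
      | cls h =>
        simp only [tensorHom_cls]
        rw [compHom_eqHom (Nat.add_assoc m p s), cls_rel_one (Rel.tensor_assoc f g h)]

lemma unit_tensorHom {m n : ℕ} (f : HomSpace δ m n) :
    compHom δ _ _ _ (tensorHom δ 0 0 m n (cls δ (Word.id 0)) f) (eqHom (Nat.zero_add n)) =
      compHom δ _ _ _ (eqHom (Nat.zero_add m)) f := by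
  induction f using cls_induction with
  | zero => simp only [map_zero, LinearMap.zero_apply]
  | add x y hx hy => simp only [map_add, LinearMap.add_apply, hx, hy]
  | smul c x hx => simp only [map_smul, LinearMap.smul_apply, hx]
  | cls f =>
    rw [tensorHom_cls, compHom_eqHom (Nat.zero_add m), cls_rel_one (Rel.unit_tensor f)]

lemma tensorHom_unit {m n : ℕ} (f : HomSpace δ m n) :
    compHom δ _ _ _ (tensorHom δ m n 0 0 f (cls δ (Word.id 0))) (eqHom (Nat.add_zero n)) =
      compHom δ _ _ _ (eqHom (Nat.add_zero m)) f := by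
  induction f using cls_induction with
  | zero => simp only [map_zero, LinearMap.zero_apply]
  | add x y hx hy => simp only [map_add, LinearMap.add_apply, hx, hy]
  | smul c x hx => simp only [map_smul, LinearMap.smul_apply, hx]
  | cls f =>
    rw [tensorHom_cls, compHom_eqHom (Nat.add_zero m), cls_rel_one (Rel.tensor_unit f)]

/-- The monoidal structure is the strict one, up to the identification of equal objects. -/
instance : MonoidalSupercategory k (STL δ) where
  tObj X Y := ⟨X.n + Y.n⟩
  tHom {X₁ Y₁ X₂ Y₂} := tensorHom δ X₁.n Y₁.n X₂.n Y₂.n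
  tHom_mem hf hg := tensorHom_mem hf hg
  tHom_id X Y := (tensorHom_cls _ _).trans (cls_rel_one (Rel.tensor_id X.n Y.n))
  super_interchange h l f g hh hg := tensorHom_interchange h l f g hh hg
  tUnit := ⟨0⟩
  assoc X Y Z := eqIso (Nat.add_assoc X.n Y.n Z.n)
  lunit X := eqIso (Nat.zero_add X.n)
  runit X := eqIso (Nat.add_zero X.n)
  assoc_hom_mem _ _ _ := eqHom_mem _
  assoc_inv_mem _ _ _ := eqHom_mem _
  lunit_hom_mem _ := eqHom_mem _
  lunit_inv_mem _ := eqHom_mem _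
  runit_hom_mem _ := eqHom_mem _
  runit_inv_mem _ := eqHom_mem _
  assoc_naturality f g h := tensorHom_assoc f g h
  lunit_naturality f := unit_tensorHom f
  runit_naturality f := tensorHom_unit f
  pentagon W X Y Z := by
    change compHom δ _ _ _ (tensorHom δ _ _ _ _ (eqHom _) (cls δ (Word.id Z.n)))
      (compHom δ _ _ _ (eqHom _) (tensorHom δ _ _ _ _ (cls δ (Word.id W.n)) (eqHom _))) =
        compHom δ _ _ _ (eqHom _) (eqHom _)
    rw [tensorHom_eqHom_id, tensorHom_id_eqHom, eqHom_trans, eqHom_trans, eqHom_trans]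
  triangle X Y := by
    change compHom δ _ _ _ (eqHom _) (tensorHom δ _ _ _ _ (cls δ (Word.id X.n)) (eqHom _)) =
      tensorHom δ _ _ _ _ (eqHom _) (cls δ (Word.id Y.n))
    rw [tensorHom_eqHom_id, tensorHom_id_eqHom, eqHom_trans]

end STL

/-! ### The super Karoubi envelope -/

/-- The super Karoubi envelope of a supercategory: the idempotent completion of the additive
envelope of the underlying category of the `Π`-envelope. -/
abbrev SKar (k : Type*) [Field k] (C : Type*) [Category* C] [Preadditive C] [Linear k C]
    [Supercategory k C] :=
  Idempotents.Karoubi (Mat_ (Underlying k (PiEnvelope C)))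

instance karoubiMatHasBinaryBiproducts (C : Type*) [Category* C] [Preadditive C] :
    HasBinaryBiproducts (Idempotents.Karoubi (Mat_ C)) :=
  hasBinaryBiproducts_of_finite_biproducts _

/-- The distinguished object `π = Π 𝟙` of the super Karoubi envelope, which is such that the
parity switching functor is `π ⊗ -`. -/
def SKar.piObj (k : Type*) [Field k] (C : Type*) [Category* C] [Preadditive C] [Linear k C]
    [Supercategory k C] [MonoidalSupercategory k C] : SKar k C :=
  (Idempotents.toKaroubi _).obj ((Mat_.embedding _).obj ⟨⟨1, tUnit k⟩⟩)

/-- A preadditive category with finite biproducts is semisimple Abelian if it is Abelian and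
every object is a finite direct sum of simple objects. -/
structure IsSemisimpleAbelian (C : Type*) [Category* C] [P : Preadditive C]
    [HasFiniteBiproducts C] : Prop where
  abelian : ∃ A : Abelian C, A.toPreadditive = P
  semisimple : ∀ X : C, ∃ (n : ℕ) (S : Fin n → C), (∀ i, Simple (S i)) ∧ Nonempty (X ≅ ⨁ S)

/-- The classes of the simple objects in the split Grothendieck group. -/
def K0.simpleClasses (C : Type*) [Category* C] [Preadditive C] [HasBinaryBiproducts C] :
    Set (K0 C) :=
  {x | ∃ S : C, Simple S ∧ x = K0.mk S}

/-- The isomorphism classes of simple objects form a `ℤ`-basis of the Grothendieck group. -/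
structure K0.HasSimpleBasis (C : Type*) [Category* C] [Preadditive C] [HasBinaryBiproducts C] :
    Prop where
  iso_of_eq : ∀ S T : C, Simple S → Simple T → K0.mk S = K0.mk T → Nonempty (S ≅ T)
  linearIndependent : LinearIndependent ℤ (Subtype.val : K0.simpleClasses C → K0 C)
  span_eq_top : Submodule.span ℤ (K0.simpleClasses C) = ⊤

/-! ### The ring `ℤ^π[x, x⁻¹]` -/

/-- The ring `ℤ^π = ℤ[π] / (π² - 1)`. -/
abbrev ZPi := AdjoinRoot (Polynomial.X ^ 2 - 1 : Polynomial ℤ)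

/-- The generator `π` of `ℤ^π`. -/
def ZPi.pi : ZPi := AdjoinRoot.root _

/-- The Laurent polynomial `[n+1]_{x,π} = x^n + π x^{n-2} + ⋯ + π^n x^{-n}`. -/
def qint (n : ℕ) : LaurentPolynomial ZPi :=
  ∑ i ∈ Finset.range (n + 1),
    LaurentPolynomial.C (ZPi.pi ^ i) * LaurentPolynomial.T ((n : ℤ) - 2 * (i : ℤ))

/-- The family consisting of the `[n+1]_{x,π}` and the `π [n+1]_{x,π}`, for `n ∈ ℕ`. -/
def qintFamily (a : ℕ × Fin 2) : LaurentPolynomial ZPi :=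
  LaurentPolynomial.C (ZPi.pi ^ (a.2 : ℕ)) * qint a.1

end

/-!
The objects `S (n, a) = Π^a im (jw n)`, for `n ∈ ℕ` and `a ∈ ℤ/2`, where `jw n` is the odd
analogue of the `n`-th Jones-Wenzl projector, control the super Karoubi envelope of `STL δ`.

The projectors are constructed by Wenzl's recursion (`STL.jwSpec`).  It divides by the values at
`δ = -(q - q⁻¹)` of a signed version of the Chebyshev polynomials, and these are nonzero because
`(q + q⁻¹) chebyshev δ n = q⁻¹ ^ n - (-q) ^ n` and `q` is not a root of unity.  The projector
`jw n` annihilates all cups and caps.  Every morphism of `STL δ` is a linear combination of caps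
followed by cups (`STL.mem_normalForms_of_hom`), hence `End (S (n, a))` consists of the scalars
and there are no nonzero morphisms between different `S (n, a)`; for equal `n` and different
parities the reason is that all endomorphisms of a tensor power are even.  The recursion
decomposes the identity of every tensor power into morphisms that factor through Jones-Wenzl
projectors, so every identity of the envelope factors through a finite sum of the `S (n, a)`. That
the `S (n, a)` are nonzero follows from partial traces and from `𝟙 ≠ 0` in `STL δ`.  The latter is
seen by a monoidal functor to superspaces, which sends the generating object to a space of
dimension `(1|1)` with an odd bilinear form (`OddTL.id_zero_ne_zero`).

A family of objects with these properties is called Schurian here (`IsSchurianFamily`).  In an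
additive idempotent complete category with such a family every morphism `f` satisfies
`f ≫ g ≫ f = f` for some `g`, and then the idempotents `1 - f ≫ g` and `1 - g ≫ f` split off
kernel and cokernel of `f` (`exists_abelian_of_isRegularHom`).  So the category is Abelian, the
`S i` are the simple objects up to isomorphism, every object is a finite direct sum of them, and
the multiplicities `dim Hom(-, S i)` show that their classes are a basis of the Grothendieck
group.

For the ring structure, the recursion splits `jw (n + 1) ⊗ 1` into `jw (n + 2)` and a summand
isomorphic to `jw n` in the opposite parity, as cup and cap are odd.  This gives
`[S (n + 1, a)] [S (1, 0)] = [S (n + 2, a)] + [S (n, a + 1)]`, which is the recursion of the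
Laurent polynomials `[n+1]_{x,π}` (`qint_succ_mul_qint_one`).  So the linear map from the
Grothendieck group that sends `[S (n, a)]` to `π^a [n+1]_{x,π}` is multiplicative
(`STL.character_mul`).  It is injective because multiplication by `x - π x⁻¹` turns the
`[n+1]_{x,π}` into differences of two monomials (`linearIndependent_qintFamily`).
-/

noncomputable section

/-! ### Von Neumann regular categories -/

section Regular

variable {C : Type*} [Category* C]

/-- A morphism `f` is von Neumann regular if it has a quasi-inverse `g`, that is,
`f ∘ g ∘ f = f`. -/
def IsRegularHom {X Y : C} (f : X ⟶ Y) : Prop := ∃ g : Y ⟶ X, f ≫ g ≫ f = f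

lemma IsRegularHom.hasKernel [Preadditive C] [IsIdempotentComplete C] {X Y : C} {f : X ⟶ Y}
    (hf : IsRegularHom f) : HasKernel f := by
  obtain ⟨g, hg⟩ := hf
  obtain ⟨K, i, r, hir, hri⟩ := IsIdempotentComplete.idempotents_split X (𝟙 X - f ≫ g) (by
    simp [Preadditive.sub_comp, Preadditive.comp_sub, reassoc_of% hg])
  have hif : i ≫ f = 0 := by
    rw [← Category.id_comp i, ← hir, Category.assoc, Category.assoc, reassoc_of% hri]
    simp [Preadditive.sub_comp, hg]
  exact HasLimit.mk ⟨KernelFork.ofι i hif, KernelFork.IsLimit.ofι i hif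
    (fun x _ => x ≫ r)
    (fun x hx => by simp [hri, Preadditive.comp_sub, reassoc_of% hx])
    (fun x hx m hm => by rw [← hm, Category.assoc, hir, Category.comp_id])⟩

lemma IsRegularHom.hasCokernel [Preadditive C] [IsIdempotentComplete C] {X Y : C} {f : X ⟶ Y}
    (hf : IsRegularHom f) : HasCokernel f := by
  obtain ⟨g, hg⟩ := hf
  obtain ⟨Q, i, r, hir, hri⟩ := IsIdempotentComplete.idempotents_split Y (𝟙 Y - g ≫ f) (by
    simp [Preadditive.sub_comp, Preadditive.comp_sub, hg])
  have hfr : f ≫ r = 0 := by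
    rw [← Category.comp_id r, ← hir, reassoc_of% hri]
    simp [Preadditive.sub_comp, Preadditive.comp_sub, reassoc_of% hg]
  exact HasColimit.mk ⟨CokernelCofork.ofπ r hfr, CokernelCofork.IsColimit.ofπ r hfr
    (fun x _ => i ≫ x)
    (fun x hx => by rw [reassoc_of% hri]; simp [Preadditive.sub_comp, hx])
    (fun x hx m hm => by rw [← hm, reassoc_of% hir])⟩

/-- A quasi-inverse of a monomorphism is a retraction. -/
lemma IsRegularHom.exists_retraction {X Y : C} {f : X ⟶ Y} (hf : IsRegularHom f) [Mono f] :
    ∃ g : Y ⟶ X, f ≫ g = 𝟙 X := by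
  obtain ⟨g, hg⟩ := hf
  exact ⟨g, by rw [← cancel_mono f, Category.assoc, hg, Category.id_comp]⟩

/-- A quasi-inverse of an epimorphism is a section. -/
lemma IsRegularHom.exists_section {X Y : C} {f : X ⟶ Y} (hf : IsRegularHom f) [Epi f] :
    ∃ g : Y ⟶ X, g ≫ f = 𝟙 Y := by
  obtain ⟨g, hg⟩ := hf
  exact ⟨g, by rw [← cancel_epi f, hg, Category.comp_id]⟩

/-- An additive idempotent complete category in which every morphism is von Neumann regular is
Abelian: the idempotents `1 - f ≫ g` and `1 - g ≫ f` split off kernel and cokernel of `f`. -/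
lemma exists_abelian_of_isRegularHom [P : Preadditive C] [IsIdempotentComplete C]
    [HasFiniteBiproducts C] (h : ∀ {X Y : C} (f : X ⟶ Y), IsRegularHom f) :
    ∃ A : Abelian C, A.toPreadditive = P := by
  have h₁ : IsNormalMonoCategory C := ⟨fun {X Y} f _ => by
    obtain ⟨g, hg⟩ := (h f).exists_retraction
    have w : f ≫ (𝟙 Y - g ≫ f) = 0 := by simp [Preadditive.comp_sub, reassoc_of% hg]
    exact ⟨⟨Y, 𝟙 Y - g ≫ f, w, KernelFork.IsLimit.ofι f w (fun x _ => x ≫ g)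
      (fun x hx => by
        rw [Preadditive.comp_sub, sub_eq_zero, Category.comp_id] at hx
        rw [Category.assoc, ← hx])
      (fun x hx m hm => by rw [← hm, Category.assoc, hg, Category.comp_id])⟩⟩⟩
  have h₂ : IsNormalEpiCategory C := ⟨fun {X Y} f _ => by
    obtain ⟨g, hg⟩ := (h f).exists_section
    have w : (𝟙 X - f ≫ g) ≫ f = 0 := by simp [Preadditive.sub_comp, hg]
    exact ⟨⟨X, 𝟙 X - f ≫ g, w, CokernelCofork.IsColimit.ofπ f w (fun x _ => g ≫ x)
      (fun x hx => by
        rw [Preadditive.sub_comp, sub_eq_zero, Category.id_comp, Category.assoc] at hx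
        exact hx.symm)
      (fun x hx m hm => by rw [← hm, reassoc_of% hg])⟩⟩⟩
  have h₃ : HasKernels C := ⟨fun f => (h f).hasKernel⟩
  have h₄ : HasCokernels C := ⟨fun f => (h f).hasCokernel⟩
  exact ⟨{ P, h₁, h₂ with
    has_finite_products := inferInstance
    has_kernels := h₃
    has_cokernels := h₄ }, rfl⟩

end Regular

/-! ### Categories generated by pairwise orthogonal Schurian objects -/

/-- A family of pairwise orthogonal objects with division rings of endomorphisms through which
every identity morphism factors, up to finite sums. -/
structure IsSchurianFamily {C : Type*} [Category* C] [Preadditive C] {I : Type*} (S : I → C) :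
    Prop where
  isIso_end : ∀ {i : I} (f : S i ⟶ S i), f ≠ 0 → IsIso f
  hom_eq_zero : ∀ {i j : I}, i ≠ j → ∀ f : S i ⟶ S j, f = 0
  id_ne_zero : ∀ i : I, 𝟙 (S i) ≠ 0
  exists_sum : ∀ X : C, ∃ (n : ℕ) (s : Fin n → I) (a : ∀ t, X ⟶ S (s t))
    (b : ∀ t, S (s t) ⟶ X), ∑ t, a t ≫ b t = 𝟙 X

namespace IsSchurianFamily

variable {C : Type*} [Category* C] [Preadditive C] {I : Type*} {S : I → C}
  (hS : IsSchurianFamily S)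

include hS

lemma eq_of_ne_zero {i j : I} {f : S i ⟶ S j} (hf : f ≠ 0) : i = j := by
  by_contra h
  exact hf (hS.hom_eq_zero h f)

lemma isIso_of_ne_zero {i j : I} (f : S i ⟶ S j) (hf : f ≠ 0) : IsIso f := by
  obtain rfl := hS.eq_of_ne_zero hf
  exact hS.isIso_end f hf

lemma isRegularHom_from (i : I) {Y : C} (f : S i ⟶ Y) : IsRegularHom f := by
  by_cases hf : f = 0
  · exact ⟨0, by simp [hf]⟩
  obtain ⟨n, s, a, b, hab⟩ := hS.exists_sum Y
  have : ∃ t, f ≫ a t ≠ 0 := by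
    by_contra! h
    refine hf ?_
    rw [← Category.comp_id f, ← hab, Preadditive.comp_sum]
    exact Finset.sum_eq_zero fun t _ => by rw [reassoc_of% (h t), zero_comp]
  obtain ⟨t, ht⟩ := this
  have := hS.isIso_of_ne_zero _ ht
  refine ⟨a t ≫ inv (f ≫ a t), ?_⟩
  rw [← Category.assoc, ← Category.assoc, IsIso.hom_inv_id, Category.id_comp]

/-- A finite family of morphisms `f t` to `Y` admits an endomorphism `e = ∑ g t ≫ f t` of `Y` that
fixes all the `f t`: the projection to the sum of their images.  The members are added one at a
time, by means of a quasi-inverse of `f j ≫ (1 - e)`. -/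
lemma exists_projection {J : Type*} (s : J → I) {Y : C} (f : ∀ t, S (s t) ⟶ Y) (F : Finset J) :
    ∃ g : ∀ t, Y ⟶ S (s t), ∀ u ∈ F, f u ≫ (∑ t ∈ F, g t ≫ f t) = f u := by
  classical
  induction F using Finset.induction_on with
  | empty => exact ⟨fun _ => 0, by simp⟩
  | insert j F hj ih =>
    obtain ⟨g, hg⟩ := ih
    set e := ∑ t ∈ F, g t ≫ f t with he
    obtain ⟨h, hh⟩ := hS.isRegularHom_from _ (f j ≫ (𝟙 Y - e))
    let g' : ∀ t, Y ⟶ S (s t) := fun t => g t - (𝟙 Y - e) ≫ h ≫ f j ≫ g t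
    refine ⟨Function.update g' j ((𝟙 Y - e) ≫ h), ?_⟩
    have key : ∑ t ∈ insert j F, Function.update g' j ((𝟙 Y - e) ≫ h) t ≫ f t =
        e + (𝟙 Y - e) ≫ h ≫ f j ≫ (𝟙 Y - e) := by
      rw [Finset.sum_insert hj, Function.update_self]
      have : ∑ t ∈ F, Function.update g' j ((𝟙 Y - e) ≫ h) t ≫ f t =
          e - (𝟙 Y - e) ≫ h ≫ f j ≫ e := by
        simp only [he, Preadditive.comp_sum, ← Finset.sum_sub_distrib]
        refine Finset.sum_congr rfl fun t ht => ?_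
        rw [Function.update_of_ne (by rintro rfl; exact hj ht)]
        simp [g', he, Preadditive.sub_comp]
      rw [this]
      simp only [Preadditive.comp_sub, Category.comp_id, Category.assoc]
      abel
    intro u hu
    rw [key]
    rcases Finset.mem_insert.1 hu with rfl | hu
    · rw [Category.assoc] at hh
      rw [Preadditive.comp_add]
      conv_rhs => rw [← Category.comp_id (f u)]
      rw [hh, ← Preadditive.comp_add, add_sub_cancel]
    · rw [Preadditive.comp_add, hg u hu, Preadditive.comp_sub_assoc, hg u hu]
      simp

lemma isRegularHom {X Y : C} (f : X ⟶ Y) : IsRegularHom f := by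
  obtain ⟨n, s, a, b, hab⟩ := hS.exists_sum X
  obtain ⟨g, hg⟩ := hS.exists_projection s (fun t => b t ≫ f) Finset.univ
  refine ⟨∑ t, g t ≫ b t, ?_⟩
  rw [← Category.id_comp (f ≫ _), ← hab]
  conv_rhs => rw [← Category.id_comp f, ← hab]
  simp only [Preadditive.sum_comp, Category.assoc] at hg ⊢
  exact Finset.sum_congr rfl fun u _ => by rw [hg u (Finset.mem_univ u)]

/-- A representation of an identity morphism in which some `b u` depends on the others can be
shortened; a shortest one is orthonormal. -/
lemma exists_orthonormal (X : C) : ∃ (n : ℕ) (s : Fin n → I) (a : ∀ t, X ⟶ S (s t))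
    (b : ∀ t, S (s t) ⟶ X), ∑ t, a t ≫ b t = 𝟙 X ∧ (∀ t, b t ≫ a t = 𝟙 _) ∧
      ∀ t u, t ≠ u → b t ≫ a u = 0 := by
  obtain ⟨n, s, a, b, hab⟩ := hS.exists_sum X
  induction n with
  | zero => exact ⟨0, s, a, b, hab, fun t => t.elim0, fun t => t.elim0⟩
  | succ n ih =>
    by_cases hdep : ∃ (u : Fin (n + 1)) (c : ∀ t, S (s u) ⟶ S (s (u.succAbove t))),
        b u = ∑ t, c t ≫ b (u.succAbove t)
    · obtain ⟨u, c, hc⟩ := hdep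
      refine ih (fun t => s (u.succAbove t)) (fun t => a u ≫ c t + a (u.succAbove t))
        (fun t => b (u.succAbove t)) ?_
      rw [← hab, Fin.sum_univ_succAbove _ u, hc, Preadditive.comp_sum, ← Finset.sum_add_distrib]
      simp [Preadditive.add_comp]
    · -- If `b t ≫ a u` is invertible, then `b t ≫ 𝟙 X = b t` can be solved for `b u`.
      have hoff : ∀ t u, t ≠ u → b t ≫ a u = 0 := by
        intro t u htu
        by_contra h0
        have := hS.isIso_of_ne_zero _ h0
        obtain ⟨v, rfl⟩ := Fin.exists_succAbove_eq htu
        refine hdep ⟨u, fun w => inv (b (u.succAbove v) ≫ a u) ≫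
          ((if h : v = w then eqToHom (by rw [h]) else 0) - b (u.succAbove v) ≫
            a (u.succAbove w)), ?_⟩
        have h1 : b (u.succAbove v) = (b (u.succAbove v) ≫ a u) ≫ b u +
            ∑ w, (b (u.succAbove v) ≫ a (u.succAbove w)) ≫ b (u.succAbove w) := by
          conv_lhs => rw [← Category.comp_id (b (u.succAbove v)), ← hab,
            Fin.sum_univ_succAbove _ u, Preadditive.comp_add, Preadditive.comp_sum]
          simp
        simp only [Category.assoc, ← Preadditive.comp_sum, Preadditive.sub_comp,
          Finset.sum_sub_distrib] at h1 ⊢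
        rw [IsIso.eq_inv_comp]
        rw [Finset.sum_eq_single v (fun w _ hw => by rw [dif_neg hw.symm, zero_comp]) (by simp)]
        simp only [dite_true, eqToHom_refl, Category.id_comp, Category.assoc]
        exact eq_sub_of_add_eq h1.symm
      refine ⟨n + 1, s, a, b, hab, fun u => ?_, hoff⟩
      by_contra h0
      have h1 : b u ≫ a u ≫ b u = b u := by
        conv_rhs => rw [← Category.comp_id (b u), ← hab, Preadditive.comp_sum]
        rw [Finset.sum_eq_single u (fun w _ hw => by
          rw [reassoc_of% (hoff u w hw.symm), zero_comp]) (by simp)]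
      have := hS.isIso_of_ne_zero _ (sub_ne_zero.2 h0)
      refine hdep ⟨u, fun _ => 0, ?_⟩
      have h2 : (b u ≫ a u - 𝟙 _) ≫ b u = 0 := by
        rw [Preadditive.sub_comp, Category.assoc, h1, Category.id_comp, sub_self]
      simpa using (cancel_epi (b u ≫ a u - 𝟙 _)).1 (h2.trans comp_zero.symm)

/-- By regularity a nonzero subobject of `S i` is a retract. -/
lemma simple (i : I) : Simple (S i) := ⟨fun {Y} f _ => by
  constructor
  · rintro hf rfl
    exact hS.id_ne_zero i (by rw [← IsIso.inv_hom_id (0 : Y ⟶ S i), comp_zero])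
  · intro hf
    obtain ⟨g, hg⟩ := (hS.isRegularHom f).exists_retraction
    have h0 : g ≫ f ≠ 0 := fun h => hf (by
      rw [← Category.id_comp f, ← hg, Category.assoc, h, comp_zero])
    have := hS.isIso_end _ h0
    have : IsSplitEpi f := IsSplitEpi.mk' ⟨inv (g ≫ f) ≫ g, by simp⟩
    exact isIso_of_mono_of_isSplitEpi f⟩

lemma exists_iso_of_simple (T : C) [Simple T] : ∃ i, Nonempty (T ≅ S i) := by
  obtain ⟨n, s, a, b, hab, hba, -⟩ := hS.exists_orthonormal T
  rcases n with _ | n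
  · exact absurd (hab.symm.trans (by simp)) (id_nonzero T)
  have : IsSplitMono (b 0) := IsSplitMono.mk' ⟨a 0, hba 0⟩
  have : IsIso (b 0) := isIso_of_mono_of_nonzero fun h => hS.id_ne_zero (s 0) (by
    rw [← hba 0, h, zero_comp])
  exact ⟨s 0, ⟨(asIso (b 0)).symm⟩⟩

lemma exists_iso_biproduct [HasFiniteBiproducts C] (X : C) :
    ∃ (n : ℕ) (s : Fin n → I), Nonempty (X ≅ ⨁ fun t => S (s t)) := by
  obtain ⟨n, s, a, b, hab, hba, hba'⟩ := hS.exists_orthonormal X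
  refine ⟨n, s, ⟨⟨biproduct.lift a, biproduct.desc b, by rw [biproduct.lift_desc, hab], ?_⟩⟩⟩
  refine biproduct.hom_ext' _ _ fun t => biproduct.hom_ext _ _ fun u => ?_
  by_cases h : t = u
  · subst h
    simp [hba]
  · simp [hba' t u h, biproduct.ι_π_ne _ h]

theorem isSemisimpleAbelian [IsIdempotentComplete C] [HasFiniteBiproducts C] :
    IsSemisimpleAbelian C where
  abelian := exists_abelian_of_isRegularHom hS.isRegularHom
  semisimple X := by
    obtain ⟨n, s, e⟩ := hS.exists_iso_biproduct X
    exact ⟨n, fun t => S (s t), fun t => hS.simple _, e⟩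

end IsSchurianFamily

/-! ### The Grothendieck group of a category with a Schurian family -/

namespace IsSchurianFamily

variable {C : Type*} [Category* C] [Preadditive C] {I : Type*} {S : I → C}
  (hS : IsSchurianFamily S)

/-- The endomorphisms of a member of the family form a division ring. -/
abbrev divisionRing (i : I) : DivisionRing (End (S i)) :=
  haveI : Nontrivial (End (S i)) := ⟨⟨𝟙 _, 0, hS.id_ne_zero i⟩⟩
  DivisionRing.ofIsUnitOrEqZero fun f => by
    by_cases h : f = 0
    · exact Or.inr h
    · exact Or.inl ((isUnit_iff_isIso f).2 (hS.isIso_end f h))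

include hS in
lemma finite_hom (i : I) (X : C) : Module.Finite (End (S i)) (X ⟶ S i) := by
  classical
  obtain ⟨n, s, a, b, hab⟩ := hS.exists_sum X
  let a' : Fin n → (X ⟶ S i) := fun t => if h : s t = i then a t ≫ eqToHom (by rw [h]) else 0
  refine ⟨Submodule.fg_def.2 ⟨Set.range a', Set.finite_range a', ?_⟩⟩
  rw [eq_top_iff]
  rintro f -
  rw [← Category.id_comp f, ← hab, Preadditive.sum_comp]
  refine Submodule.sum_mem _ fun t _ => ?_
  by_cases h : s t = i
  · have : (a t ≫ b t) ≫ f = (End.of (eqToHom (by rw [h]) ≫ b t ≫ f) : End (S i)) • a' t := by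
      simp [a', h, End.smul_right, End.of]
    rw [this]
    exact Submodule.smul_mem _ _ (Submodule.subset_span ⟨t, rfl⟩)
  · rw [Category.assoc, hS.hom_eq_zero h (b t ≫ f), comp_zero]
    exact zero_mem _

variable [HasBinaryBiproducts C]

/-- The multiplicity of `S i`, as a homomorphism on the Grothendieck group: the dimension of
`Hom(X, S i)` over the division ring `End (S i)`. -/
def mult (i : I) : K0 C →+ ℤ :=
  K0.lift (fun X => (Module.finrank (End (S i)) (X ⟶ S i) : ℤ))
    (fun X Y ⟨e⟩ => by
      rw [LinearEquiv.finrank_eq (R := End (S i)) (M := X ⟶ S i) (N := Y ⟶ S i)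
        { toFun := fun f => e.inv ≫ f
          invFun := fun f => e.hom ≫ f
          map_add' := by simp
          map_smul' := by simp [End.smul_right]
          left_inv := fun f => by simp
          right_inv := fun f => by simp }])
    (fun X Y => by
      let := hS.divisionRing i
      have := hS.finite_hom i X
      have := hS.finite_hom i Y
      rw [← Nat.cast_add, ← Module.finrank_prod, LinearEquiv.finrank_eq (R := End (S i))
        (M := X ⊞ Y ⟶ S i) (N := (X ⟶ S i) × (Y ⟶ S i))
        { toFun := fun f => (biprod.inl ≫ f, biprod.inr ≫ f)
          invFun := fun f => biprod.desc f.1 f.2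
          map_add' := by simp
          map_smul' := by simp [End.smul_right]
          left_inv := fun f => by ext <;> simp
          right_inv := fun f => by simp }])

lemma mult_self (i : I) : hS.mult i (K0.mk (S i)) = 1 := by
  let := hS.divisionRing i
  rw [mult, K0.lift_mk]
  exact_mod_cast Module.finrank_self (End (S i))

lemma mult_of_ne {i j : I} (h : j ≠ i) : hS.mult i (K0.mk (S j)) = 0 := by
  have : Subsingleton (S j ⟶ S i) := ⟨fun f g => by
    rw [hS.hom_eq_zero h f, hS.hom_eq_zero h g]⟩
  let := hS.divisionRing i
  rw [mult, K0.lift_mk, Module.finrank_zero_of_subsingleton, Nat.cast_zero]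

include hS in
lemma linearIndependent_mk : LinearIndependent ℤ (fun i => K0.mk (S i)) := by
  classical
  rw [linearIndependent_iff']
  intro F c hc i hi
  have := congrArg (hS.mult i) hc
  rw [map_sum, map_zero, Finset.sum_eq_single i] at this
  · simpa [mult_self] using this
  · intro j _ hj
    rw [map_zsmul, hS.mult_of_ne hj, smul_zero]
  · exact fun h => absurd hi h

omit [HasBinaryBiproducts C] in
lemma _root_.K0.mk_eq_zero [HasBinaryBiproducts C] {X : C} (h : IsZero X) : K0.mk X = 0 := by
  have e : X ⊞ X ≅ X := ⟨0, 0, (biprod.hom_ext _ _ (h.eq_of_tgt _ _) (h.eq_of_tgt _ _)),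
    h.eq_of_src _ _⟩
  have := (K0.mk_biprod X X).symm.trans (K0.mk_iso e)
  simpa using this

omit [HasBinaryBiproducts C] in
lemma _root_.K0.mk_eq_sum [HasFiniteBiproducts C] [HasBinaryBiproducts C] {n : ℕ} {X : C}
    (Y : Fin n → C) (e : X ≅ ⨁ Y) : K0.mk X = ∑ t, K0.mk (Y t) := by
  rw [K0.mk_iso e]
  clear e
  induction n with
  | zero =>
    rw [Fin.sum_univ_zero]
    refine K0.mk_eq_zero ?_
    rw [IsZero.iff_id_eq_zero]
    exact biproduct.hom_ext _ _ fun j => j.elim0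
  | succ n ih =>
    have e : ⨁ Y ≅ Y 0 ⊞ ⨁ fun t : Fin n => Y t.succ :=
      { hom := biprod.lift (biproduct.π Y 0) (biproduct.lift fun t => biproduct.π Y t.succ)
        inv := biprod.desc (biproduct.ι Y 0) (biproduct.desc fun t => biproduct.ι Y t.succ)
        hom_inv_id := by
          rw [biprod.lift_desc, biproduct.lift_desc, ← biproduct.total (f := Y),
            Fin.sum_univ_succ]
        inv_hom_id := by
          refine biprod.hom_ext' _ _ (biprod.hom_ext _ _ ?_ ?_)
            (biprod.hom_ext _ _ ?_ ?_)
          · simp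
          · refine biproduct.hom_ext _ _ fun t => ?_
            simp [biproduct.ι_π_ne Y (Fin.succ_ne_zero t).symm]
          · refine biproduct.hom_ext' _ _ fun t => ?_
            simp [biproduct.ι_π_ne Y (Fin.succ_ne_zero t)]
          · refine biproduct.hom_ext' _ _ fun t => biproduct.hom_ext _ _ fun u => ?_
            by_cases h : t = u
            · subst h; simp
            · simp [biproduct.ι_π_ne _ h,
                biproduct.ι_π_ne Y (fun h' => h (Fin.succ_injective n h'))] }
    rw [K0.mk_iso e, K0.mk_biprod, ih, Fin.sum_univ_succ]

include hS

lemma span_mk [HasFiniteBiproducts C] : ⊤ ≤ Submodule.span ℤ (Set.range fun i => K0.mk (S i)) := by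
  have h : ∀ X : C, K0.mk X ∈ Submodule.span ℤ (Set.range fun i => K0.mk (S i)) := fun X => by
    obtain ⟨n, s, ⟨e⟩⟩ := hS.exists_iso_biproduct X
    rw [K0.mk_eq_sum _ e]
    exact Submodule.sum_mem _ fun t _ => Submodule.subset_span ⟨s t, rfl⟩
  rintro x -
  induction x using QuotientAddGroup.induction_on with
  | H x =>
    induction x using FreeAbelianGroup.induction_on with
    | zero => exact zero_mem _
    | of X => exact h X
    | neg X hX => exact neg_mem hX
    | add x y hx hy => exact add_mem hx hy

/-- The classes of the members of the family form a basis of the Grothendieck group. -/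
def basis [HasFiniteBiproducts C] : Module.Basis I ℤ (K0 C) :=
  Module.Basis.mk hS.linearIndependent_mk hS.span_mk

lemma basis_apply [HasFiniteBiproducts C] (i : I) : hS.basis i = K0.mk (S i) :=
  Module.Basis.mk_apply ..

lemma simpleClasses_eq : K0.simpleClasses C = Set.range fun i => K0.mk (S i) := by
  ext x
  constructor
  · rintro ⟨T, _, rfl⟩
    obtain ⟨i, ⟨e⟩⟩ := hS.exists_iso_of_simple T
    exact ⟨i, (K0.mk_iso e).symm⟩
  · rintro ⟨i, rfl⟩
    exact ⟨S i, hS.simple i, rfl⟩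

theorem hasSimpleBasis [HasFiniteBiproducts C] : K0.HasSimpleBasis C where
  iso_of_eq T U _ _ h := by
    obtain ⟨i, ⟨e⟩⟩ := hS.exists_iso_of_simple T
    obtain ⟨j, ⟨e'⟩⟩ := hS.exists_iso_of_simple U
    rw [K0.mk_iso e, K0.mk_iso e'] at h
    obtain rfl := hS.linearIndependent_mk.injective h
    exact ⟨e ≪≫ e'.symm⟩
  linearIndependent := by
    rw [hS.simpleClasses_eq]
    exact hS.linearIndependent_mk.linearIndepOn_id
  span_eq_top := by
    rw [hS.simpleClasses_eq]
    exact top_le_iff.1 hS.span_mk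

end IsSchurianFamily

/-! ### The Laurent polynomials `[n+1]_{x,π}` -/

namespace ZPi

lemma pi_mul_pi : ZPi.pi * ZPi.pi = 1 := by
  have h := AdjoinRoot.eval₂_root (Polynomial.X ^ 2 - 1 : Polynomial ℤ)
  simp only [Polynomial.eval₂_sub, Polynomial.eval₂_pow, Polynomial.eval₂_X,
    Polynomial.eval₂_one] at h
  rw [pi, ← sq]
  exact sub_eq_zero.1 h

/-- The specialization of `ℤ^π` at a square root `ε` of `1`. -/
def specialize (ε : ℤ) (hε : ε ^ 2 = 1) : ZPi →+* ℤ :=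
  AdjoinRoot.lift (RingHom.id ℤ) ε (by simp [hε])

lemma specialize_pi (ε : ℤ) (hε : ε ^ 2 = 1) : specialize ε hε pi = ε :=
  AdjoinRoot.lift_root _

lemma eq_zero_of_add_smul_pi_eq_zero {c d : ℤ} (h : c • (1 : ZPi) + d • pi = 0) :
    c = 0 ∧ d = 0 := by
  have h₁ := congrArg (specialize 1 (by norm_num)) h
  have h₂ := congrArg (specialize (-1) (by norm_num)) h
  simp only [map_add, map_zsmul, map_one, specialize_pi, map_zero, smul_eq_mul] at h₁ h₂
  omega

end ZPi

section qint

open LaurentPolynomial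

lemma qint_zero : qint 0 = 1 := by simp [qint]

lemma qint_one : qint 1 = T 1 + C ZPi.pi * T (-1) := by
  simp [qint, Finset.sum_range_succ]

lemma qint_succ_left (n : ℕ) :
    qint (n + 1) = T ((n : ℤ) + 1) + C ZPi.pi * T (-1) * qint n := by
  rw [qint, Finset.sum_range_succ', add_comm, qint, Finset.mul_sum]
  congr 1
  · simp
  · refine Finset.sum_congr rfl fun i _ => ?_
    rw [pow_succ' ZPi.pi, map_mul, mul_mul_mul_comm, ← T_add]
    congr 2
    push_cast
    ring

lemma qint_succ_right (n : ℕ) :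
    qint (n + 1) = T 1 * qint n + C (ZPi.pi ^ (n + 1)) * T (-((n : ℤ) + 1)) := by
  rw [qint, Finset.sum_range_succ, qint, Finset.mul_sum]
  congr 1
  · refine Finset.sum_congr rfl fun i _ => ?_
    rw [mul_left_comm, ← T_add]
    congr 2
    push_cast
    ring
  · congr 2
    push_cast
    ring

lemma qint_succ_mul_qint_one (n : ℕ) :
    qint (n + 1) * qint 1 = qint (n + 2) + C ZPi.pi * qint n := by
  have h₁ := qint_succ_right (n + 1)
  have h₂ := qint_succ_right n
  have hT : (T (-1) * T 1 : LaurentPolynomial ZPi) = 1 := by rw [← T_add]; simp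
  have h₃ : (T (-1) * T (-((n : ℤ) + 1)) : LaurentPolynomial ZPi) =
      T (-(((n + 1 : ℕ) : ℤ) + 1)) := by
    rw [← T_add]; congr 1; push_cast; ring
  have h₄ : (C (ZPi.pi ^ (n + 1 + 1)) : LaurentPolynomial ZPi) =
      C ZPi.pi * C (ZPi.pi ^ (n + 1)) := by rw [← map_mul, pow_succ' ZPi.pi]
  rw [h₁, qint_one, mul_add, mul_comm _ (T 1), add_assoc]
  congr 1
  conv_lhs => rw [h₂]
  rw [← h₃, h₄]
  linear_combination C ZPi.pi * qint n * hT

/-- Multiplication by `x - π x⁻¹` turns `[n+1]_{x,π}` into a difference of two monomials. -/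
lemma mul_qint (n : ℕ) : (T 1 - C ZPi.pi * T (-1)) * qint n =
    T ((n : ℤ) + 1) - C (ZPi.pi ^ (n + 1)) * T (-((n : ℤ) + 1)) := by
  linear_combination qint_succ_left n - qint_succ_right n

/-- The coefficient of `x^(m+1)` in the product with `x - π x⁻¹`; it detects `[m+1]_{x,π}`. -/
def qintCoeff (m : ℕ) : LaurentPolynomial ZPi →+ ZPi where
  toFun f := ((T 1 - C ZPi.pi * T (-1)) * f : LaurentPolynomial ZPi).coeff ((m : ℤ) + 1)
  map_zero' := by simp
  map_add' f g := by simp [mul_add]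

lemma qintCoeff_qintFamily (m n : ℕ) (a : Fin 2) :
    qintCoeff m (qintFamily (n, a)) = if n = m then ZPi.pi ^ (a : ℕ) else 0 := by
  have h : (T 1 - C ZPi.pi * T (-1)) * qintFamily (n, a) =
      C (ZPi.pi ^ (a : ℕ)) * T ((n : ℤ) + 1) -
        C (ZPi.pi ^ (a : ℕ) * ZPi.pi ^ (n + 1)) * T (-((n : ℤ) + 1)) := by
    rw [qintFamily, mul_left_comm, mul_qint, mul_sub, map_mul, mul_assoc]
  change ((T 1 - C ZPi.pi * T (-1)) * qintFamily (n, a) : LaurentPolynomial ZPi).coeff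
    ((m : ℤ) + 1) = _
  rw [h, ← single_eq_C_mul_T, ← single_eq_C_mul_T]
  have h₁ : -((n : ℤ) + 1) ≠ m + 1 := by omega
  have h₂ : (n : ℤ) + 1 = m + 1 ↔ n = m := by omega
  rw [AddMonoidAlgebra.coeff_sub, Finsupp.sub_apply, AddMonoidAlgebra.coeff_single,
    AddMonoidAlgebra.coeff_single, Finsupp.single_apply, Finsupp.single_apply, if_neg h₁, sub_zero]
  simp only [h₂]

theorem linearIndependent_qintFamily : LinearIndependent ℤ qintFamily := by
  rw [linearIndependent_iff'']
  rintro F c hc h ⟨n, a⟩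
  have hF : F ⊆ F.image Prod.fst ×ˢ Finset.univ := fun p hp => by
    exact Finset.mem_product.2 ⟨Finset.mem_image_of_mem _ hp, Finset.mem_univ _⟩
  rw [Finset.sum_subset hF fun p _ hp => by rw [hc p hp, zero_smul], Finset.sum_product] at h
  have h' := congrArg (qintCoeff n) h
  simp only [map_sum, map_zsmul, qintCoeff_qintFamily, map_zero] at h'
  by_cases hn : n ∈ F.image Prod.fst
  · rw [Finset.sum_eq_single n (fun m _ hm => by simp [hm]) (fun h => absurd hn h)] at h'
    simp only [Fin.sum_univ_two, if_true, Fin.val_zero, Fin.val_one, pow_zero, pow_one] at h'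
    have := ZPi.eq_zero_of_add_smul_pi_eq_zero h'
    fin_cases a
    exacts [this.1, this.2]
  · exact hc _ fun hp => hn (Finset.mem_image_of_mem _ hp)

end qint

/-! ### A fibre functor of the odd Temperley-Lieb supercategory -/

namespace OddTL

open Word

variable {k : Type*} [Field k]

/-- The parity of a tensor product of basis vectors of a superspace with basis `v₀` (even) and
`v₁` (odd); the tensor product is encoded by the sequence of its indices. -/
def vecParity {n : ℕ} (x : Fin n → ZMod 2) : ZMod 2 := ∑ i, x i

/-- The first part of a sequence of indices. -/
def fstPart {m p : ℕ} (x : Fin (m + p) → ZMod 2) : Fin m → ZMod 2 := fun i => x (Fin.castAdd p i)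

/-- The second part of a sequence of indices. -/
def sndPart {m p : ℕ} (x : Fin (m + p) → ZMod 2) : Fin p → ZMod 2 := fun i => x (Fin.natAdd m i)

lemma vecParity_eq_add {m p : ℕ} (x : Fin (m + p) → ZMod 2) :
    vecParity x = vecParity (fstPart x) + vecParity (sndPart x) := by
  simp only [vecParity, Fin.sum_univ_add, fstPart, sndPart]

lemma parts_ext {m p : ℕ} {x y : Fin (m + p) → ZMod 2} :
    x = y ↔ fstPart x = fstPart y ∧ sndPart x = sndPart y := by
  constructor
  · rintro rfl
    exact ⟨rfl, rfl⟩
  · rintro ⟨h₁, h₂⟩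
    funext i
    refine Fin.addCases (fun i => ?_) (fun i => ?_) i
    · exact congrFun h₁ i
    · exact congrFun h₂ i

lemma sum_parts {m p : ℕ} {M : Type*} [AddCommMonoid M]
    (f : (Fin m → ZMod 2) → (Fin p → ZMod 2) → M) :
    ∑ x : Fin (m + p) → ZMod 2, f (fstPart x) (sndPart x) = ∑ y, ∑ z, f y z := by
  rw [← Fintype.sum_prod_type']
  refine Fintype.sum_equiv (Fin.appendEquiv m p).symm _ _ fun x => ?_
  rfl

/-- The matrix coefficients of the operator given by a word, on the tensor powers of the
superspace with basis `v₀` (even) and `v₁` (odd).  The form `cap` is given by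
`v₀ ⊗ v₁ ↦ q`, `v₁ ⊗ v₀ ↦ 1`, and the copairing `cup` is `-v₀ ⊗ v₁ + q⁻¹ v₁ ⊗ v₀`; the sign
in the tensor product comes from moving the second operator past the first vector. -/
def matCoeff (q : k) : ∀ {m n : ℕ}, Word m n → (Fin m → ZMod 2) → (Fin n → ZMod 2) → k
  | _, _, .id _ => fun x y => if x = y then 1 else 0
  | _, _, .comp f g => fun x y => ∑ z, matCoeff q f x z * matCoeff q g z y
  | _, _, .tensor f g => fun x y => ssign k (g.parity * vecParity (fstPart x)) *
      (matCoeff q f (fstPart x) (fstPart y) * matCoeff q g (sndPart x) (sndPart y))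
  | _, _, .cup => fun _ y => if y 0 = 0 ∧ y 1 = 1 then -1 else if y 0 = 1 ∧ y 1 = 0 then q⁻¹ else 0
  | _, _, .cap => fun x _ => if x 0 = 0 ∧ x 1 = 1 then q else if x 0 = 1 ∧ x 1 = 0 then 1 else 0

lemma vecParity_of_matCoeff_ne_zero (q : k) {m n : ℕ} (w : Word m n) (x : Fin m → ZMod 2)
    (y : Fin n → ZMod 2) (h : matCoeff q w x y ≠ 0) : vecParity y = vecParity x + w.parity := by
  induction w with
  | id n =>
    simp only [matCoeff, ne_eq, ite_eq_right_iff, Classical.not_imp] at h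
    rw [h.1, parity, add_zero]
  | comp f g hf hg =>
    obtain ⟨z, -, hz⟩ := Finset.exists_ne_zero_of_sum_ne_zero h
    rw [hg z y (right_ne_zero_of_mul hz), hf x z (left_ne_zero_of_mul hz), parity, add_assoc]
  | tensor f g hf hg =>
    have h := right_ne_zero_of_mul h
    rw [vecParity_eq_add, vecParity_eq_add x, hf _ _ (left_ne_zero_of_mul h),
      hg _ _ (right_ne_zero_of_mul h), parity]
    ring
  | cup =>
    simp only [vecParity, parity, Fin.sum_univ_two, matCoeff] at h ⊢
    split_ifs at h with h₁ h₂
    · simp [h₁]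
    · simp [h₂]
    · exact absurd rfl h
  | cap =>
    simp only [vecParity, parity, Fin.sum_univ_two, matCoeff] at h ⊢
    split_ifs at h with h₁ h₂
    · simp [h₁, CharTwo.add_self_eq_zero]
    · simp [h₂, CharTwo.add_self_eq_zero]
    · exact absurd rfl h

lemma matCoeff_cast (q : k) {m n m' n' : ℕ} (hm : m = m') (hn : n = n') (w : Word m n)
    (x : Fin m' → ZMod 2) (y : Fin n' → ZMod 2) :
    matCoeff q (Word.cast hm hn w) x y =
      matCoeff q w (fun i => x (Fin.cast hm i)) (fun i => y (Fin.cast hn i)) := by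
  subst hm hn
  rfl

lemma sum_cons {n : ℕ} {M : Type*} [AddCommMonoid M] (f : (Fin (n + 1) → ZMod 2) → M) :
    ∑ x, f x = ∑ x, f (Matrix.vecCons 0 x) + ∑ x, f (Matrix.vecCons 1 x) := by
  rw [← (Fin.consEquiv fun _ => ZMod 2).sum_comp, Fintype.sum_prod_type]
  exact Fin.sum_univ_two (fun a : Fin 2 => ∑ x, f (Fin.cons (α := fun _ => ZMod 2) a x))

lemma ssign_one : ssign k 1 = -1 := pow_one _

lemma ssign_mul_self (a : ZMod 2) : ssign k a * ssign k a = 1 := by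
  rw [← ssign_add, CharTwo.add_self_eq_zero, ssign_zero]

lemma matCoeff_zigzag_left {q : k} (hq : q ≠ 0) : matCoeff q
    (comp (n := 3) (tensor (Word.id 1) cup : Word (1 + 0) (1 + 2))
        (tensor cap (Word.id 1) : Word (2 + 1) (0 + 1))) = matCoeff q (Word.id 1) := by
  funext x y
  have hx : x = ![x 0] := by ext i; fin_cases i; rfl
  have hy : y = ![y 0] := by ext i; fin_cases i; rfl
  rw [hx, hy]
  simp only [matCoeff, sum_cons, Finset.univ_unique, Finset.sum_singleton, funext_iff, vecParity,
    fstPart, sndPart, parity]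
  rcases zmod_two_cases (x 0) with h | h <;> rcases zmod_two_cases (y 0) with h' | h' <;>
    rw [h, h'] <;>
    simp [ssign_zero, ssign_one, Fin.forall_fin_one, hq]

lemma matCoeff_zigzag_right {q : k} (hq : q ≠ 0) : matCoeff q
    (comp (n := 3) (tensor cup (Word.id 1) : Word (0 + 1) (2 + 1))
        (tensor (Word.id 1) cap : Word (1 + 2) (1 + 0))) =
      (-1 : k) • matCoeff q (Word.id 1) := by
  funext x y
  have hx : x = ![x 0] := by ext i; fin_cases i; rfl
  have hy : y = ![y 0] := by ext i; fin_cases i; rfl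
  rw [hx, hy]
  simp only [matCoeff, sum_cons, Finset.univ_unique, Finset.sum_singleton, funext_iff, vecParity,
    fstPart, sndPart, parity, Pi.smul_apply]
  rcases zmod_two_cases (x 0) with h | h <;> rcases zmod_two_cases (y 0) with h' | h' <;>
    rw [h, h'] <;>
    simp [ssign_zero, ssign_one, Fin.forall_fin_one, hq]

lemma matCoeff_circle (q : k) :
    matCoeff q (comp cup cap) = (-(q - q⁻¹)) • matCoeff q (Word.id 0) := by
  funext x y
  obtain rfl : x = y := Subsingleton.elim _ _
  simp only [matCoeff, sum_cons, Finset.univ_unique, Finset.sum_singleton, Pi.smul_apply]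
  simp
  ring

lemma matCoeff_interchange (q : k) {m n p r s t : ℕ} (h : Word m n) (l : Word r s)
    (f : Word n p) (g : Word s t) : matCoeff q (comp (tensor h l) (tensor f g)) =
      ssign k (g.parity * h.parity) • matCoeff q (tensor (comp h f) (comp l g)) := by
  funext x y
  simp only [matCoeff, Pi.smul_apply, smul_eq_mul]
  rw [sum_parts (fun z z' => ssign k (l.parity * vecParity (fstPart x)) *
    (matCoeff q h (fstPart x) z * matCoeff q l (sndPart x) z') *
      (ssign k (g.parity * vecParity z) * (matCoeff q f z (fstPart y) *
        matCoeff q g z' (sndPart y)))), Finset.sum_mul_sum, Finset.mul_sum, Finset.mul_sum]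
  refine Finset.sum_congr rfl fun z _ => ?_
  rw [Finset.mul_sum, Finset.mul_sum]
  refine Finset.sum_congr rfl fun z' _ => ?_
  by_cases hz : matCoeff q h (fstPart x) z = 0
  · simp [hz]
  · rw [vecParity_of_matCoeff_ne_zero q h _ _ hz, parity]
    simp only [add_mul, mul_add, ssign_add]
    ring

lemma matCoeff_assoc (q : k) {m n p r s t : ℕ} (f : Word m n) (g : Word p r) (h : Word s t) :
    matCoeff q (Word.cast (Nat.add_assoc m p s) (Nat.add_assoc n r t)
      (tensor (tensor f g) h)) = matCoeff q (tensor f (tensor g h)) := by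
  funext x y
  rw [matCoeff_cast]
  have key : ∀ {a b c : ℕ} (z : Fin (a + (b + c)) → ZMod 2),
      fstPart (fstPart fun i => z (Fin.cast (Nat.add_assoc a b c) i)) = fstPart z ∧
      sndPart (fstPart fun i => z (Fin.cast (Nat.add_assoc a b c) i)) = fstPart (sndPart z) ∧
      sndPart (fun i => z (Fin.cast (Nat.add_assoc a b c) i)) = sndPart (sndPart z) := by
    intro a b c z
    refine ⟨?_, ?_, ?_⟩ <;> funext i <;> refine congrArg z (Fin.ext ?_) <;>
      simp [Nat.add_assoc]
  simp only [matCoeff, parity]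
  rw [vecParity_eq_add (fstPart _)]
  obtain ⟨h₁, h₂, h₃⟩ := key x
  obtain ⟨h₄, h₅, h₆⟩ := key y
  rw [h₁, h₂, h₃, h₄, h₅, h₆]
  simp only [add_mul, mul_add, ssign_add]
  ring

lemma matCoeff_rel {q δ : k} (hq : q ≠ 0) (hδ : δ = -(q - q⁻¹)) {m n : ℕ} {f g : Word m n} {c : k}
    (h : Rel δ f c g) : matCoeff q f = c • matCoeff q g := by
  induction h with
  | id_comp f => funext x y; simp [matCoeff]
  | comp_id f => funext x y; simp [matCoeff]
  | comp_assoc f g h =>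
    funext x y
    simp only [matCoeff, one_smul, Finset.sum_mul, Finset.mul_sum, mul_assoc]
    exact Finset.sum_comm
  | tensor_id m n =>
    funext x y
    simp only [matCoeff, parity, zero_mul, ssign_zero, one_smul, one_mul, parts_ext (x := x)]
    split_ifs <;> simp_all
  | unit_tensor f =>
    funext x y
    rw [matCoeff_cast, one_smul]
    have hx : fstPart (fun i => x (Fin.cast (Nat.zero_add _) i)) = Fin.elim0 :=
      Subsingleton.elim _ _
    have key : ∀ {n : ℕ} (z : Fin n → ZMod 2),
        sndPart (fun i => z (Fin.cast (Nat.zero_add n) i)) = z := fun z => by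
      funext i; refine congrArg z (Fin.ext ?_); simp
    simp only [matCoeff]
    rw [hx, key, key, if_pos (Subsingleton.elim _ _)]
    simp [vecParity, ssign_zero]
  | tensor_unit f =>
    funext x y
    rw [matCoeff_cast, one_smul]
    simp only [matCoeff, parity, zero_mul, ssign_zero, one_mul]
    rw [if_pos (Subsingleton.elim _ _), mul_one]
    rfl
  | tensor_assoc f g h => rw [matCoeff_assoc, one_smul]
  | super_interchange h l f g => exact matCoeff_interchange q h l f g
  | zigzag_left => rw [matCoeff_zigzag_left hq, one_smul]
  | zigzag_right => exact matCoeff_zigzag_right hq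
  | circle => rw [hδ]; exact matCoeff_circle q
  | comp_left g _ ih =>
    funext x y
    simp only [matCoeff, ih, Pi.smul_apply, smul_eq_mul, Finset.mul_sum, mul_assoc]
  | comp_right f _ ih =>
    funext x y
    simp only [matCoeff, ih, Pi.smul_apply, smul_eq_mul, Finset.mul_sum, mul_left_comm]
  | tensor_left g _ ih =>
    funext x y
    simp only [matCoeff, ih, Pi.smul_apply, smul_eq_mul]
    ring
  | tensor_right f h ih =>
    funext x y
    simp only [matCoeff, ih, Pi.smul_apply, smul_eq_mul]
    rw [parity_eq _ _]
    ring

/-- The fibre functor on morphisms, as a matrix indexed by the basis vectors. -/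
def matHom {q δ : k} (hq : q ≠ 0) (hδ : δ = -(q - q⁻¹)) (m n : ℕ) :
    HomSpace δ m n →ₗ[k] (Fin m → ZMod 2) → (Fin n → ZMod 2) → k :=
  liftHom (matCoeff q) fun _ _ _ h => matCoeff_rel hq hδ h

lemma matHom_cls {q δ : k} (hq : q ≠ 0) (hδ : δ = -(q - q⁻¹)) {m n : ℕ} (w : Word m n) :
    matHom hq hδ m n (cls δ w) = matCoeff q w := liftHom_cls _ _ w

/-- The relations do not collapse the odd Temperley-Lieb supercategory. -/
lemma id_zero_ne_zero {q δ : k} (hq : q ≠ 0) (hδ : δ = -(q - q⁻¹)) :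
    (𝟙 (⟨0⟩ : STL δ)) ≠ 0 := fun h => by
  have h' : cls δ (Word.id 0) = 0 := h
  have h₁ := matHom_cls hq hδ (δ := δ) (Word.id 0)
  rw [h', map_zero] at h₁
  simpa [matCoeff] using congrFun (congrFun h₁ 0) 0

end OddTL

/-! ### Normal forms in the odd Temperley-Lieb supercategory -/

namespace STL

open OddTL

variable {k : Type*} [Field k] {δ : k}

/-- The tensor power `·^{⊗n}`. -/
abbrev pt (δ : k) (n : ℕ) : STL δ := ⟨n⟩

/-- The class of a word, as a morphism of `STL δ`. -/
abbrev ofWord (δ : k) {m n : ℕ} (w : Word m n) : pt δ m ⟶ pt δ n := cls δ w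

lemma ofWord_comp {m n p : ℕ} (f : Word m n) (g : Word n p) :
    ofWord δ f ≫ ofWord δ g = ofWord δ (.comp f g) := compHom_cls f g

lemma hom_induction {m n : ℕ} {P : (pt δ m ⟶ pt δ n) → Prop} (f : pt δ m ⟶ pt δ n) (zero : P 0)
    (add : ∀ f g, P f → P g → P (f + g)) (smul : ∀ (c : k) f, P f → P (c • f))
    (ofWord : ∀ w, P (ofWord δ w)) : P f := cls_induction f zero add smul ofWord

/-- The tensor product `f ⊗ 1` with one strand on the right. -/
def addStrand {m n : ℕ} : (pt δ m ⟶ pt δ n) →ₗ[k] (pt δ (m + 1) ⟶ pt δ (n + 1)) :=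
  (tensorHom δ m n 1 1).flip (cls δ (.id 1))

/-- The tensor product `1 ⊗ f` with `l` strands on the left. -/
def leftStrands (l : ℕ) {m n : ℕ} : (pt δ m ⟶ pt δ n) →ₗ[k] (pt δ (l + m) ⟶ pt δ (l + n)) :=
  tensorHom δ l l m n (cls δ (.id l))

lemma addStrand_ofWord {m n : ℕ} (w : Word m n) :
    addStrand (ofWord δ w) = ofWord δ (.tensor w (.id 1)) := tensorHom_cls _ _

lemma leftStrands_ofWord (l : ℕ) {m n : ℕ} (w : Word m n) :
    leftStrands l (ofWord δ w) = ofWord δ (.tensor (.id l) w) := tensorHom_cls _ _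

lemma addStrand_id (n : ℕ) : addStrand (𝟙 (pt δ n)) = 𝟙 (pt δ (n + 1)) :=
  (addStrand_ofWord _).trans (cls_rel_one (Rel.tensor_id n 1))

lemma leftStrands_id (l n : ℕ) : leftStrands l (𝟙 (pt δ n)) = 𝟙 (pt δ (l + n)) :=
  (leftStrands_ofWord l _).trans (cls_rel_one (Rel.tensor_id l n))

lemma ofWord_interchange {m n p r s t : ℕ} (h : Word m n) (l : Word r s) (f : Word n p)
    (g : Word s t) : ofWord δ (.tensor h l) ≫ ofWord δ (.tensor f g) =
      ssign k (g.parity * h.parity) • ofWord δ (.tensor (.comp h f) (.comp l g)) := by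
  rw [ofWord_comp]
  exact cls_rel (Rel.super_interchange h l f g)

lemma ofWord_tensor_congr {m n p r : ℕ} {f f' : Word m n} {g g' : Word p r}
    (hf : ofWord δ f = ofWord δ f') (hg : ofWord δ g = ofWord δ g') :
    ofWord δ (.tensor f g) = ofWord δ (.tensor f' g') :=
  (tensorHom_cls f g).symm.trans (Eq.trans
    (congrArg₂ (fun x y => tensorHom δ m n p r x y) hf hg) (tensorHom_cls f' g'))

lemma ofWord_id_comp {m n : ℕ} (f : Word m n) : ofWord δ (.comp (.id m) f) = ofWord δ f :=
  cls_rel_one (Rel.id_comp f)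

lemma ofWord_comp_id {m n : ℕ} (f : Word m n) : ofWord δ (.comp f (.id n)) = ofWord δ f :=
  cls_rel_one (Rel.comp_id f)

lemma ofWord_tensor_id_zero {m n : ℕ} (f : Word m n) :
    ofWord δ (.tensor f (.id 0)) = ofWord δ f :=
  cls_rel_one (Rel.tensor_unit f)

lemma ofWord_tensor_id_one_id_one {m n : ℕ} (f : Word m n) :
    ofWord δ (.tensor (.tensor f (.id 1)) (.id 1)) = ofWord δ (.tensor f (.id 2)) :=
  (cls_rel_one (Rel.tensor_assoc f (.id 1) (.id 1))).trans
    (ofWord_tensor_congr rfl (cls_rel_one (Rel.tensor_id 1 1)))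

lemma addStrand_comp {m n p : ℕ} (f : pt δ m ⟶ pt δ n) (g : pt δ n ⟶ pt δ p) :
    addStrand (f ≫ g) = addStrand f ≫ addStrand g := by
  induction f using hom_induction with
  | zero => simp
  | add f f' hf hf' => simp [hf, hf', Preadditive.add_comp]
  | smul c f hf => simp [hf]
  | ofWord f =>
    induction g using hom_induction with
    | zero => simp
    | add g g' hg hg' => simp [hg, hg', Preadditive.comp_add]
    | smul c g hg => simp [hg]
    | ofWord g =>
      rw [ofWord_comp, addStrand_ofWord, addStrand_ofWord, addStrand_ofWord, ofWord_interchange]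
      simp only [Word.parity, zero_mul, ssign_zero, one_smul]
      exact ofWord_tensor_congr rfl (ofWord_id_comp _).symm

lemma leftStrands_comp (l : ℕ) {m n p : ℕ} (f : pt δ m ⟶ pt δ n) (g : pt δ n ⟶ pt δ p) :
    leftStrands l (f ≫ g) = leftStrands l f ≫ leftStrands l g := by
  induction f using hom_induction with
  | zero => simp
  | add f f' hf hf' => simp [hf, hf', Preadditive.add_comp]
  | smul c f hf => simp [hf]
  | ofWord f =>
    induction g using hom_induction with
    | zero => simp
    | add g g' hg hg' => simp [hg, hg', Preadditive.comp_add]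
    | smul c g hg => simp [hg]
    | ofWord g =>
      rw [ofWord_comp, leftStrands_ofWord, leftStrands_ofWord, leftStrands_ofWord,
        ofWord_interchange]
      simp only [Word.parity, mul_zero, ssign_zero, one_smul]
      exact ofWord_tensor_congr (ofWord_id_comp _).symm rfl

lemma leftStrands_addStrand (l : ℕ) {m n : ℕ} (f : pt δ m ⟶ pt δ n) :
    leftStrands l (addStrand f) = addStrand (leftStrands l f) := by
  induction f using hom_induction with
  | zero => simp
  | add f f' hf hf' => simp [hf, hf']
  | smul c f hf => simp [hf]
  | ofWord f =>
    rw [addStrand_ofWord, leftStrands_ofWord, leftStrands_ofWord, addStrand_ofWord]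
    exact (cls_rel_one (Rel.tensor_assoc (.id l) f (.id 1))).symm

/-- The cap on the last two strands. -/
def lastCap (δ : k) (n : ℕ) : pt δ (n + 2) ⟶ pt δ n := ofWord δ (.tensor (.id n) .cap)

/-- The cup on the last two strands. -/
def lastCup (δ : k) (n : ℕ) : pt δ n ⟶ pt δ (n + 2) := ofWord δ (.tensor (.id n) .cup)

lemma leftStrands_lastCap (l n : ℕ) : leftStrands l (lastCap δ n) = lastCap δ (l + n) := by
  rw [lastCap, leftStrands_ofWord]
  exact (cls_rel_one (Rel.tensor_assoc (.id l) (.id n) .cap)).symm.trans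
    (ofWord_tensor_congr (cls_rel_one (Rel.tensor_id l n)) rfl)

lemma leftStrands_lastCup (l n : ℕ) : leftStrands l (lastCup δ n) = lastCup δ (l + n) := by
  rw [lastCup, leftStrands_ofWord]
  exact (cls_rel_one (Rel.tensor_assoc (.id l) (.id n) .cup)).symm.trans
    (ofWord_tensor_congr (cls_rel_one (Rel.tensor_id l n)) rfl)

lemma lastCup_lastCap (n : ℕ) : lastCup δ n ≫ lastCap δ n = δ • 𝟙 (pt δ n) := by
  have h : lastCup δ 0 ≫ lastCap δ 0 = δ • 𝟙 (pt δ 0) := by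
    have h₁ : lastCup δ 0 = ofWord δ .cup := cls_rel_one (Rel.unit_tensor .cup)
    have h₂ : lastCap δ 0 = ofWord δ .cap := cls_rel_one (Rel.unit_tensor .cap)
    rw [h₁, h₂, ofWord_comp]
    exact cls_rel Rel.circle
  have h' := congrArg (leftStrands n) h
  rw [leftStrands_comp, leftStrands_lastCup, leftStrands_lastCap, map_smul, leftStrands_id] at h'
  exact h'

lemma lastCup_addStrand_lastCap (n : ℕ) :
    lastCup δ (n + 1) ≫ addStrand (lastCap δ n) = 𝟙 (pt δ (n + 1)) := by
  have h : lastCup δ 1 ≫ addStrand (lastCap δ 0) = 𝟙 (pt δ 1) := by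
    have h₂ : lastCap δ 0 = ofWord δ .cap := cls_rel_one (Rel.unit_tensor .cap)
    rw [h₂, addStrand_ofWord]
    exact (compHom_cls _ _).trans (cls_rel_one Rel.zigzag_left)
  have h' := congrArg (leftStrands n) h
  rw [leftStrands_comp, leftStrands_lastCup, leftStrands_addStrand, leftStrands_lastCap,
    leftStrands_id] at h'
  exact h'

lemma addStrand_lastCup_lastCap (n : ℕ) :
    addStrand (lastCup δ n) ≫ lastCap δ (n + 1) = -𝟙 (pt δ (n + 1)) := by
  have h : addStrand (lastCup δ 0) ≫ lastCap δ 1 = -𝟙 (pt δ 1) := by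
    have h₂ : lastCup δ 0 = ofWord δ .cup := cls_rel_one (Rel.unit_tensor .cup)
    rw [h₂, addStrand_ofWord]
    refine (compHom_cls _ _).trans ((cls_rel Rel.zigzag_right).trans ?_)
    exact neg_one_smul k (𝟙 (pt δ 1))
  have h' := congrArg (leftStrands n) h
  rw [leftStrands_comp, leftStrands_lastCap, leftStrands_addStrand, leftStrands_lastCup,
    map_neg, leftStrands_id] at h'
  exact h'

/-- A morphism slides past a cap to the right of it, with a sign. -/
lemma addStrand_addStrand_lastCap {m n : ℕ} {p : ZMod 2} {f : pt δ m ⟶ pt δ n}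
    (hf : f ∈ homPart k (pt δ m) (pt δ n) p) :
    addStrand (addStrand f) ≫ lastCap δ n = ssign k p • lastCap δ m ≫ f := by
  induction hf using Submodule.span_induction with
  | zero => simp
  | add f g _ _ hf hg => simp only [map_add, Preadditive.add_comp, Preadditive.comp_add, hf, hg,
      smul_add]
  | smul c f _ hf => simp only [map_smul, Linear.smul_comp, Linear.comp_smul, hf, smul_comm c]
  | mem f hf =>
    obtain ⟨w, rfl, rfl⟩ := hf
    change addStrand (addStrand (ofWord δ w)) ≫ _ = _ • lastCap δ m ≫ ofWord δ w
    rw [addStrand_ofWord, addStrand_ofWord, ofWord_tensor_id_one_id_one,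
      ← ofWord_tensor_id_zero w, lastCap, lastCap, ofWord_interchange]
    refine congrArg₂ (fun (c : k) x => c • x) ?_ ?_
    · simp [Word.parity]
    · refine Eq.trans ?_ (ofWord_interchange (.id m) .cap w (.id 0)).symm
      simp only [Word.parity, mul_zero, ssign_zero, one_smul]
      refine ofWord_tensor_congr ?_ ?_
      · rw [ofWord_comp_id, ofWord_id_comp]
      · rw [ofWord_comp_id, ofWord_id_comp]

/-- A morphism slides past a cup to the right of it, with a sign. -/
lemma comp_lastCup {m n : ℕ} {p : ZMod 2} {f : pt δ m ⟶ pt δ n}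
    (hf : f ∈ homPart k (pt δ m) (pt δ n) p) :
    f ≫ lastCup δ n = ssign k p • lastCup δ m ≫ addStrand (addStrand f) := by
  induction hf using Submodule.span_induction with
  | zero => simp
  | add f g _ _ hf hg => simp only [map_add, Preadditive.add_comp, Preadditive.comp_add, hf, hg,
      smul_add]
  | smul c f _ hf => simp only [map_smul, Linear.smul_comp, Linear.comp_smul, hf, smul_comm c]
  | mem f hf =>
    obtain ⟨w, rfl, rfl⟩ := hf
    change ofWord δ w ≫ _ = _ • lastCup δ m ≫ addStrand (addStrand (ofWord δ w))
    rw [addStrand_ofWord, addStrand_ofWord, ofWord_tensor_id_one_id_one,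
      ← ofWord_tensor_id_zero w, lastCup, lastCup, ofWord_interchange]
    refine congrArg₂ (fun (c : k) x => c • x) ?_ ?_
    · simp [Word.parity]
    · refine Eq.trans ?_ (ofWord_interchange (.id m) .cup w (.id 2)).symm
      simp only [Word.parity, zero_mul, ssign_zero, one_smul]
      refine ofWord_tensor_congr ?_ ?_
      · rw [ofWord_comp_id, ofWord_id_comp]
      · rw [ofWord_comp_id, ofWord_id_comp]

end STL

namespace STL

open OddTL

variable {k : Type*} [Field k] {δ : k}

/-- The elementary caps: a cap on two neighbouring strands, tensored with identities. -/
inductive IsCap : ∀ {m n : ℕ}, (pt δ m ⟶ pt δ n) → Prop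
  | last (n : ℕ) : IsCap (lastCap δ n)
  | addStrand {m n : ℕ} {c : pt δ m ⟶ pt δ n} (h : IsCap c) : IsCap (addStrand c)

/-- The elementary cups: a cup on two neighbouring strands, tensored with identities. -/
inductive IsCup : ∀ {m n : ℕ}, (pt δ m ⟶ pt δ n) → Prop
  | last (n : ℕ) : IsCup (lastCup δ n)
  | addStrand {m n : ℕ} {u : pt δ m ⟶ pt δ n} (h : IsCup u) : IsCup (addStrand u)

lemma IsCap.eq_add_two {m n : ℕ} {c : pt δ m ⟶ pt δ n} (h : IsCap c) : m = n + 2 := by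
  induction h with
  | last n => rfl
  | addStrand h ih => omega

lemma IsCup.eq_add_two {m n : ℕ} {u : pt δ m ⟶ pt δ n} (h : IsCup u) : n = m + 2 := by
  induction h with
  | last n => rfl
  | addStrand h ih => omega

lemma IsCap.leftStrands (l : ℕ) {m n : ℕ} {c : pt δ m ⟶ pt δ n} (h : IsCap c) :
    IsCap (leftStrands l c) := by
  induction h with
  | last n => rw [leftStrands_lastCap]; exact .last _
  | addStrand h ih => rw [leftStrands_addStrand]; exact .addStrand ih

lemma IsCup.leftStrands (l : ℕ) {m n : ℕ} {u : pt δ m ⟶ pt δ n} (h : IsCup u) :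
    IsCup (leftStrands l u) := by
  induction h with
  | last n => rw [leftStrands_lastCup]; exact .last _
  | addStrand h ih => rw [leftStrands_addStrand]; exact .addStrand ih

/-- The possible values of a cup followed by a cap: a multiple of the identity, or a multiple of a
cap followed by a cup. -/
inductive IsCupCap : ∀ {n : ℕ}, (pt δ n ⟶ pt δ n) → Prop
  | id {n : ℕ} (r : k) : IsCupCap (r • 𝟙 (pt δ n))
  | swap {m n : ℕ} {c : pt δ n ⟶ pt δ m} {u : pt δ m ⟶ pt δ n} (hc : IsCap c) (hu : IsCup u)
    (r : k) : IsCupCap (r • c ≫ u)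

lemma IsCupCap.addStrand {n : ℕ} {f : pt δ n ⟶ pt δ n} (h : IsCupCap f) :
    IsCupCap (addStrand f) := by
  cases h with
  | id r => rw [map_smul, addStrand_id]; exact .id r
  | swap hc hu r => rw [map_smul, addStrand_comp]; exact .swap hc.addStrand hu.addStrand r

lemma lastCap_mem (n : ℕ) : lastCap δ n ∈ homPart k (pt δ (n + 2)) (pt δ n) 1 := by
  have h : (Word.tensor (.id n) .cap).parity = 1 := zero_add _
  exact h ▸ cls_mem (δ := δ) (.tensor (.id n) .cap)

lemma lastCup_mem (n : ℕ) : lastCup δ n ∈ homPart k (pt δ n) (pt δ (n + 2)) 1 := by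
  have h : (Word.tensor (.id n) .cup).parity = 1 := zero_add _
  exact h ▸ cls_mem (δ := δ) (.tensor (.id n) .cup)

lemma exists_parity {m n : ℕ} (f : pt δ m ⟶ pt δ n) :
    f = 0 ∨ ∃ p, f ∈ homPart k (pt δ m) (pt δ n) p := by
  by_cases h : Nonempty (Word m n)
  · obtain ⟨w⟩ := h
    refine Or.inr ⟨w.parity, ?_⟩
    change f ∈ partOf δ m n w.parity
    rw [partOf_eq_top w]
    trivial
  · left
    induction f using hom_induction with
    | zero => rfl
    | add f g hf hg => rw [hf, hg, add_zero]
    | smul c f hf => rw [hf, smul_zero]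
    | ofWord w => exact absurd ⟨w⟩ h

lemma IsCap.exists_parity {m n : ℕ} {c : pt δ m ⟶ pt δ n} (_ : IsCap c) :
    ∃ p, c ∈ homPart k (pt δ m) (pt δ n) p :=
  (STL.exists_parity c).elim (fun h => ⟨0, h ▸ zero_mem _⟩) id

lemma isCupCap_comp {m n : ℕ} {u : pt δ m ⟶ pt δ n} (hu : IsCup u) {c : pt δ n ⟶ pt δ m}
    (hc : IsCap c) : IsCupCap (u ≫ c) := by
  induction hu with
  | last m =>
    cases hc with
    | last => rw [lastCup_lastCap]; exact .id δ
    | addStrand hc =>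
      cases hc with
      | last n =>
        rw [lastCup_addStrand_lastCap, ← one_smul k (𝟙 _)]
        exact .id 1
      | @addStrand _ n c hc =>
        obtain ⟨p, hp⟩ := hc.exists_parity
        have h := comp_lastCup hp
        have h' : lastCup δ _ ≫ addStrand (addStrand c) = ssign k p • c ≫ lastCup δ n := by
          rw [h, smul_smul, ssign_mul_self, one_smul]
        rw [h']
        exact .swap hc (.last n) _
  | addStrand hu ih =>
    cases hc with
    | last =>
      cases hu with
      | last n =>
        rw [addStrand_lastCup_lastCap, ← neg_one_smul k (𝟙 _)]
        exact .id (-1)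
      | @addStrand n _ u hu =>
        rcases STL.exists_parity u with h0 | ⟨p, hp⟩
        · subst h0
          rw [map_zero, map_zero, zero_comp, ← zero_smul k (𝟙 _)]
          exact .id 0
        · rw [addStrand_addStrand_lastCap hp]
          exact .swap (.last n) hu _
    | addStrand hc =>
      rw [← addStrand_comp]
      exact (ih hc).addStrand

/-- Compositions of elementary caps. -/
inductive IsCaps : ∀ {m n : ℕ}, (pt δ m ⟶ pt δ n) → Prop
  | id (n : ℕ) : IsCaps (𝟙 (pt δ n))
  | cons {m n p : ℕ} {c : pt δ m ⟶ pt δ n} {f : pt δ n ⟶ pt δ p} (hc : IsCap c) (hf : IsCaps f) :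
    IsCaps (c ≫ f)

/-- Compositions of elementary cups. -/
inductive IsCups : ∀ {m n : ℕ}, (pt δ m ⟶ pt δ n) → Prop
  | id (n : ℕ) : IsCups (𝟙 (pt δ n))
  | snoc {m n p : ℕ} {f : pt δ m ⟶ pt δ n} {u : pt δ n ⟶ pt δ p} (hf : IsCups f) (hu : IsCup u) :
    IsCups (f ≫ u)

lemma IsCups.cons {m n p : ℕ} {u : pt δ m ⟶ pt δ n} {f : pt δ n ⟶ pt δ p} (hu : IsCup u)
    (hf : IsCups f) : IsCups (u ≫ f) := by
  induction hf with
  | id =>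
    rw [Category.comp_id, ← Category.id_comp u]
    exact .snoc (.id _) hu
  | snoc hf hv ih => rw [← Category.assoc]; exact .snoc ih hv

lemma IsCaps.addStrand {m n : ℕ} {f : pt δ m ⟶ pt δ n} (h : IsCaps f) : IsCaps (addStrand f) := by
  induction h with
  | id => rw [addStrand_id]; exact .id _
  | cons hc hf ih => rw [addStrand_comp]; exact .cons hc.addStrand ih

lemma IsCups.addStrand {m n : ℕ} {f : pt δ m ⟶ pt δ n} (h : IsCups f) : IsCups (addStrand f) := by
  induction h with
  | id => rw [addStrand_id]; exact .id _
  | snoc hf hu ih => rw [addStrand_comp]; exact .snoc ih hu.addStrand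

lemma IsCaps.leftStrands (l : ℕ) {m n : ℕ} {f : pt δ m ⟶ pt δ n} (h : IsCaps f) :
    IsCaps (leftStrands l f) := by
  induction h with
  | id => rw [leftStrands_id]; exact .id _
  | cons hc hf ih => rw [leftStrands_comp]; exact .cons (hc.leftStrands l) ih

lemma IsCups.leftStrands (l : ℕ) {m n : ℕ} {f : pt δ m ⟶ pt δ n} (h : IsCups f) :
    IsCups (leftStrands l f) := by
  induction h with
  | id => rw [leftStrands_id]; exact .id _
  | snoc hf hu ih => rw [leftStrands_comp]; exact .snoc ih (hu.leftStrands l)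

/-- The span of the morphisms in normal form: caps followed by cups. -/
def normalForms (δ : k) (m n : ℕ) : Submodule k (pt δ m ⟶ pt δ n) :=
  Submodule.span k {x | ∃ (r : ℕ) (c : pt δ m ⟶ pt δ r) (u : pt δ r ⟶ pt δ n),
    IsCaps c ∧ IsCups u ∧ x = c ≫ u}

lemma mem_normalForms {m r n : ℕ} {c : pt δ m ⟶ pt δ r} {u : pt δ r ⟶ pt δ n} (hc : IsCaps c)
    (hu : IsCups u) : c ≫ u ∈ normalForms δ m n := Submodule.subset_span ⟨r, c, u, hc, hu, rfl⟩

@[elab_as_elim]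
lemma normalForms_induction {m n : ℕ} {P : ∀ f : pt δ m ⟶ pt δ n, f ∈ normalForms δ m n → Prop}
    {f : pt δ m ⟶ pt δ n} (hf : f ∈ normalForms δ m n) (zero : P 0 (zero_mem _))
    (add : ∀ f g hf hg, P f hf → P g hg → P (f + g) (add_mem hf hg))
    (smul : ∀ (a : k) f hf, P f hf → P (a • f) (Submodule.smul_mem _ a hf))
    (comp : ∀ {r : ℕ} (c : pt δ m ⟶ pt δ r) (u : pt δ r ⟶ pt δ n) (hc : IsCaps c) (hu : IsCups u),
      P (c ≫ u) (mem_normalForms hc hu)) : P f hf := by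
  induction hf using Submodule.span_induction with
  | zero => exact zero
  | add f g hf hg ihf ihg => exact add f g hf hg ihf ihg
  | smul a f hf ih => exact smul a f hf ih
  | mem f hf =>
    obtain ⟨r, c, u, hc, hu, rfl⟩ := hf
    exact comp c u hc hu

lemma cap_comp_mem {m n p : ℕ} {c : pt δ m ⟶ pt δ n} (hc : IsCap c) {f : pt δ n ⟶ pt δ p}
    (hf : f ∈ normalForms δ n p) : c ≫ f ∈ normalForms δ m p := by
  induction hf using normalForms_induction with
  | zero => rw [comp_zero]; exact zero_mem _
  | add f g _ _ hf hg => rw [Preadditive.comp_add]; exact add_mem hf hg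
  | smul a f _ hf => rw [Linear.comp_smul]; exact Submodule.smul_mem _ _ hf
  | comp d u hd hu => rw [← Category.assoc]; exact mem_normalForms (.cons hc hd) hu

lemma caps_comp_mem {m n p : ℕ} {c : pt δ m ⟶ pt δ n} (hc : IsCaps c) {f : pt δ n ⟶ pt δ p}
    (hf : f ∈ normalForms δ n p) : c ≫ f ∈ normalForms δ m p := by
  induction hc with
  | id => rwa [Category.id_comp]
  | cons hc _ ih => rw [Category.assoc]; exact cap_comp_mem hc (ih hf)

/-- A cup is moved past the caps one at a time. -/
lemma cup_comp_caps_comp_cups_mem {n r p : ℕ} {d : pt δ n ⟶ pt δ r} (hd : IsCaps d)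
    {v : pt δ r ⟶ pt δ p} (hv : IsCups v) :
    ∀ {m : ℕ} {u : pt δ m ⟶ pt δ n}, IsCup u → u ≫ d ≫ v ∈ normalForms δ m p := by
  induction hd with
  | id =>
    intro m u hu
    rw [Category.id_comp, ← Category.id_comp (u ≫ v)]
    exact mem_normalForms (.id _) (.cons hu hv)
  | @cons n n' r c f hc hf ih =>
    intro m u hu
    obtain rfl : m = n' := by
      have := hc.eq_add_two
      have := hu.eq_add_two
      omega
    have h := isCupCap_comp hu hc
    rw [Category.assoc, ← Category.assoc u]
    generalize u ≫ c = x at h ⊢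
    cases h with
    | id a =>
      rw [Linear.smul_comp, Category.id_comp]
      exact Submodule.smul_mem _ _ (mem_normalForms hf hv)
    | swap hc' hu' a =>
      rw [Linear.smul_comp, Category.assoc]
      exact Submodule.smul_mem _ _ (cap_comp_mem hc' (ih hv hu'))

lemma cup_comp_mem {m n p : ℕ} {u : pt δ m ⟶ pt δ n} (hu : IsCup u) {f : pt δ n ⟶ pt δ p}
    (hf : f ∈ normalForms δ n p) : u ≫ f ∈ normalForms δ m p := by
  induction hf using normalForms_induction with
  | zero => rw [comp_zero]; exact zero_mem _
  | add f g _ _ hf hg => rw [Preadditive.comp_add]; exact add_mem hf hg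
  | smul a f _ hf => rw [Linear.comp_smul]; exact Submodule.smul_mem _ _ hf
  | comp d v hd hv => exact cup_comp_caps_comp_cups_mem hd hv hu

lemma cups_comp_mem {m n p : ℕ} {u : pt δ m ⟶ pt δ n} (hu : IsCups u) {f : pt δ n ⟶ pt δ p}
    (hf : f ∈ normalForms δ n p) : u ≫ f ∈ normalForms δ m p := by
  induction hu with
  | id => rwa [Category.id_comp]
  | snoc _ hv ih => rw [Category.assoc]; exact ih (cup_comp_mem hv hf)

lemma comp_mem_normalForms {m n p : ℕ} {f : pt δ m ⟶ pt δ n} (hf : f ∈ normalForms δ m n)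
    {g : pt δ n ⟶ pt δ p} (hg : g ∈ normalForms δ n p) : f ≫ g ∈ normalForms δ m p := by
  induction hf using normalForms_induction with
  | zero => rw [zero_comp]; exact zero_mem _
  | add f g _ _ hf hg => rw [Preadditive.add_comp]; exact add_mem hf hg
  | smul a f _ hf => rw [Linear.smul_comp]; exact Submodule.smul_mem _ _ hf
  | comp c u hc hu => rw [Category.assoc]; exact caps_comp_mem hc (cups_comp_mem hu hg)

lemma addStrand_mem_normalForms {m n : ℕ} {f : pt δ m ⟶ pt δ n} (hf : f ∈ normalForms δ m n) :
    addStrand f ∈ normalForms δ (m + 1) (n + 1) := by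
  induction hf using normalForms_induction with
  | zero => rw [map_zero]; exact zero_mem _
  | add f g _ _ hf hg => rw [map_add]; exact add_mem hf hg
  | smul a f _ hf => rw [map_smul]; exact Submodule.smul_mem _ _ hf
  | comp c u hc hu => rw [addStrand_comp]; exact mem_normalForms hc.addStrand hu.addStrand

lemma leftStrands_mem_normalForms (l : ℕ) {m n : ℕ} {f : pt δ m ⟶ pt δ n}
    (hf : f ∈ normalForms δ m n) : leftStrands l f ∈ normalForms δ (l + m) (l + n) := by
  induction hf using normalForms_induction with
  | zero => rw [map_zero]; exact zero_mem _
  | add f g _ _ hf hg => rw [map_add]; exact add_mem hf hg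
  | smul a f _ hf => rw [map_smul]; exact Submodule.smul_mem _ _ hf
  | comp c u hc hu =>
    rw [leftStrands_comp]
    exact mem_normalForms (hc.leftStrands l) (hu.leftStrands l)

lemma ofWord_tensor_id_mem {m n : ℕ} (w : Word m n) (hw : ofWord δ w ∈ normalForms δ m n)
    (p : ℕ) : ofWord δ (.tensor w (.id p)) ∈ normalForms δ (m + p) (n + p) := by
  induction p with
  | zero => rwa [ofWord_tensor_id_zero]
  | succ p ih =>
    have := addStrand_mem_normalForms ih
    rw [addStrand_ofWord] at this
    have h : ofWord δ (.tensor (.tensor w (.id p)) (.id 1)) =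
        ofWord δ (.tensor w (.id (p + 1))) :=
      (cls_rel_one (Rel.tensor_assoc w (.id p) (.id 1))).trans
        (ofWord_tensor_congr rfl (cls_rel_one (Rel.tensor_id p 1)))
    rwa [h] at this

lemma id_mem_normalForms (n : ℕ) : 𝟙 (pt δ n) ∈ normalForms δ n n := by
  simpa using mem_normalForms (IsCaps.id (δ := δ) n) (IsCups.id n)

/-- Morphisms are linear combinations of morphisms in normal form. -/
theorem mem_normalForms_of_hom {m n : ℕ} (f : pt δ m ⟶ pt δ n) : f ∈ normalForms δ m n := by
  induction f using hom_induction with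
  | zero => exact zero_mem _
  | add f g hf hg => exact add_mem hf hg
  | smul c f hf => exact Submodule.smul_mem _ _ hf
  | ofWord w =>
    induction w with
    | id n => exact id_mem_normalForms n
    | comp f g hf hg => rw [← ofWord_comp]; exact comp_mem_normalForms hf hg
    | @tensor m n p r f g hf hg =>
      have h : ofWord δ (.tensor f g) =
          ofWord δ (.tensor (.id m) g) ≫ ofWord δ (.tensor f (.id r)) := by
        rw [ofWord_interchange]
        simp only [Word.parity, mul_zero, ssign_zero, one_smul]
        exact ofWord_tensor_congr (ofWord_id_comp f).symm (ofWord_comp_id g).symm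
      rw [h, ← leftStrands_ofWord]
      exact comp_mem_normalForms (leftStrands_mem_normalForms m hg) (ofWord_tensor_id_mem f hf r)
    | cup =>
      have h : ofWord δ .cup = lastCup δ 0 := (cls_rel_one (Rel.unit_tensor .cup)).symm
      rw [h]
      simpa using cup_comp_mem (.last 0) (id_mem_normalForms 2)
    | cap =>
      have h : ofWord δ .cap = lastCap δ 0 := (cls_rel_one (Rel.unit_tensor .cap)).symm
      rw [h]
      simpa using cap_comp_mem (.last 0) (id_mem_normalForms 0)

/-- A morphism annihilated by caps after it. -/
def KillsCaps {X : STL δ} {n : ℕ} (f : X ⟶ pt δ n) : Prop :=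
  ∀ {m : ℕ} (c : pt δ n ⟶ pt δ m), IsCap c → f ≫ c = 0

/-- A morphism annihilated by cups before it. -/
def KillsCups {X : STL δ} {n : ℕ} (f : pt δ n ⟶ X) : Prop :=
  ∀ {m : ℕ} (u : pt δ m ⟶ pt δ n), IsCup u → u ≫ f = 0

/-- In the normal form of `x`, only the multiples of the identity contribute. -/
lemma KillsCaps.comp_comp_eq_smul {X Y : STL δ} {n : ℕ} {f : X ⟶ pt δ n} {g : pt δ n ⟶ Y}
    (hf : KillsCaps f) (hg : KillsCups g) (x : pt δ n ⟶ pt δ n) :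
    ∃ a : k, f ≫ x ≫ g = a • f ≫ g := by
  induction mem_normalForms_of_hom x using normalForms_induction with
  | zero => exact ⟨0, by simp⟩
  | add x y _ _ hx hy =>
    obtain ⟨a, ha⟩ := hx
    obtain ⟨b, hb⟩ := hy
    exact ⟨a + b, by simp [Preadditive.add_comp, Preadditive.comp_add, ha, hb, add_smul]⟩
  | smul c x _ hx =>
    obtain ⟨a, ha⟩ := hx
    exact ⟨c * a, by simp [ha, mul_smul]⟩
  | comp c u hc hu =>
    cases hc with
    | id =>
      cases hu with
      | id => exact ⟨1, by simp⟩
      | snoc _ hv => exact ⟨0, by simp [hg _ hv]⟩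
    | cons hd _ => exact ⟨0, by simp [reassoc_of% (hf _ hd)]⟩

lemma KillsCaps.comp_comp_eq_zero {X Y : STL δ} {m n : ℕ} {f : X ⟶ pt δ m} {g : pt δ n ⟶ Y}
    (hf : KillsCaps f) (hg : KillsCups g) (hmn : m ≠ n) (x : pt δ m ⟶ pt δ n) :
    f ≫ x ≫ g = 0 := by
  induction mem_normalForms_of_hom x using normalForms_induction with
  | zero => simp
  | add x y _ _ hx hy => simp [Preadditive.add_comp, Preadditive.comp_add, hx, hy]
  | smul c x _ hx => simp [hx]
  | comp c u hc hu =>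
    cases hc with
    | id =>
      cases hu with
      | id => exact absurd rfl hmn
      | snoc _ hv => simp [hg _ hv]
    | cons hd _ => simp [reassoc_of% (hf _ hd)]

end STL

/-! ### Odd Jones-Wenzl projectors -/

namespace STL

open OddTL

variable {k : Type*} [Field k] {δ : k}

/-- The signed Chebyshev polynomials `0, 1, δ, δ² + 1, …` in `δ`; the partial traces of the odd
Jones-Wenzl projectors are quotients of consecutive values. -/
def chebyshev (δ : k) : ℕ → k
  | 0 => 0
  | 1 => 1
  | n + 2 => δ * chebyshev δ (n + 1) + chebyshev δ n

/-- For `δ = -(q - q⁻¹)` the recursion has characteristic roots `q⁻¹` and `-q`. -/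
lemma add_inv_mul_chebyshev {q : k} (hq : q ≠ 0) (n : ℕ) :
    (q + q⁻¹) * chebyshev (-(q - q⁻¹)) n = q⁻¹ ^ n - (-q) ^ n ∧
      (q + q⁻¹) * chebyshev (-(q - q⁻¹)) (n + 1) = q⁻¹ ^ (n + 1) - (-q) ^ (n + 1) := by
  induction n with
  | zero => simp [chebyshev, add_comm]
  | succ n ih =>
    refine ⟨ih.2, ?_⟩
    have h : q * q⁻¹ = 1 := mul_inv_cancel₀ hq
    rw [chebyshev, mul_add, mul_left_comm, ih.1, ih.2]
    linear_combination (-q⁻¹ ^ n + (-q) ^ n) * h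

lemma chebyshev_ne_zero {q : k} (hq₀ : q ≠ 0) (hq : ∀ n : ℕ, 0 < n → q ^ n ≠ 1) (n : ℕ) :
    chebyshev (-(q - q⁻¹)) (n + 1) ≠ 0 := by
  intro h
  have h' := (add_inv_mul_chebyshev hq₀ n).2
  rw [h, mul_zero, eq_comm, sub_eq_zero, inv_pow] at h'
  have h' : q ^ (n + 1) * (-q) ^ (n + 1) = 1 := by
    rw [← h', mul_inv_cancel₀ (pow_ne_zero _ hq₀)]
  -- The equality `q⁻¹ ^ (n + 1) = (-q) ^ (n + 1)` determines `q ^ (2 * (n + 1))` up to a sign.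
  refine hq (4 * (n + 1)) (by omega) ?_
  have : (q ^ (n + 1) * (-q) ^ (n + 1)) ^ 2 = 1 := by rw [h', one_pow]
  rw [← this, mul_pow, ← pow_mul, ← pow_mul, mul_comm (n + 1) 2, pow_mul (-q), neg_sq, ← pow_mul,
    ← pow_add]
  congr 1
  ring

/-- The odd Jones-Wenzl projectors, defined by the analogue of Wenzl's recursion. -/
def jw (δ : k) : ∀ n : ℕ, pt δ n ⟶ pt δ n
  | 0 => 𝟙 _
  | 1 => 𝟙 _
  | n + 2 => addStrand (jw δ (n + 1)) - (chebyshev δ (n + 1) / chebyshev δ (n + 2)) •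
      (addStrand (jw δ (n + 1)) ≫ lastCap δ n ≫ lastCup δ n ≫ addStrand (jw δ (n + 1)))

/-- The properties of the Jones-Wenzl projectors that are established by simultaneous induction;
the last one computes the partial trace. -/
structure JWSpec (δ : k) (n : ℕ) : Prop where
  idem : jw δ n ≫ jw δ n = jw δ n
  killsCaps : KillsCaps (jw δ n)
  killsCups : KillsCups (jw δ n)
  idem_succ : jw δ (n + 1) ≫ jw δ (n + 1) = jw δ (n + 1)
  killsCaps_succ : KillsCaps (jw δ (n + 1))
  killsCups_succ : KillsCups (jw δ (n + 1))
  addStrand_comp : addStrand (jw δ n) ≫ jw δ (n + 1) = jw δ (n + 1)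
  comp_addStrand : jw δ (n + 1) ≫ addStrand (jw δ n) = jw δ (n + 1)
  trace : lastCup δ n ≫ addStrand (jw δ (n + 1)) ≫ lastCap δ n =
    (chebyshev δ (n + 2) / chebyshev δ (n + 1)) • jw δ n

lemma hom_self_mem (n : ℕ) (f : pt δ n ⟶ pt δ n) : f ∈ homPart k (pt δ n) (pt δ n) 0 := by
  change f ∈ partOf δ n n (Word.id n).parity
  rw [partOf_eq_top]
  trivial

lemma end_comp_lastCup {n : ℕ} (f : pt δ n ⟶ pt δ n) :
    f ≫ lastCup δ n = lastCup δ n ≫ addStrand (addStrand f) := by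
  rw [comp_lastCup (hom_self_mem n f), ssign_zero, one_smul]

lemma addStrand_addStrand_end_lastCap {n : ℕ} (f : pt δ n ⟶ pt δ n) :
    addStrand (addStrand f) ≫ lastCap δ n = lastCap δ n ≫ f := by
  rw [addStrand_addStrand_lastCap (hom_self_mem n f), ssign_zero, one_smul]

lemma killsCaps_of_lt_two {n : ℕ} (hn : n < 2) (f : pt δ n ⟶ pt δ n) : KillsCaps f :=
  fun c hc => by
    have := hc.eq_add_two
    omega

lemma killsCups_of_lt_two {n : ℕ} (hn : n < 2) (f : pt δ n ⟶ pt δ n) : KillsCups f :=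
  fun c hc => by
    have := hc.eq_add_two
    omega

lemma jwSpec (h : ∀ n, chebyshev δ (n + 1) ≠ 0) (n : ℕ) : JWSpec δ n := by
  induction n with
  | zero =>
    refine ⟨Category.comp_id _, killsCaps_of_lt_two (by omega) _,
      killsCups_of_lt_two (by omega) _, Category.comp_id _, killsCaps_of_lt_two (by omega) _,
      killsCups_of_lt_two (by omega) _, ?_, ?_, ?_⟩
    · rw [jw, addStrand_id]; exact Category.id_comp _
    · rw [jw, addStrand_id]; exact Category.comp_id _
    · rw [jw, jw, addStrand_id, Category.id_comp, lastCup_lastCap]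
      simp [chebyshev]
  | succ n ih =>
    set P := addStrand (jw δ (n + 1)) with hP
    set C := lastCap δ n with hC
    set U := lastCup δ n with hU
    set s := chebyshev δ (n + 1) / chebyshev δ (n + 2) with hs
    set t := chebyshev δ (n + 2) / chebyshev δ (n + 1) with ht
    have hst : s * t = 1 := by
      rw [hs, ht, div_mul_div_cancel₀ (h (n + 1)), div_self (h n)]
    have hq : jw δ (n + 1 + 1) = P - s • (P ≫ C ≫ U ≫ P) := rfl
    set Q := jw δ (n + 1 + 1) with hQ
    have hPP : P ≫ P = P := by rw [hP, ← addStrand_comp, ih.idem_succ]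
    have hUPC : U ≫ P ≫ C = t • jw δ n := ih.trace
    have hUP : jw δ n ≫ U ≫ P = U ≫ P := by
      rw [← Category.assoc, end_comp_lastCup, Category.assoc, hP, ← addStrand_comp,
        ih.addStrand_comp]
    have hPC : P ≫ C ≫ jw δ n = P ≫ C := by
      rw [← addStrand_addStrand_end_lastCap, ← Category.assoc, hP, ← addStrand_comp,
        ih.comp_addStrand]
    have hPQ : P ≫ Q = Q := by
      simp only [hq, Preadditive.comp_sub, Linear.comp_smul, hPP, reassoc_of% hPP]
    have hQP : Q ≫ P = Q := by
      simp only [hq, Preadditive.sub_comp, Linear.smul_comp, Category.assoc, hPP]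
    -- The coefficient `s` is the inverse of the partial trace, whence the two terms cancel.
    have hUQ : U ≫ Q = 0 := by
      simp only [hq, Preadditive.comp_sub, Linear.comp_smul]
      rw [reassoc_of% hUPC, Linear.smul_comp, hUP, smul_smul, hst, one_smul, sub_self]
    have hQC : Q ≫ C = 0 := by
      simp only [hq, Preadditive.sub_comp, Linear.smul_comp, Category.assoc]
      rw [hUPC, Linear.comp_smul, Linear.comp_smul, hPC, smul_smul, hst, one_smul, sub_self]
    have hQQ : Q ≫ Q = Q := by
      conv_lhs => enter [1]; rw [hq]
      simp only [Preadditive.sub_comp, Linear.smul_comp, Category.assoc, hPQ, hUQ, comp_zero,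
        smul_zero, sub_zero]
    refine ⟨ih.idem_succ, ih.killsCaps_succ, ih.killsCups_succ, hQQ, ?_, ?_, hPQ, hQP, ?_⟩
    · intro m c hc
      cases hc with
      | last => exact hQC
      | addStrand hc =>
        rw [← hQ, ← hQP, Category.assoc, hP, ← addStrand_comp, ih.killsCaps_succ _ hc, map_zero,
          comp_zero]
    · intro m u hu
      cases hu with
      | last => exact hUQ
      | addStrand hu =>
        rw [← hQ, ← hPQ, ← Category.assoc, hP, ← addStrand_comp, ih.killsCups_succ _ hu, map_zero,
          zero_comp]
    · have h₁ : lastCup δ (n + 1) ≫ addStrand P = jw δ (n + 1) ≫ lastCup δ (n + 1) :=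
        (end_comp_lastCup _).symm
      have h₂ : addStrand P ≫ lastCap δ (n + 1) = lastCap δ (n + 1) ≫ jw δ (n + 1) :=
        addStrand_addStrand_end_lastCap _
      have hr : chebyshev δ (n + 1 + 2) / chebyshev δ (n + 1 + 1) = δ + s := by
        have := h (n + 1)
        rw [chebyshev, hs]
        field_simp
      -- The circle contributes `δ` to the partial trace, and the composition of the two
      -- zigzags contributes `s`, with a sign that is due to the second zigzag relation.
      have h₃ : lastCup δ (n + 1) ≫ lastCap δ (n + 1) ≫ jw δ (n + 1) = δ • jw δ (n + 1) := by
        rw [← Category.assoc, lastCup_lastCap, Linear.smul_comp, Category.id_comp]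
      have h₄ : lastCup δ (n + 1) ≫ addStrand C ≫ addStrand U ≫ lastCap δ (n + 1) =
          -𝟙 _ := by
        rw [addStrand_lastCup_lastCap, ← Category.assoc, lastCup_addStrand_lastCap,
          Category.id_comp]
      have h₅ : lastCup δ (n + 1) ≫ addStrand P ≫ addStrand C ≫ addStrand U ≫ addStrand P ≫
          lastCap δ (n + 1) = -jw δ (n + 1) := by
        rw [h₂, reassoc_of% h₁]
        have := congrArg (fun x => jw δ (n + 1) ≫ x ≫ jw δ (n + 1)) h₄
        simpa [ih.idem_succ] using this
      rw [hr, ← hQ, hq]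
      simp only [map_sub, map_smul, addStrand_comp, Preadditive.sub_comp, Preadditive.comp_sub,
        Linear.smul_comp, Linear.comp_smul, Category.assoc]
      rw [h₅, h₂, h₃, smul_neg, sub_neg_eq_add, add_smul]

lemma addStrand_jw_succ (n : ℕ) : addStrand (jw δ (n + 1)) = jw δ (n + 2) +
    (chebyshev δ (n + 1) / chebyshev δ (n + 2)) •
      (addStrand (jw δ (n + 1)) ≫ lastCap δ n ≫ lastCup δ n ≫ addStrand (jw δ (n + 1))) := by
  rw [jw, sub_add_cancel]

lemma JWSpec.jw_lastCup {n : ℕ} (hn : JWSpec δ n) :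
    jw δ n ≫ lastCup δ n ≫ addStrand (jw δ (n + 1)) =
      lastCup δ n ≫ addStrand (jw δ (n + 1)) := by
  rw [← Category.assoc, end_comp_lastCup, Category.assoc, ← STL.addStrand_comp, hn.addStrand_comp]

lemma JWSpec.lastCap_jw {n : ℕ} (hn : JWSpec δ n) :
    addStrand (jw δ (n + 1)) ≫ lastCap δ n ≫ jw δ n =
      addStrand (jw δ (n + 1)) ≫ lastCap δ n := by
  rw [← addStrand_addStrand_end_lastCap, ← Category.assoc, ← STL.addStrand_comp,
    hn.comp_addStrand]

/-- The partial traces are nonzero multiples of each other, hence the projectors are nonzero. -/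
lemma jw_ne_zero (h : ∀ n, chebyshev δ (n + 1) ≠ 0) (h₀ : 𝟙 (pt δ 0) ≠ 0) (n : ℕ) :
    jw δ n ≠ 0 := by
  induction n with
  | zero => exact h₀
  | succ n ih =>
    intro hn
    have := (jwSpec h n).trace
    rw [hn, map_zero, zero_comp, comp_zero, eq_comm, smul_eq_zero] at this
    exact this.elim (div_ne_zero (h (n + 1)) (h n)) ih

/-- Identity morphisms factor through Jones-Wenzl projectors, up to sums. -/
lemma id_mem_span_jw (h : ∀ n, chebyshev δ (n + 1) ≠ 0) (n : ℕ) :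
    𝟙 (pt δ n) ∈ Submodule.span k {x | ∃ (m : ℕ) (f : pt δ n ⟶ pt δ m) (g : pt δ m ⟶ pt δ n),
      x = f ≫ jw δ m ≫ g} := by
  induction n with
  | zero => exact Submodule.subset_span ⟨0, 𝟙 _, 𝟙 _, by simp [jw]⟩
  | succ n ih =>
    rw [← addStrand_id]
    have key := Submodule.mem_map_of_mem (f := addStrand) ih
    rw [Submodule.map_span] at key
    refine Submodule.span_le.2 ?_ key
    rintro _ ⟨_, ⟨m, f, g, rfl⟩, rfl⟩
    rw [SetLike.mem_coe, addStrand_comp, addStrand_comp]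
    rcases m with _ | m
    · exact Submodule.subset_span ⟨1, addStrand f, addStrand g, by simp [jw, addStrand_id]⟩
    · rw [addStrand_jw_succ, Preadditive.add_comp, Preadditive.comp_add, Linear.smul_comp,
        Linear.comp_smul]
      refine add_mem (Submodule.subset_span ⟨m + 2, _, _, rfl⟩)
        (Submodule.smul_mem _ _ (Submodule.subset_span ⟨m,
          addStrand f ≫ addStrand (jw δ (m + 1)) ≫ lastCap δ m,
          lastCup δ m ≫ addStrand (jw δ (m + 1)) ≫ addStrand g, ?_⟩))
      have := (jwSpec h m).jw_lastCup
      simp only [Category.assoc]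
      rw [reassoc_of% this]

end STL

/-! ### Direct summands in the idempotent completion of an additive envelope -/

section MatSummand

open Idempotents MonoidalCategory

variable {A : Type*} [Category* A] [Preadditive A]

/-- The image of an idempotent `e` of `A`, as an object of the idempotent completion of the additive
envelope. -/
def matSummand (X : A) (e : X ⟶ X) (he : e ≫ e = e) : Karoubi (Mat_ A) :=
  ⟨(Mat_.embedding A).obj X, (Mat_.embedding A).map e, by rw [← Functor.map_comp, he]⟩

namespace matSummand

variable {X Y : A} {e : X ⟶ X} {he : e ≫ e = e} {e' : Y ⟶ Y} {he' : e' ≫ e' = e'}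

/-- The morphism between images of idempotents given by a compatible morphism of `A`. -/
def hom (f : X ⟶ Y) (h : e ≫ f ≫ e' = f) : matSummand X e he ⟶ matSummand Y e' he' :=
  ⟨(Mat_.embedding A).map f, by
    change (Mat_.embedding A).map e ≫ (Mat_.embedding A).map f ≫ (Mat_.embedding A).map e' = _
    rw [← Functor.map_comp, ← Functor.map_comp, h]⟩

lemma exists_eq_hom (g : matSummand X e he ⟶ matSummand Y e' he') :
    ∃ (f : X ⟶ Y) (h : e ≫ f ≫ e' = f), g = hom f h := by
  obtain ⟨f, hf⟩ := (Mat_.embedding A).map_surjective g.f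
  refine ⟨f, (Mat_.embedding A).map_injective ?_, Karoubi.hom_ext _ _ hf.symm⟩
  rw [Functor.map_comp, Functor.map_comp, hf]
  exact g.comm

lemma hom_comp_hom {Z : A} {e'' : Z ⟶ Z} {he'' : e'' ≫ e'' = e''} (f : X ⟶ Y)
    (h : e ≫ f ≫ e' = f) (g : Y ⟶ Z) (h' : e' ≫ g ≫ e'' = g) (h'' : e ≫ (f ≫ g) ≫ e'' = f ≫ g) :
    (hom f h : matSummand X e he ⟶ matSummand Y e' he') ≫
      (hom g h' : _ ⟶ matSummand Z e'' he'') = hom (f ≫ g) h'' :=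
  Karoubi.hom_ext _ _ ((Mat_.embedding A).map_comp f g).symm

lemma _root_.CategoryTheory.Mat_.comp_apply_of_forall_eq {M N K : Mat_ A} (f : M ⟶ N) (g : N ⟶ K)
    (j : N.ι) (hj : ∀ j', j' = j) (i : M.ι) (l : K.ι) : (f ≫ g) i l = f i j ≫ g j l := by
  rw [Mat_.comp_apply, Fintype.sum_eq_single j fun j' h => absurd (hj j') h]

/-- The tensor product of the images of two idempotents is the image of their tensor product. -/
def tensorIso [MonoidalCategory A] [MonoidalPreadditive A]
    (h : (e ⊗ₘ e') ≫ (e ⊗ₘ e') = e ⊗ₘ e') :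
    matSummand X e he ⊗ matSummand Y e' he' ≅ matSummand (X ⊗ Y) (e ⊗ₘ e') h where
  hom := ⟨fun _ _ => e ⊗ₘ e', by
    funext i j
    refine (Mat_.comp_apply_of_forall_eq _ _ (PUnit.unit, PUnit.unit) (fun _ => rfl) _ _).trans ?_
    refine (congrArg (fun x => (e ⊗ₘ e') ≫ x) (Mat_.comp_apply_of_forall_eq
      (M := (matSummand X e he ⊗ matSummand Y e' he').X)
      (N := (matSummand (X ⊗ Y) (e ⊗ₘ e') h).X) _ _ PUnit.unit (fun _ => rfl) _ _)).trans ?_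
    exact (congrArg (fun x => (e ⊗ₘ e') ≫ x) h).trans h⟩
  inv := ⟨fun _ _ => e ⊗ₘ e', by
    funext i j
    refine (Mat_.comp_apply_of_forall_eq _ _ PUnit.unit (fun _ => rfl) _ _).trans ?_
    refine (congrArg (fun x => (e ⊗ₘ e') ≫ x) (Mat_.comp_apply_of_forall_eq
      (M := (matSummand (X ⊗ Y) (e ⊗ₘ e') h).X)
      (N := (matSummand X e he ⊗ matSummand Y e' he').X) _ _ (PUnit.unit, PUnit.unit)
      (fun _ => rfl) _ _)).trans ?_
    exact (congrArg (fun x => (e ⊗ₘ e') ≫ x) h).trans h⟩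
  hom_inv_id := by
    refine Karoubi.hom_ext _ _ ?_
    funext i j
    exact (Mat_.comp_apply_of_forall_eq _ _ PUnit.unit (fun _ => rfl) _ _).trans h
  inv_hom_id := by
    refine Karoubi.hom_ext _ _ ?_
    funext i j
    exact (Mat_.comp_apply_of_forall_eq _ _ (PUnit.unit, PUnit.unit) (fun _ => rfl) _ _).trans h

lemma matSummand_id (X : A) (h : 𝟙 X ≫ 𝟙 X = 𝟙 X) :
    matSummand X (𝟙 X) h = (toKaroubi _).obj ((Mat_.embedding A).obj X) := by
  refine Karoubi.ext rfl ?_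
  change (Mat_.embedding A).map (𝟙 X) ≫ 𝟙 _ = 𝟙 _ ≫ 𝟙 _
  rw [CategoryTheory.Functor.map_id]

end matSummand

/-- The sums of endomorphisms that factor through members of a family of objects. -/
def factorSums {C : Type*} [Category* C] [Preadditive C] {I : Type*} (S : I → C) (X : C) :
    AddSubgroup (X ⟶ X) :=
  AddSubgroup.closure {x | ∃ (i : I) (a : X ⟶ S i) (b : S i ⟶ X), x = a ≫ b}

lemma comp_mem_factorSums {C : Type*} [Category* C] [Preadditive C] {I : Type*} {S : I → C}
    {X Y : C} {x : X ⟶ X} (hx : x ∈ factorSums S X) (f : Y ⟶ X) (g : X ⟶ Y) :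
    f ≫ x ≫ g ∈ factorSums S Y := by
  induction hx using AddSubgroup.closure_induction with
  | zero => simp [zero_mem]
  | add x y _ _ hx hy => simpa [Preadditive.add_comp, Preadditive.comp_add] using add_mem hx hy
  | neg x _ hx => simpa using neg_mem hx
  | mem x hx =>
    obtain ⟨i, a, b, rfl⟩ := hx
    exact AddSubgroup.subset_closure ⟨i, f ≫ a, b ≫ g, by simp⟩

lemma exists_sum_of_mem_factorSums {C : Type*} [Category* C] [Preadditive C] {I : Type*}
    {S : I → C} {X : C} {x : X ⟶ X} (hx : x ∈ factorSums S X) :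
    ∃ (n : ℕ) (s : Fin n → I) (a : ∀ t, X ⟶ S (s t)) (b : ∀ t, S (s t) ⟶ X),
      ∑ t, a t ≫ b t = x := by
  suffices h : ∃ (J : Type) (_ : Fintype J) (s : J → I) (a : ∀ t, X ⟶ S (s t))
      (b : ∀ t, S (s t) ⟶ X), ∑ t, a t ≫ b t = x by
    obtain ⟨J, _, s, a, b, h⟩ := h
    refine ⟨Fintype.card J, s ∘ (Fintype.equivFin J).symm, fun t => a _, fun t => b _, ?_⟩
    rw [← h]
    exact (Fintype.equivFin J).symm.sum_comp fun t => a t ≫ b t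
  induction hx using AddSubgroup.closure_induction with
  | zero => exact ⟨Empty, inferInstance, fun t => t.elim, fun t => t.elim, fun t => t.elim, rfl⟩
  | add x y _ _ hx hy =>
    obtain ⟨J, _, s, a, b, rfl⟩ := hx
    obtain ⟨J', _, s', a', b', rfl⟩ := hy
    exact ⟨J ⊕ J', inferInstance, Sum.elim s s', Sum.rec a a', Sum.rec b b',
      Fintype.sum_sum_type _⟩
  | neg x _ hx =>
    obtain ⟨J, _, s, a, b, rfl⟩ := hx
    exact ⟨J, inferInstance, s, fun t => -a t, b, by simp⟩
  | mem x hx =>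
    obtain ⟨i, a, b, rfl⟩ := hx
    exact ⟨Unit, inferInstance, fun _ => i, fun _ => a, fun _ => b, by simp⟩

/-- It suffices to decompose the identities of the objects of `A`. -/
lemma id_mem_factorSums_of_matSummand {I : Type*} {S : I → Karoubi (Mat_ A)}
    (h : ∀ X : A, 𝟙 (matSummand X (𝟙 X) (Category.comp_id _)) ∈ factorSums S _)
    (Z : Karoubi (Mat_ A)) : 𝟙 Z ∈ factorSums S Z := by
  have hM : ∀ M : Mat_ A, 𝟙 ((toKaroubi _).obj M) ∈ factorSums S _ := fun M => by
    let E := Mat_.isoBiproductEmbedding M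
    have hsum : 𝟙 ((toKaroubi _).obj M) = ∑ i, (toKaroubi _).map (E.hom ≫ biproduct.π _ i) ≫
        𝟙 _ ≫ (toKaroubi _).map (biproduct.ι (fun i => (Mat_.embedding A).obj (M.X i)) i ≫ E.inv) := by
      simp only [Category.id_comp, ← Functor.map_comp, ← Functor.map_sum, Category.assoc]
      have : ∑ i, E.hom ≫ biproduct.π (fun i => (Mat_.embedding A).obj (M.X i)) i ≫
          biproduct.ι (fun i => (Mat_.embedding A).obj (M.X i)) i ≫ E.inv = 𝟙 M := by
        rw [← Preadditive.comp_sum]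
        simp only [← Category.assoc, ← Preadditive.sum_comp]
        rw [biproduct.total, Category.comp_id, E.hom_inv_id]
      rw [this, CategoryTheory.Functor.map_id]
    rw [hsum]
    refine sum_mem fun i _ => comp_mem_factorSums ?_ _ _
    have := h (M.X i)
    rwa [matSummand.matSummand_id] at this
  have := comp_mem_factorSums (hM Z.X) Z.decompId_i Z.decompId_p
  rwa [Category.id_comp, ← Karoubi.decompId] at this

/-- The class of an object with a decomposition of its identity into two summands. -/
lemma K0.mk_eq_add {C : Type*} [Category* C] [Preadditive C] [HasBinaryBiproducts C] {X Y Z : C}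
    (a : Z ⟶ X) (b : X ⟶ Z) (c : Z ⟶ Y) (d : Y ⟶ Z) (h : a ≫ b + c ≫ d = 𝟙 Z)
    (hba : b ≫ a = 𝟙 X) (hdc : d ≫ c = 𝟙 Y) : K0.mk Z = K0.mk X + K0.mk Y := by
  have h₁ : b ≫ c = 0 := by
    have := congrArg (fun x => b ≫ x ≫ c) h
    simpa [Preadditive.add_comp, Preadditive.comp_add, hdc, reassoc_of% hba] using this
  have h₂ : d ≫ a = 0 := by
    have := congrArg (fun x => d ≫ x ≫ a) h
    simpa [Preadditive.add_comp, Preadditive.comp_add, hba, reassoc_of% hdc] using this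
  rw [← K0.mk_biprod]
  exact K0.mk_iso ⟨biprod.lift a c, biprod.desc b d, by rw [biprod.lift_desc, h], by
    ext <;> simp [hba, hdc, h₁, h₂]⟩

end MatSummand

/-! ### The simple objects of the super Karoubi envelope -/

namespace STL

open OddTL Idempotents MonoidalCategory

variable {k : Type*} [Field k] {δ : k}

/-- The object `Π^a ·^{⊗n}` of the underlying category of the `Π`-envelope. -/
abbrev piPt (δ : k) (a : ZMod 2) (n : ℕ) : Underlying k (PiEnvelope (STL δ)) := ⟨⟨a, pt δ n⟩⟩

/-- A morphism of parity `a + b`, as an even morphism `Π^a ·^{⊗m} ⟶ Π^b ·^{⊗n}`. -/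
def piHom {m n : ℕ} (a b : ZMod 2) (f : pt δ m ⟶ pt δ n)
    (hf : f ∈ homPart k (pt δ m) (pt δ n) (a + b)) : piPt δ a m ⟶ piPt δ b n :=
  ⟨f, by
    change f ∈ homPart k (pt δ m) (pt δ n) (a + b + 0)
    rwa [add_zero]⟩

lemma exists_eq_piHom {m n : ℕ} {a b : ZMod 2} (g : piPt δ a m ⟶ piPt δ b n) :
    ∃ (f : pt δ m ⟶ pt δ n) (hf : f ∈ homPart k (pt δ m) (pt δ n) (a + b)), g = piHom a b f hf :=
  ⟨g.1, by
    have h : g.1 ∈ homPart k (pt δ m) (pt δ n) (a + b + 0) := g.2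
    rwa [add_zero] at h, rfl⟩

lemma end_mem {n : ℕ} (a : ZMod 2) (f : pt δ n ⟶ pt δ n) :
    f ∈ homPart k (pt δ n) (pt δ n) (a + a) := by
  rw [CharTwo.add_self_eq_zero]
  exact hom_self_mem n f

/-- The image of an idempotent of `·^{⊗n}`, placed in parity `a`. -/
def summand (a : ZMod 2) {n : ℕ} (e : pt δ n ⟶ pt δ n) (he : e ≫ e = e) : SKar k (STL δ) :=
  matSummand (piPt δ a n) (piHom a a e (end_mem a e)) (Underlying.hom_ext he)

/-- The morphism between images of idempotents given by a compatible morphism of `STL δ`. -/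
def summandHom {a b : ZMod 2} {m n : ℕ} {e : pt δ m ⟶ pt δ m} {he : e ≫ e = e}
    {e' : pt δ n ⟶ pt δ n} {he' : e' ≫ e' = e'} (f : pt δ m ⟶ pt δ n)
    (hf : f ∈ homPart k (pt δ m) (pt δ n) (a + b)) (h : e ≫ f ≫ e' = f) :
    summand a e he ⟶ summand b e' he' :=
  matSummand.hom (piHom a b f hf) (Underlying.hom_ext h)

section summand

variable {a b c : ZMod 2} {m n p : ℕ} {e : pt δ m ⟶ pt δ m} {he : e ≫ e = e}
    {e' : pt δ n ⟶ pt δ n} {he' : e' ≫ e' = e'} {e'' : pt δ p ⟶ pt δ p} {he'' : e'' ≫ e'' = e''}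

lemma exists_eq_summandHom (g : summand a e he ⟶ summand b e' he') :
    ∃ (f : pt δ m ⟶ pt δ n) (hf : f ∈ homPart k (pt δ m) (pt δ n) (a + b)) (h : e ≫ f ≫ e' = f),
      g = summandHom f hf h := by
  obtain ⟨g, hg, rfl⟩ := matSummand.exists_eq_hom g
  obtain ⟨f, hf, rfl⟩ := exists_eq_piHom g
  exact ⟨f, hf, congrArg Subtype.val hg, rfl⟩

lemma summandHom_comp (f : pt δ m ⟶ pt δ n) (hf : f ∈ homPart k (pt δ m) (pt δ n) (a + b))
    (h : e ≫ f ≫ e' = f) (g : pt δ n ⟶ pt δ p) (hg : g ∈ homPart k (pt δ n) (pt δ p) (b + c))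
    (h' : e' ≫ g ≫ e'' = g) (x : pt δ m ⟶ pt δ p) (hx : x ∈ homPart k (pt δ m) (pt δ p) (a + c))
    (h'' : e ≫ x ≫ e'' = x) (hfg : f ≫ g = x) :
    (summandHom f hf h : summand a e he ⟶ summand b e' he') ≫
      (summandHom g hg h' : _ ⟶ summand c e'' he'') = summandHom x hx h'' := by
  subst hfg
  exact matSummand.hom_comp_hom _ _ _ _ _

lemma summandHom_add (f : pt δ m ⟶ pt δ n) (hf : f ∈ homPart k (pt δ m) (pt δ n) (a + b))
    (h : e ≫ f ≫ e' = f) (g : pt δ m ⟶ pt δ n) (hg : g ∈ homPart k (pt δ m) (pt δ n) (a + b))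
    (h' : e ≫ g ≫ e' = g) (x : pt δ m ⟶ pt δ n) (hx : x ∈ homPart k (pt δ m) (pt δ n) (a + b))
    (h'' : e ≫ x ≫ e' = x) (hfg : f + g = x) :
    (summandHom f hf h : summand a e he ⟶ summand b e' he') + summandHom g hg h' =
      summandHom x hx h'' := by
  subst hfg
  exact Karoubi.hom_ext _ _ ((Mat_.embedding _).map_add (f := piHom a b f hf)
    (g := piHom a b g hg)).symm

lemma summandHom_id (h : e ≫ e ≫ e = e) :
    (summandHom e (end_mem a e) h : summand a e he ⟶ summand a e he) = 𝟙 _ := rfl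

lemma summandHom_eq_zero_iff (f : pt δ m ⟶ pt δ n)
    (hf : f ∈ homPart k (pt δ m) (pt δ n) (a + b)) (h : e ≫ f ≫ e' = f) :
    (summandHom f hf h : summand a e he ⟶ summand b e' he') = 0 ↔ f = 0 := by
  constructor
  · intro h0
    have h1 : (Mat_.embedding _).map (piHom a b f hf) = 0 := congrArg Karoubi.Hom.f h0
    have h2 := (Mat_.embedding _).map_injective (h1.trans ((Mat_.embedding _).map_zero _ _).symm)
    exact congrArg Subtype.val h2
  · rintro rfl
    exact Karoubi.hom_ext _ _ ((Mat_.embedding _).map_zero _ _)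

end summand

lemma eq_zero_of_mem_of_mem {m n : ℕ} {f : pt δ m ⟶ pt δ n} {a b : ZMod 2} (hab : a ≠ b)
    (ha : f ∈ homPart k (pt δ m) (pt δ n) a) (hb : f ∈ homPart k (pt δ m) (pt δ n) b) : f = 0 := by
  have h₁ := parityProj_of_mem k ha a
  have h₂ := parityProj_of_mem k hb a
  rw [if_pos rfl] at h₁
  rw [if_neg hab] at h₂
  exact h₁.symm.trans h₂

variable (hT : ∀ n, chebyshev δ (n + 1) ≠ 0)

/-- The object `Π^a` of the image of the `n`-th Jones-Wenzl projector. -/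
def jwObj (i : ℕ × Fin 2) : SKar k (STL δ) :=
  summand (i.2 : ZMod 2) (jw δ i.1) (jwSpec hT i.1).idem

/-- All morphisms between two given objects, in either direction, have the same parity. -/
lemma exists_common_parity {m n : ℕ} (f : pt δ m ⟶ pt δ n) (g : pt δ n ⟶ pt δ m) :
    f = 0 ∨ g = 0 ∨ ∃ p, f ∈ homPart k (pt δ m) (pt δ n) p ∧ g ∈ homPart k (pt δ n) (pt δ m) p := by
  by_cases hf : Nonempty (Word m n)
  · by_cases hg : Nonempty (Word n m)
    · obtain ⟨w⟩ := hf
      obtain ⟨v⟩ := hg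
      refine Or.inr (Or.inr ⟨w.parity, ?_, ?_⟩)
      · change f ∈ partOf δ m n w.parity
        rw [partOf_eq_top w]
        trivial
      · have : w.parity = v.parity := by
          have : (Word.comp w v).parity = (Word.id m).parity := Word.parity_eq _ _
          exact CharTwo.add_eq_zero.1 this
        change g ∈ partOf δ n m w.parity
        rw [this, partOf_eq_top v]
        trivial
    · right; left
      induction g using hom_induction with
      | zero => rfl
      | add f g hf hg => rw [hf, hg, add_zero]
      | smul c f hf => rw [hf, smul_zero]
      | ofWord w => exact absurd ⟨w⟩ hg
  · left
    induction f using hom_induction with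
    | zero => rfl
    | add f g hf hg => rw [hf, hg, add_zero]
    | smul c f hf => rw [hf, smul_zero]
    | ofWord w => exact absurd ⟨w⟩ hf

lemma id_mem_factorSums_jwObj (X : Underlying k (PiEnvelope (STL δ))) :
    𝟙 (matSummand X (𝟙 X) (Category.comp_id _)) ∈ factorSums (jwObj hT) _ := by
  obtain ⟨⟨a, ⟨n⟩⟩⟩ := X
  have key : ∀ f ∈ Submodule.span k {x | ∃ (m : ℕ) (f : pt δ n ⟶ pt δ m) (g : pt δ m ⟶ pt δ n),
      x = f ≫ jw δ m ≫ g}, (summandHom f (end_mem a f) (by simp) :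
        summand a (𝟙 _) (Category.comp_id _) ⟶ _) ∈ factorSums (jwObj hT) _ := by
    intro f hf
    induction hf using Submodule.closure_induction with
    | zero =>
      rw [(summandHom_eq_zero_iff _ _ _).2 rfl]
      exact zero_mem _
    | add f g _ _ hf hg =>
      have := add_mem hf hg
      rwa [summandHom_add _ _ _ _ _ _ (f + g) (end_mem _ _) (by simp) rfl] at this
    | smul_mem r x hx =>
      obtain ⟨m, f, g, rfl⟩ := hx
      rcases exists_common_parity f g with rfl | rfl | ⟨p, hf, hg⟩
      · rw [(summandHom_eq_zero_iff _ _ _).2 (by simp)]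
        exact zero_mem _
      · rw [(summandHom_eq_zero_iff _ _ _).2 (by simp)]
        exact zero_mem _
      · have hJ := (jwSpec hT m).idem
        have hab : a + (a + p) = p := CharTwo.add_cancel_left a p
        have hab' : a + p + a = p := by rw [add_comm, hab]
        have hf' : r • f ≫ jw δ m ∈ homPart k (pt δ n) (pt δ m) (a + (a + p)) := by
          rw [hab]
          have := Supercategory.comp_mem hf (hom_self_mem m (jw δ m))
          rw [add_zero] at this
          exact Submodule.smul_mem _ r this
        have hg' : jw δ m ≫ g ∈ homPart k (pt δ m) (pt δ n) (a + p + a) := by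
          rw [hab']
          have := Supercategory.comp_mem (hom_self_mem m (jw δ m)) hg
          rwa [zero_add] at this
        refine AddSubgroup.subset_closure ⟨(m, (a + p : ZMod 2)), summandHom _ hf' ?_,
          summandHom _ hg' ?_, ?_⟩
        · simp [hJ]
        · simp [reassoc_of% hJ]
        · symm
          refine summandHom_comp _ _ _ _ _ _ _ _ _ ?_
          simp [reassoc_of% hJ]
  exact key (𝟙 _) (id_mem_span_jw hT n)

include hT in
lemma isIso_summand_jw {n : ℕ} {a : ZMod 2} {hJ : jw δ n ≫ jw δ n = jw δ n}
    (g : summand a (jw δ n) hJ ⟶ summand a (jw δ n) hJ) (hg : g ≠ 0) : IsIso g := by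
  obtain ⟨f, hf, h, rfl⟩ := exists_eq_summandHom g
  have hn := jwSpec hT n
  obtain ⟨r, hr⟩ := KillsCaps.comp_comp_eq_smul hn.killsCaps hn.killsCups f
  rw [h, hJ] at hr
  have hr0 : r ≠ 0 := by
    rintro rfl
    exact hg ((summandHom_eq_zero_iff _ _ _).2 (by rw [hr, zero_smul]))
  have hid : jw δ n ≫ jw δ n ≫ jw δ n = jw δ n := by rw [hJ, hJ]
  refine ⟨summandHom (r⁻¹ • jw δ n) (end_mem _ _) (by simp [hid]), ?_, ?_⟩
  · rw [← summandHom_id hid]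
    refine summandHom_comp _ _ _ _ _ _ _ _ _ ?_
    simp [hr, hJ, smul_smul, hr0]
  · rw [← summandHom_id hid]
    refine summandHom_comp _ _ _ _ _ _ _ _ _ ?_
    simp [hr, hJ, smul_smul, hr0]

theorem isSchurianFamily_jwObj (h₀ : 𝟙 (pt δ 0) ≠ 0) : IsSchurianFamily (jwObj hT) where
  isIso_end {_} g hg := isIso_summand_jw hT g hg
  hom_eq_zero {i j} hij g := by
    obtain ⟨m, a⟩ := i
    obtain ⟨n, b⟩ := j
    obtain ⟨f, hf, h, rfl⟩ := exists_eq_summandHom g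
    refine (summandHom_eq_zero_iff _ _ _).2 ?_
    by_cases hmn : m = n
    · subst hmn
      refine eq_zero_of_mem_of_mem (fun hab => hij ?_) hf (hom_self_mem m f)
      exact congrArg (Prod.mk m) ((CharTwo.add_eq_zero (R := ZMod 2)).1 hab)
    · rw [← h]
      exact KillsCaps.comp_comp_eq_zero (jwSpec hT m).killsCaps (jwSpec hT n).killsCups hmn f
  id_ne_zero i h := by
    have hJ := (jwSpec hT i.1).idem
    exact jw_ne_zero hT h₀ i.1
      ((summandHom_eq_zero_iff (a := i.2) (b := i.2) (he := hJ) (he' := hJ) (jw δ i.1)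
        (end_mem i.2 _) (by rw [hJ, hJ])).1 h)
  exists_sum X := exists_sum_of_mem_factorSums
    (id_mem_factorSums_of_matSummand (id_mem_factorSums_jwObj hT) X)

end STL

/-! ### Products in the Grothendieck ring -/

namespace STL

open OddTL Idempotents MonoidalCategory

variable {k : Type*} [Field k] {δ : k}

/-- The class of the product with a tensor power of the generating object; the parities of the
factors introduce no sign, since idempotents are even. -/
lemma mk_summand_mul_mk_summand_id {a b : ZMod 2} {n l : ℕ} {e : pt δ n ⟶ pt δ n}
    {he : e ≫ e = e} {hl : 𝟙 (pt δ l) ≫ 𝟙 (pt δ l) = 𝟙 (pt δ l)}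
    (x : pt δ (n + l) ⟶ pt δ (n + l)) (hx : x ≫ x = x)
    (h : tensorHom δ n n l l e (cls δ (.id l)) = x) :
    K0.mk (summand a e he) * K0.mk (summand b (𝟙 (pt δ l)) hl) = K0.mk (summand (a + b) x hx) := by
  have key : (piHom a a e (end_mem a e) ⊗ₘ piHom b b (𝟙 (pt δ l)) (end_mem b _)) =
      piHom (a + b) (a + b) x (end_mem _ x) := by
    refine Underlying.hom_ext ((PiEnvelope.tensor_even_id (k := k) a b (hom_self_mem n e)
      (pt δ l)).trans h)
  have hidem : piHom (a + b) (a + b) x (end_mem _ x) ≫ piHom (a + b) (a + b) x (end_mem _ x) =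
      piHom (a + b) (a + b) x (end_mem _ x) := Underlying.hom_ext hx
  have hidem' := hidem
  rw [← key] at hidem'
  rw [K0.mk_mul_mk]
  refine K0.mk_iso (matSummand.tensorIso hidem' ≪≫ eqToIso ?_)
  congr 1

lemma tensorHom_id_zero {n : ℕ} (e : pt δ n ⟶ pt δ n) :
    tensorHom δ n n 0 0 e (cls δ (.id 0)) = e := by
  induction e using hom_induction with
  | zero => exact LinearMap.map_zero₂ _ _
  | add f g hf hg => exact (LinearMap.map_add₂ _ _ _ _).trans (congrArg₂ (· + ·) hf hg)
  | smul c f hf => exact (LinearMap.map_smul₂ _ _ _ _).trans (congrArg (c • ·) hf)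
  | ofWord w => exact (tensorHom_cls _ _).trans (ofWord_tensor_id_zero w)

variable (hT : ∀ n, chebyshev δ (n + 1) ≠ 0)

/-- Tensoring with a power of `π` shifts the parity. -/
lemma mk_jwObj_mul_mk_jwObj_zero (n : ℕ) (a b : Fin 2) :
    K0.mk (jwObj hT (n, a)) * K0.mk (jwObj hT (0, b)) = K0.mk (jwObj hT (n, a + b)) :=
  mk_summand_mul_mk_summand_id (a := a) (b := b) _ _ (tensorHom_id_zero _)

lemma mk_jwObj_zero_mul_mk_jwObj_one (a : Fin 2) :
    K0.mk (jwObj hT (0, a)) * K0.mk (jwObj hT (1, 0)) = K0.mk (jwObj hT (1, a)) := by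
  have h := mk_summand_mul_mk_summand_id (a := a) (b := 0) (l := 1) (he := (jwSpec hT 0).idem)
    (hl := (jwSpec hT 1).idem) (jw δ 1) (jwSpec hT 1).idem (addStrand_id 0)
  exact h.trans (congrArg (fun b : Fin 2 => K0.mk (jwObj hT (1, b))) (add_zero a))

include hT in
/-- The image of `jw (n + 1) ⊗ 1` is the direct sum of the images of the neighbouring
projectors, one of them in the opposite parity since `lastCap` and `lastCup` are odd. -/
lemma mk_summand_addStrand_jw (n : ℕ) (a : ZMod 2)
    (hP : addStrand (jw δ (n + 1)) ≫ addStrand (jw δ (n + 1)) = addStrand (jw δ (n + 1))) :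
    K0.mk (summand a (addStrand (jw δ (n + 1))) hP) =
      K0.mk (summand a (jw δ (n + 2)) (jwSpec hT _).idem) +
        K0.mk (summand (a + 1) (jw δ n) (jwSpec hT n).idem) := by
  have hn := jwSpec hT n
  have hn₁ := jwSpec hT (n + 1)
  have hE := addStrand_jw_succ (δ := δ) n
  set P := addStrand (jw δ (n + 1)) with hPdef
  set s := chebyshev δ (n + 1) / chebyshev δ (n + 2) with hs
  have hst : s * (chebyshev δ (n + 2) / chebyshev δ (n + 1)) = 1 := by
    rw [hs, div_mul_div_cancel₀ (hT (n + 1)), div_self (hT n)]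
  have hPQ : P ≫ jw δ (n + 2) = jw δ (n + 2) := hn₁.addStrand_comp
  have hQP : jw δ (n + 2) ≫ P = jw δ (n + 2) := hn₁.comp_addStrand
  have hQ : jw δ (n + 2) ≫ jw δ (n + 2) = jw δ (n + 2) := hn₁.idem_succ
  have hu : P ≫ lastCap δ n ∈ homPart k (pt δ (n + 2)) (pt δ n) 1 := by
    have := Supercategory.comp_mem (hom_self_mem _ P) (lastCap_mem (δ := δ) n)
    rwa [zero_add] at this
  have hv : lastCup δ n ≫ P ∈ homPart k (pt δ n) (pt δ (n + 2)) 1 := by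
    have := Supercategory.comp_mem (lastCup_mem (δ := δ) n) (hom_self_mem _ P)
    rwa [add_zero] at this
  have hu' : s • P ≫ lastCap δ n ∈ homPart k (pt δ (n + 2)) (pt δ n) (a + (a + 1)) := by
    rw [CharTwo.add_cancel_left]
    exact Submodule.smul_mem _ s hu
  have hv' : lastCup δ n ≫ P ∈ homPart k (pt δ n) (pt δ (n + 2)) (a + 1 + a) := by
    rw [add_comm (a + 1) a, CharTwo.add_cancel_left]
    exact hv
  have hcap : P ≫ lastCap δ n ≫ jw δ n = P ≫ lastCap δ n := hn.lastCap_jw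
  have hcup : jw δ n ≫ lastCup δ n ≫ P = lastCup δ n ≫ P := hn.jw_lastCup
  have htr : lastCup δ n ≫ P ≫ lastCap δ n =
      (chebyshev δ (n + 2) / chebyshev δ (n + 1)) • jw δ n := hn.trace
  have hw : P ≫ (s • P ≫ lastCap δ n ≫ lastCup δ n ≫ P) ≫ P =
      s • P ≫ lastCap δ n ≫ lastCup δ n ≫ P := by
    simp only [Linear.comp_smul, Linear.smul_comp, Category.assoc]
    rw [reassoc_of% hP, hP]
  refine K0.mk_eq_add
    (summandHom (jw δ (n + 2)) (end_mem a _) (by rw [reassoc_of% hPQ, hQ]))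
    (summandHom (jw δ (n + 2)) (end_mem a _) (by rw [hQP, hQ]))
    (summandHom (s • P ≫ lastCap δ n) hu' (by
      simp only [Linear.comp_smul, Linear.smul_comp, Category.assoc]
      rw [hcap, reassoc_of% hP]))
    (summandHom (lastCup δ n ≫ P) hv' (by
      rw [Category.assoc, hP, hcup])) ?_ ?_ ?_
  · rw [summandHom_comp _ _ _ _ _ _ (jw δ (n + 2)) (end_mem a _) (by rw [hQP, hPQ]) hQ,
      summandHom_comp _ _ _ _ _ _ (s • P ≫ lastCap δ n ≫ lastCup δ n ≫ P) (end_mem a _)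
        hw (by simp), ← summandHom_id (by rw [hP, hP])]
    refine summandHom_add _ _ _ _ _ _ _ _ _ hE.symm
  · rw [← summandHom_id (by rw [hQ, hQ])]
    exact summandHom_comp _ _ _ _ _ _ _ _ _ hQ
  · rw [← summandHom_id (by rw [hn.idem, hn.idem])]
    refine summandHom_comp _ _ _ _ _ _ _ _ _ ?_
    simp only [Linear.comp_smul, Category.assoc]
    rw [reassoc_of% hP, htr, smul_smul, hst, one_smul]

lemma mk_jwObj_succ_mul_mk_jwObj_one (n : ℕ) (a : Fin 2) :
    K0.mk (jwObj hT (n + 1, a)) * K0.mk (jwObj hT (1, 0)) =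
      K0.mk (jwObj hT (n + 2, a)) + K0.mk (jwObj hT (n, a + 1)) := by
  have hP : addStrand (jw δ (n + 1)) ≫ addStrand (jw δ (n + 1)) = addStrand (jw δ (n + 1)) := by
    rw [← addStrand_comp, (jwSpec hT (n + 1)).idem]
  have h := mk_summand_mul_mk_summand_id (a := a) (b := 0) (l := 1)
    (he := (jwSpec hT (n + 1)).idem) (hl := (jwSpec hT 1).idem) _ hP rfl
  rw [mk_summand_addStrand_jw hT] at h
  refine h.trans ?_
  congr 1
  · exact congrArg (fun b : Fin 2 => K0.mk (jwObj hT (n + 2, b))) (add_zero a)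
  · exact congrArg (fun b : Fin 2 => K0.mk (jwObj hT (n, b + 1))) (add_zero a)

lemma mk_jwObj_zero_zero : K0.mk (jwObj hT (0, 0)) = 1 := by
  rw [K0.one_def]
  refine K0.mk_iso (eqToIso ?_)
  refine (matSummand.matSummand_id (piPt δ 0 0) (Category.comp_id _)).trans ?_
  rfl

lemma jwObj_zero_one : jwObj hT (0, 1) = SKar.piObj k (STL δ) :=
  matSummand.matSummand_id (piPt δ 1 0) (Category.comp_id _)

end STL

/-! ### The Grothendieck ring -/

namespace STL

open LaurentPolynomial

variable {k : Type*} [Field k] {δ : k} (hT : ∀ n, chebyshev δ (n + 1) ≠ 0)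
  (hS : IsSchurianFamily (jwObj hT))

/-- The additive homomorphism that sends the class of the `n`-th simple object of parity `a` to
`π^a [n+1]_{x,π}`. -/
def character : K0 (SKar k (STL δ)) →ₗ[ℤ] LaurentPolynomial ZPi :=
  hS.basis.constr ℤ qintFamily

lemma character_mk (i : ℕ × Fin 2) : character hT hS (K0.mk (jwObj hT i)) = qintFamily i := by
  rw [← hS.basis_apply, character, Module.Basis.constr_basis]

lemma character_injective : Function.Injective (character hT hS) := by
  rw [← LinearMap.ker_eq_bot, LinearMap.ker_eq_bot']
  intro x hx
  rw [character, Module.Basis.constr_apply] at hx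
  have := linearIndependent_iff.1 linearIndependent_qintFamily (hS.basis.repr x) hx
  exact hS.basis.repr.map_eq_zero_iff.1 this

lemma range_character : (LinearMap.range (character hT hS)).toAddSubgroup =
    AddSubgroup.closure (Set.range qintFamily) := by
  rw [character, Module.Basis.constr_range, ← Submodule.span_int_eq_addSubgroupClosure]

lemma C_pi_mul_C_pi : (C ZPi.pi * C ZPi.pi : LaurentPolynomial ZPi) = 1 := by
  rw [← map_mul, ZPi.pi_mul_pi, map_one]

lemma qintFamily_add (n : ℕ) (a b : Fin 2) :
    qintFamily (n, a + b) = qintFamily (n, a) * qintFamily (0, b) := by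
  have h := C_pi_mul_C_pi
  fin_cases a <;> fin_cases b <;> simp [qintFamily, qint_zero]
  · exact mul_comm _ _
  · linear_combination -qint n * h

lemma qintFamily_succ_mul (n : ℕ) (a : Fin 2) : qintFamily (n + 1, a) * qintFamily (1, 0) =
    qintFamily (n + 2, a) + qintFamily (n, a + 1) := by
  have h : qintFamily (0, 1) = C ZPi.pi := by simp [qintFamily, qint_zero]
  rw [qintFamily_add, h]
  have := qint_succ_mul_qint_one n
  simp only [qintFamily, Fin.val_zero, pow_zero, map_one, one_mul]
  linear_combination C (ZPi.pi ^ (a : ℕ)) * this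

/-- Multiplicativity is checked for right factors `π` and `·`; it propagates to all classes of
simple objects by the recursion `[S (n + 2)] = [S (n + 1)] [·] - π [S n]`. -/
lemma character_mul (x y : K0 (SKar k (STL δ))) :
    character hT hS (x * y) = character hT hS x * character hT hS y := by
  have hind : ∀ y, (∀ i, character hT hS (K0.mk (jwObj hT i) * y) =
      qintFamily i * character hT hS y) → ∀ x,
        character hT hS (x * y) = character hT hS x * character hT hS y := by
    intro y h x
    have : character hT hS ∘ₗ LinearMap.mulRight ℤ y =
        LinearMap.mulRight ℤ (character hT hS y) ∘ₗ character hT hS :=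
      hS.basis.ext fun i => by
        simp only [LinearMap.comp_apply, LinearMap.mulRight_apply, hS.basis_apply, character_mk, h]
    exact LinearMap.congr_fun this x
  have h₀ : ∀ (b : Fin 2) x, character hT hS (x * K0.mk (jwObj hT (0, b))) =
      character hT hS x * qintFamily (0, b) := fun b x => by
    rw [← character_mk hT hS (0, b)]
    refine hind _ (fun i => ?_) x
    obtain ⟨n, a⟩ := i
    rw [mk_jwObj_mul_mk_jwObj_zero, character_mk, character_mk, qintFamily_add]
  have h₁ : ∀ x, character hT hS (x * K0.mk (jwObj hT (1, 0))) =
      character hT hS x * qintFamily (1, 0) := fun x => by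
    rw [← character_mk hT hS (1, 0)]
    refine hind _ (fun i => ?_) x
    obtain ⟨n, a⟩ := i
    rcases n with _ | n
    · rw [mk_jwObj_zero_mul_mk_jwObj_one, character_mk, character_mk, mul_comm,
        ← qintFamily_add, zero_add]
    · rw [mk_jwObj_succ_mul_mk_jwObj_one, map_add, character_mk, character_mk, character_mk,
        qintFamily_succ_mul]
  have hn : ∀ n (b : Fin 2) x, character hT hS (x * K0.mk (jwObj hT (n, b))) =
      character hT hS x * qintFamily (n, b) := by
    intro n
    induction n using Nat.twoStepInduction with
    | zero => exact h₀
    | one =>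
      intro b x
      rw [← mk_jwObj_zero_mul_mk_jwObj_one, ← mul_assoc, h₁, h₀, mul_assoc, mul_comm (qintFamily _),
        ← qintFamily_add, zero_add]
    | more n ih ih' =>
      intro b x
      rw [← add_sub_cancel_right (K0.mk (jwObj hT (n + 2, b))) (K0.mk (jwObj hT (n, b + 1))),
        ← mk_jwObj_succ_mul_mk_jwObj_one, mul_sub, map_sub, ← mul_assoc, h₁, ih', ih, mul_assoc,
        qintFamily_succ_mul]
      ring
  have : character hT hS ∘ₗ LinearMap.mulLeft ℤ x =
      LinearMap.mulLeft ℤ (character hT hS x) ∘ₗ character hT hS :=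
    hS.basis.ext fun i => by
      simp only [LinearMap.comp_apply, LinearMap.mulLeft_apply, hS.basis_apply, character_mk, hn]
  exact LinearMap.congr_fun this y

lemma character_one : character hT hS 1 = 1 := by
  rw [← mk_jwObj_zero_zero hT, character_mk]
  simp [qintFamily, qint_zero]

/-- The character, as a homomorphism of rings. -/
def characterRingHom : K0 (SKar k (STL δ)) →+* LaurentPolynomial ZPi :=
  RingHom.mk' ⟨⟨character hT hS, character_one hT hS⟩, character_mul hT hS⟩
    (map_add (character hT hS))

end STL

end

theorem mainTheorem3 {k : Type*} [Field k] (hk : ringChar k ≠ 2) (q : k) (hq₀ : q ≠ 0)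
    (hq : ∀ n : ℕ, 0 < n → q ^ n ≠ 1) (δ : k) (hδ : δ = -(q - q⁻¹)) :
    IsSemisimpleAbelian (SKar k (STL δ)) ∧
    K0.HasSimpleBasis (SKar k (STL δ)) ∧
    LinearIndependent ℤ qintFamily ∧
    ∃ R : Subring (LaurentPolynomial ZPi),
      R.toAddSubgroup = AddSubgroup.closure (Set.range qintFamily) ∧
      ∃ φ : K0 (SKar k (STL δ)) ≃+* R,
        (∀ x, x ∈ K0.simpleClasses (SKar k (STL δ)) ↔
          (φ x : LaurentPolynomial ZPi) ∈ Set.range qintFamily) ∧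
        (φ (K0.mk (SKar.piObj k (STL δ))) : LaurentPolynomial ZPi) =
          LaurentPolynomial.C ZPi.pi := by
  have hT : ∀ n, STL.chebyshev δ (n + 1) ≠ 0 := by
    rw [hδ]
    exact STL.chebyshev_ne_zero hq₀ hq
  have hS := STL.isSchurianFamily_jwObj hT (OddTL.id_zero_ne_zero hq₀ hδ)
  have hinj := STL.character_injective hT hS
  refine ⟨hS.isSemisimpleAbelian, hS.hasSimpleBasis, linearIndependent_qintFamily,
    (STL.characterRingHom hT hS).range, STL.range_character hT hS,
    RingEquiv.ofBijective (STL.characterRingHom hT hS).rangeRestrict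
      ⟨fun x y h => hinj (congrArg Subtype.val h), RingHom.rangeRestrict_surjective _⟩,
    fun x => ?_, ?_⟩
  · change _ ↔ STL.character hT hS x ∈ _
    rw [hS.simpleClasses_eq]
    constructor
    · rintro ⟨i, rfl⟩
      exact ⟨i, (STL.character_mk hT hS i).symm⟩
    · rintro ⟨i, hi⟩
      exact ⟨i, hinj ((STL.character_mk hT hS i).trans hi)⟩
  · change STL.character hT hS _ = _
    rw [← STL.jwObj_zero_one hT, STL.character_mk]
    simp [qintFamily, qint_zero]
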